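/- **Theorem (existence and uniqueness of the Cartan canonical connection).** *Setting.* Let $T$ and $M$ be smooth manifolds of dimensions $p$ and $n$, with local coordinates $(t^\alpha)$ and $(x^i)$, and let $E=J^1(T,M)\to T\times M$ be the first order jet bundle, whose fibre over $(t,x)$ is $\mathrm{Hom}(T_tT,T_xM)$, with induced coordinates $(t^\alpha,x^i,x^i_\alpha)$. Repeated indices are summed. Let $h=(h_{\alpha\beta}(t))$ be a smooth semi-Riemannian metric on $T$, with inverse $(h^{\alpha\beta})$ and Christoffel symbols $H^\gamma_{\alpha\beta}$. Let $L:E\to\mathbb R$ be a smooth Kronecker $h$-regular Lagrangian function, i.e. in all induced coordinates $$\tfrac12\,\frac{\partial^2L}{\partial x^i_\alpha\,\partial x^j_\beta}=h^{\alpha\beta}\,g_{ij},$$ where $g_{ij}(t^\gamma,x^k,x^k_\gamma)$ is a smooth symmetric d-tensor on $E$ (at each point of $E$ over $(t,x)$, a symmetric bilinear form on $T_xM$) of rank $n$ and constant signature; let $(g^{ij})$ be its inverse. The pair $(E,L)$ is a metrical multi-time Lagrange space. *Canonical nonlinear connection.* Put $$2\mathcal G^k=\frac{g^{ki}}2\Big\{\frac{\partial^2L}{\partial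 x^j\partial x^i_\alpha}x^j_\alpha-\frac{\partial L}{\partial x^i}+\frac{\partial^2L}{\partial t^\alpha\partial x^i_\alpha}+\frac{\partial L}{\partial x^i_\alpha}H^\gamma_{\alpha\gamma}+2g_{ij}h^{\alpha\beta}H^\gamma_{\alpha\beta}x^j_\gamma\Big\},$$ $$M^{(i)}_{(\alpha)\beta}=-H^\gamma_{\alpha\beta}x^i_\gamma,\qquad N^{(i)}_{(\alpha)j}=h_{\alpha\gamma}\frac{\partial\mathcal G^i}{\partial x^j_\gamma},$$ and let $\Gamma=(M^{(i)}_{(\alpha)\beta},N^{(i)}_{(\alpha)j})$. The adapted basis of $\Gamma$ consists of $$\frac{\delta}{\delta t^\alpha}=\frac{\partial}{\partial t^\alpha}-M^{(j)}_{(\beta)\alpha}\frac{\partial}{\partial x^j_\beta},\qquad \frac{\delta}{\delta x^i}=\frac{\partial}{\partial x^i}-N^{(j)}_{(\beta)i}\frac{\partial}{\partial x^j_\beta},\qquad \frac{\partial}{\partial x^i_\alpha};$$ let $h_T,h_M,v$ be the projections of the corresponding decomposition of $TE$. *Connections.* A $\Gamma$-linear connection is a smooth linear connection $\nabla$ on (the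 tangent bundle of) $E$ with $\nabla h_T=0$, $\nabla h_M=0$, $\nabla v=0$. Define its coefficients by $$\nabla_{\delta/\delta t^\gamma}\tfrac{\delta}{\delta t^\beta}=\bar G^\alpha_{\beta\gamma}\tfrac{\delta}{\delta t^\alpha},\quad \nabla_{\delta/\delta x^j}\tfrac{\delta}{\delta t^\beta}=\bar L^\alpha_{\beta j}\tfrac{\delta}{\delta t^\alpha},\quad \nabla_{\partial/\partial x^j_\gamma}\tfrac{\delta}{\delta t^\beta}=\bar C^{\alpha(\gamma)}_{\beta(j)}\tfrac{\delta}{\delta t^\alpha},$$ $$\nabla_{\delta/\delta t^\gamma}\tfrac{\delta}{\delta x^i}=G^k_{i\gamma}\tfrac{\delta}{\delta x^k},\quad \nabla_{\delta/\delta x^j}\tfrac{\delta}{\delta x^i}=L^k_{ij}\tfrac{\delta}{\delta x^k},\quad \nabla_{\partial/\partial x^j_\gamma}\tfrac{\delta}{\delta x^i}=C^{k(\gamma)}_{i(j)}\tfrac{\delta}{\delta x^k}.$$ It is $h$-normal if $\bar G^\alpha_{\beta\gamma}=H^\alpha_{\beta\gamma}$, $\bar L^\alpha_{\beta j}=0$,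 $\bar C^{\alpha(\gamma)}_{\beta(j)}=0$ and $\nabla J=0$, where $J=h_{\alpha\beta}\,\frac{\partial}{\partial x^i_\alpha}\otimes dt^\beta\otimes dx^i$. Its horizontal and vertical covariant derivatives of $g$ are $$g_{ij|k}=\frac{\delta g_{ij}}{\delta x^k}-g_{mj}L^m_{ik}-g_{im}L^m_{jk},\qquad g_{ij}|^{(\gamma)}_{(k)}=\frac{\partial g_{ij}}{\partial x^k_\gamma}-g_{mj}C^{m(\gamma)}_{i(k)}-g_{im}C^{m(\gamma)}_{j(k)}.$$ *Conclusion.* There is a unique $h$-normal $\Gamma$-linear connection $C\Gamma=(H^\gamma_{\alpha\beta},G^k_{j\gamma},L^i_{jk},C^{i(\gamma)}_{j(k)})$ on $E$ such that, in all induced coordinates, 1. $g_{ij|k}=0$ and $g_{ij}|^{(\gamma)}_{(k)}=0$; 2. $G^k_{j\gamma}=\dfrac{g^{ki}}2\dfrac{\delta g_{ij}}{\delta t^\gamma}$, $\quad L^k_{ij}=L^k_{ji}$, $\quad C^{i(\gamma)}_{j(k)}=C^{i(\gamma)}_{k(j)}$. Moreover, its coefficients $L$ and $C$ are given by $$L^i_{jk}=\frac{g^{im}}2\Big(\frac{\delta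 g_{jm}}{\delta x^k}+\frac{\delta g_{km}}{\delta x^j}-\frac{\delta g_{jk}}{\delta x^m}\Big),\qquad C^{i(\gamma)}_{j(k)}=\frac{g^{im}}2\Big(\frac{\partial g_{jm}}{\partial x^k_\gamma}+\frac{\partial g_{km}}{\partial x^j_\gamma}-\frac{\partial g_{jk}}{\partial x^m_\gamma}\Big).$$ -/

import Mathlib

open scoped Manifold ContDiff

noncomputable section

namespace MultiTime

open Bundle

/-! ## The first order jet bundle `J¹(T, M)` as a smooth manifold -/

/-- Coordinate space of dimension `m`. -/
abbrev Vec (m : ℕ) : Type := EuclideanSpace ℝ (Fin m)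

/-- The coordinate space of `J¹(T, M)`: points `((t, x), A)`, where `A` has the entries
`x^i_α = (A e_α)_i`. -/
abbrev JetModel (p n : ℕ) : Type := (Vec p × Vec n) × (Vec p →L[ℝ] Vec n)

instance pullbackAddCommGroup {B B' : Type*} (f : B' → B) (E : B → Type*)
    [∀ x, AddCommGroup (E x)] (x : B') : AddCommGroup ((f *ᵖ E) x) :=
  inferInstanceAs (AddCommGroup (E (f x)))

instance pullbackIsTopologicalAddGroup {B B' : Type*} (f : B' → B) (E : B → Type*)
    [∀ x, AddCommGroup (E x)] [∀ x, TopologicalSpace (E x)]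
    [∀ x, IsTopologicalAddGroup (E x)] (x : B') : IsTopologicalAddGroup ((f *ᵖ E) x) :=
  inferInstanceAs (IsTopologicalAddGroup (E (f x)))

instance pullbackContinuousSMul {B B' : Type*} (f : B' → B) (E : B → Type*)
    [∀ x, AddCommGroup (E x)] [∀ x, Module ℝ (E x)] [∀ x, TopologicalSpace (E x)]
    [∀ x, ContinuousSMul ℝ (E x)] (x : B') : ContinuousSMul ℝ ((f *ᵖ E) x) :=
  inferInstanceAs (ContinuousSMul ℝ (E (f x)))

/-- The model with corners of `J¹(T, M)` (there are no corners). -/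
abbrev jetI (p n : ℕ) :
    ModelWithCorners ℝ (JetModel p n)
      (ModelProd (ModelProd (Vec p) (Vec n)) (Vec p →L[ℝ] Vec n)) :=
  ((𝓡 p).prod (𝓡 n)).prod 𝓘(ℝ, Vec p →L[ℝ] Vec n)

section Manifolds

variable (p n : ℕ)
  (T : Type*) [TopologicalSpace T] [ChartedSpace (Vec p) T] [IsManifold (𝓡 p) ∞ T]
  (M : Type*) [TopologicalSpace M] [ChartedSpace (Vec n) M] [IsManifold (𝓡 n) ∞ M]

/-- The tangent bundle of `T`, pulled back to `T × M`. -/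
abbrev TimeBundle : T × M → Type _ :=
  (ContMDiffMap.fst : C^∞⟮(𝓡 p).prod (𝓡 n), T × M; 𝓡 p, T⟯) *ᵖ
    (TangentSpace (𝓡 p) : T → Type _)

/-- The tangent bundle of `M`, pulled back to `T × M`. -/
abbrev SpaceBundle : T × M → Type _ :=
  (ContMDiffMap.snd : C^∞⟮(𝓡 p).prod (𝓡 n), T × M; 𝓡 n, M⟯) *ᵖ
    (TangentSpace (𝓡 n) : M → Type _)

/-- The jet bundle `J¹(T, M)`: a point over `(t, x)` is a linear map `T_t T → T_x M`. -/
abbrev J1 : Type _ :=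
  TotalSpace (Vec p →L[ℝ] Vec n)
    (fun q : T × M => TimeBundle p n T M q →L[ℝ] SpaceBundle p n T M q)

instance instTopologicalSpaceJ1 : TopologicalSpace (J1 p n T M) := inferInstance

instance instChartedSpaceJ1 :
    ChartedSpace (ModelProd (ModelProd (Vec p) (Vec n)) (Vec p →L[ℝ] Vec n)) (J1 p n T M) :=
  inferInstance

instance instIsManifoldJ1 : IsManifold (jetI p n) ∞ (J1 p n T M) := inferInstance

instance instIsManifoldOneJ1 : IsManifold (jetI p n) 1 (J1 p n T M) := inferInstance

end Manifolds

section Charts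

variable {p n : ℕ}
  {T : Type*} [TopologicalSpace T] [ChartedSpace (Vec p) T] [IsManifold (𝓡 p) ∞ T]
  {M : Type*} [TopologicalSpace M] [ChartedSpace (Vec n) M] [IsManifold (𝓡 n) ∞ M]

variable (p n T M) in
/-- A pair of smooth charts: `(t^α)` on `T` and `(x^i)` on `M`. -/
structure JetChart where
  time : OpenPartialHomeomorph T (Vec p)
  time_mem : time ∈ IsManifold.maximalAtlas (𝓡 p) ∞ T
  space : OpenPartialHomeomorph M (Vec n)
  space_mem : space ∈ IsManifold.maximalAtlas (𝓡 n) ∞ M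

namespace JetChart

/-- The domain in `J¹(T, M)` of the coordinates induced by a pair of charts. -/
def source (c : JetChart p n T M) : Set (J1 p n T M) :=
  {e | e.1.1 ∈ c.time.source ∧ e.1.2 ∈ c.space.source}

/-- The range of the induced coordinates. -/
def target (c : JetChart p n T M) : Set (JetModel p n) :=
  {y | y.1.1 ∈ c.time.target ∧ y.1.2 ∈ c.space.target}

/-- The induced coordinates `(t^α, x^i, x^i_α)`. -/
def coord (c : JetChart p n T M) (e : J1 p n T M) : JetModel p n :=
  ((c.time e.1.1, c.space e.1.2),
    (mfderiv (𝓡 n) (𝓡 n) c.space e.1.2 : TangentSpace (𝓡 n) e.1.2 →L[ℝ] Vec n) ∘L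
      (e.2 : TangentSpace (𝓡 p) e.1.1 →L[ℝ] TangentSpace (𝓡 n) e.1.2) ∘L
        (ContinuousLinearMap.inverse
          (mfderiv (𝓡 p) (𝓡 p) c.time e.1.1 : TangentSpace (𝓡 p) e.1.1 →L[ℝ] Vec p)))

/-- The inverse of the induced coordinates. -/
def param (c : JetChart p n T M) (y : JetModel p n) : J1 p n T M :=
  ⟨(c.time.symm y.1.1, c.space.symm y.1.2),
    ((ContinuousLinearMap.inverse
        (mfderiv (𝓡 n) (𝓡 n) c.space (c.space.symm y.1.2) :
          TangentSpace (𝓡 n) (c.space.symm y.1.2) →L[ℝ] Vec n)) ∘L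
      y.2 ∘L
        (mfderiv (𝓡 p) (𝓡 p) c.time (c.time.symm y.1.1) :
          TangentSpace (𝓡 p) (c.time.symm y.1.1) →L[ℝ] Vec p) :
      TangentSpace (𝓡 p) (c.time.symm y.1.1) →L[ℝ]
        TangentSpace (𝓡 n) (c.space.symm y.1.2))⟩

end JetChart

/-- The coordinate vector `∂/∂u^a` at the point with coordinates `u` of a chart `φ`. -/
def coordVec {m : ℕ} {X : Type*} [TopologicalSpace X] [ChartedSpace (Vec m) X]
    (φ : OpenPartialHomeomorph X (Vec m)) (a : Fin m) (u : Vec m) :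
    TangentSpace (𝓡 m) (φ.symm u) :=
  ContinuousLinearMap.inverse
    (mfderiv (𝓡 m) (𝓡 m) φ (φ.symm u) : TangentSpace (𝓡 m) (φ.symm u) →L[ℝ] Vec m)
    (EuclideanSpace.single a 1)

/-- The bilinear form `B` takes the diagonal values `ε` (signs) in some basis. -/
def HasSignature {m : ℕ} {V : Type*} [AddCommGroup V] [Module ℝ V]
    (B : LinearMap.BilinForm ℝ V) (ε : Fin m → ℤˣ) : Prop :=
  ∃ b : Module.Basis (Fin m) ℝ V, ∀ i j, B (b i) (b j) = if i = j then ((ε i : ℤ) : ℝ) else 0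

/-! ## Partial derivatives on the coordinate space -/

/-- The direction of the coordinate `x^i_α`. -/
def vertUnit (i : Fin n) (α : Fin p) : Vec p →L[ℝ] Vec n :=
  (EuclideanSpace.proj α : Vec p →L[ℝ] ℝ).smulRight (EuclideanSpace.single i (1 : ℝ))

/-- `∂f/∂t^α`. -/
def dT (α : Fin p) (f : JetModel p n → ℝ) (y : JetModel p n) : ℝ :=
  fderiv ℝ f y ((EuclideanSpace.single α 1, 0), 0)

/-- `∂f/∂x^i`. -/
def dX (i : Fin n) (f : JetModel p n → ℝ) (y : JetModel p n) : ℝ :=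
  fderiv ℝ f y ((0, EuclideanSpace.single i 1), 0)

/-- `∂f/∂x^i_α`. -/
def dV (i : Fin n) (α : Fin p) (f : JetModel p n → ℝ) (y : JetModel p n) : ℝ :=
  fderiv ℝ f y ((0, 0), vertUnit i α)

/-- The coordinate function `x^i_α`. -/
def vel (i : Fin n) (α : Fin p) (y : JetModel p n) : ℝ :=
  (y.2 (EuclideanSpace.single α 1)) i

/-! ## The temporal metric -/

/-- The components `h_{αβ}` in the chart `φ`, as functions of the coordinates. -/
def timeCoeff (B : ∀ t : T, LinearMap.BilinForm ℝ (TangentSpace (𝓡 p) t))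
    (φ : OpenPartialHomeomorph T (Vec p)) (α β : Fin p) (u : Vec p) : ℝ :=
  B (φ.symm u) (coordVec φ α u) (coordVec φ β u)

variable (p T) in
/-- A smooth semi-Riemannian metric on `T`. -/
structure SemiRiemannianMetric where
  form : ∀ t : T, LinearMap.BilinForm ℝ (TangentSpace (𝓡 p) t)
  symm : ∀ t, (form t).IsSymm
  nondegenerate : ∀ t, (form t).Nondegenerate
  signature : ∃ ε : Fin p → ℤˣ, ∀ t, HasSignature (form t) ε
  smooth : ∀ φ ∈ IsManifold.maximalAtlas (𝓡 p) ∞ T, ∀ α β,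
    ContDiffOn ℝ ∞ (timeCoeff form φ α β) φ.target

namespace SemiRiemannianMetric

variable (h : SemiRiemannianMetric p T)

/-- `h_{αβ}`. -/
def lo (φ : OpenPartialHomeomorph T (Vec p)) (α β : Fin p) (u : Vec p) : ℝ :=
  timeCoeff h.form φ α β u

/-- `h^{αβ}`. -/
def up (φ : OpenPartialHomeomorph T (Vec p)) (α β : Fin p) (u : Vec p) : ℝ :=
  (Matrix.of fun α β => h.lo φ α β u)⁻¹ α β

/-- The Christoffel symbols `H^γ_{αβ}` of `h`. -/
def christoffel (φ : OpenPartialHomeomorph T (Vec p)) (γ α β : Fin p) (u : Vec p) : ℝ :=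
  ∑ μ, h.up φ γ μ u / 2 *
    (fderiv ℝ (h.lo φ α μ) u (EuclideanSpace.single β 1)
      + fderiv ℝ (h.lo φ β μ) u (EuclideanSpace.single α 1)
      - fderiv ℝ (h.lo φ α β) u (EuclideanSpace.single μ 1))

end SemiRiemannianMetric

/-! ## Metrical multi-time Lagrange spaces -/

/-- The components `g_{ij}` of a d-tensor in the induced coordinates. -/
def spaceCoeff (g : ∀ e : J1 p n T M, LinearMap.BilinForm ℝ (TangentSpace (𝓡 n) e.1.2))
    (c : JetChart p n T M) (i j : Fin n) (y : JetModel p n) : ℝ :=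
  g (c.param y) (coordVec c.space i y.1.2) (coordVec c.space j y.1.2)

variable (n M) in
/-- A metrical multi-time Lagrange space over `(T, h)` and `M`: a smooth Kronecker `h`-regular
Lagrangian function `L` on `J¹(T, M)`, that is
`(1/2) ∂²L/∂x^i_α∂x^j_β = h^{αβ} g_{ij}` with `g` a smooth symmetric d-tensor of rank `n` and
of constant signature. -/
structure LagrangeSpace (h : SemiRiemannianMetric p T) where
  L : J1 p n T M → ℝ
  smooth : ContMDiff (jetI p n) 𝓘(ℝ, ℝ) ∞ L
  g : ∀ e : J1 p n T M, LinearMap.BilinForm ℝ (TangentSpace (𝓡 n) e.1.2)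
  g_symm : ∀ e, (g e).IsSymm
  g_nondegenerate : ∀ e, (g e).Nondegenerate
  g_signature : ∃ ε : Fin n → ℤˣ, ∀ e, HasSignature (g e) ε
  g_smooth : ∀ (c : JetChart p n T M) (i j : Fin n),
    ContDiffOn ℝ ∞ (spaceCoeff g c i j) c.target
  kronecker : ∀ (c : JetChart p n T M), ∀ y ∈ c.target, ∀ (i j : Fin n) (α β : Fin p),
    (1 / 2 : ℝ) * dV i α (dV j β (fun z => L (c.param z))) y
      = h.up c.time α β y.1.1 * spaceCoeff g c i j y

namespace LagrangeSpace

variable {h : SemiRiemannianMetric p T} (S : LagrangeSpace n M h) (c : JetChart p n T M)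

/-- `g_{ij}`. -/
def lo (i j : Fin n) (y : JetModel p n) : ℝ := spaceCoeff S.g c i j y

/-- `g^{ij}`. -/
def up (i j : Fin n) (y : JetModel p n) : ℝ := (Matrix.of fun i j => S.lo c i j y)⁻¹ i j

/-- `L` in coordinates. -/
def lag (y : JetModel p n) : ℝ := S.L (c.param y)

/-! ### The canonical nonlinear connection -/

/-- The `h`-trace `𝒢^k = h^{αβ} G^{(k)}_{(α)β}` of the canonical spatial spray. The
Euler–Lagrange equations of `L √|h|` read
`h^{αβ} (x^k_{αβ} - H^γ_{αβ} x^k_γ) + 2 𝒢^k = 0`. -/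
def spray (k : Fin n) (y : JetModel p n) : ℝ :=
  (1 / 2 : ℝ) * ∑ i, S.up c k i y / 2 *
    ((∑ j, ∑ α, dX j (dV i α (S.lag c)) y * vel j α y)
      - dX i (S.lag c) y
      + (∑ α, dT α (dV i α (S.lag c)) y)
      + (∑ α, ∑ γ, dV i α (S.lag c) y * h.christoffel c.time γ α γ y.1.1)
      + 2 * ∑ j, ∑ α, ∑ β, ∑ γ, S.lo c i j y * h.up c.time α β y.1.1 *
          h.christoffel c.time γ α β y.1.1 * vel j γ y)

/-- The temporal components `M^{(i)}_{(α)β} = -H^γ_{αβ} x^i_γ`. -/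
def temporal (_S : LagrangeSpace n M h) (c : JetChart p n T M) (i : Fin n) (α β : Fin p) (y : JetModel p n) : ℝ :=
  -∑ γ, h.christoffel c.time γ α β y.1.1 * vel i γ y

/-- The spatial components `N^{(i)}_{(α)j} = h_{αγ} ∂𝒢^i/∂x^j_γ`. -/
def spatial (i : Fin n) (α : Fin p) (j : Fin n) (y : JetModel p n) : ℝ :=
  ∑ γ, h.lo c.time α γ y.1.1 * dV j γ (S.spray c i) y

/-! ### The adapted bases -/

/-- `δf/δt^α` for a function `f` of the coordinates. -/
def deltaT (α : Fin p) (f : JetModel p n → ℝ) (y : JetModel p n) : ℝ :=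
  dT α f y - ∑ j, ∑ β, S.temporal c j β α y * dV j β f y

/-- `δf/δx^i` for a function `f` of the coordinates. -/
def deltaX (i : Fin n) (f : JetModel p n → ℝ) (y : JetModel p n) : ℝ :=
  dX i f y - ∑ j, ∑ β, S.spatial c j β i y * dV j β f y

/-- The vector field `δ/δt^α` on the chart domain. -/
def frameT (α : Fin p) : ∀ e : J1 p n T M, TangentSpace (jetI p n) e :=
  VectorField.mpullback (jetI p n) 𝓘(ℝ, JetModel p n) c.coord
    (fun y => (((EuclideanSpace.single α 1, 0),
      -∑ j, ∑ β, S.temporal c j β α y • vertUnit j β) : JetModel p n))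

/-- The vector field `δ/δx^i` on the chart domain. -/
def frameX (i : Fin n) : ∀ e : J1 p n T M, TangentSpace (jetI p n) e :=
  VectorField.mpullback (jetI p n) 𝓘(ℝ, JetModel p n) c.coord
    (fun y => (((0, EuclideanSpace.single i 1),
      -∑ j, ∑ β, S.spatial c j β i y • vertUnit j β) : JetModel p n))

end LagrangeSpace

/-- The vector field `∂/∂x^i_α` on the chart domain. -/
def JetChart.frameV (c : JetChart p n T M) (i : Fin n) (α : Fin p) :
    ∀ e : J1 p n T M, TangentSpace (jetI p n) e :=
  VectorField.mpullback (jetI p n) 𝓘(ℝ, JetModel p n) c.coord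
    (fun _ => (((0, 0), vertUnit i α) : JetModel p n))

/-- The components of a tangent vector of `J¹(T, M)` in the natural basis
`∂/∂t^α, ∂/∂x^i, ∂/∂x^i_α`. -/
def JetChart.components (c : JetChart p n T M) (e : J1 p n T M)
    (v : TangentSpace (jetI p n) e) : JetModel p n :=
  mfderiv (jetI p n) 𝓘(ℝ, JetModel p n) c.coord e v

/-- `dt^α`. -/
def JetChart.coframeT (c : JetChart p n T M) (α : Fin p) (e : J1 p n T M)
    (v : TangentSpace (jetI p n) e) : ℝ := (c.components e v).1.1 α

/-- `dx^i`. -/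
def JetChart.coframeX (c : JetChart p n T M) (i : Fin n) (e : J1 p n T M)
    (v : TangentSpace (jetI p n) e) : ℝ := (c.components e v).1.2 i

namespace LagrangeSpace

variable {h : SemiRiemannianMetric p T} (S : LagrangeSpace n M h) (c : JetChart p n T M)

/-- `δx^i_α = dx^i_α + M^{(i)}_{(α)β} dt^β + N^{(i)}_{(α)j} dx^j`. -/
def coframeV (i : Fin n) (α : Fin p) (e : J1 p n T M)
    (v : TangentSpace (jetI p n) e) : ℝ :=
  vel i α (c.components e v)
    + (∑ β, S.temporal c i α β (c.coord e) * c.coframeT β e v)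
    + ∑ j, S.spatial c i α j (c.coord e) * c.coframeX j e v

/-- The projection `h_T` of the adapted decomposition. -/
def projT (e : J1 p n T M) (v : TangentSpace (jetI p n) e) : TangentSpace (jetI p n) e :=
  ∑ α, c.coframeT α e v • S.frameT c α e

/-- The projection `h_M` of the adapted decomposition. -/
def projX (e : J1 p n T M) (v : TangentSpace (jetI p n) e) : TangentSpace (jetI p n) e :=
  ∑ i, c.coframeX i e v • S.frameX c i e

/-- The projection `v` of the adapted decomposition. -/
def projV (e : J1 p n T M) (w : TangentSpace (jetI p n) e) : TangentSpace (jetI p n) e :=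
  ∑ i, ∑ α, S.coframeV c i α e w • c.frameV i α e

end LagrangeSpace

/-- The normalization d-tensor `J = h_{αβ} ∂/∂x^i_α ⊗ dt^β ⊗ dx^i`, applied to `v` and `w`. -/
def normalization (h : SemiRiemannianMetric p T) (c : JetChart p n T M) (e : J1 p n T M)
    (v w : TangentSpace (jetI p n) e) : TangentSpace (jetI p n) e :=
  ∑ i, ∑ α, ∑ β, (h.lo c.time α β (c.time e.1.1) * c.coframeT β e v * c.coframeX i e w) •
    c.frameV i α e

/-! ## Linear connections on `J¹(T, M)` -/

variable (p n T M) in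
/-- Linear connections on `J¹(T, M)`: `D Y e v` is `∇_v Y` at the point `e`. -/
abbrev LinearConnection : Type _ :=
  CovariantDerivative (jetI p n) (JetModel p n)
    (TangentSpace (jetI p n) : J1 p n T M → Type _)

/-- The vector field `Y` is differentiable at `e`. -/
def DiffFieldAt (Y : ∀ e : J1 p n T M, TangentSpace (jetI p n) e) (e : J1 p n T M) : Prop :=
  MDifferentiableAt (jetI p n) (jetI p n).tangent
    (fun e' => (⟨e', Y e'⟩ : TangentBundle (jetI p n) (J1 p n T M))) e

namespace LagrangeSpace

variable {h : SemiRiemannianMetric p T} (S : LagrangeSpace n M h)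
  (D : LinearConnection p n T M)

/-- `D` is a smooth `Γ`-linear connection for the canonical nonlinear connection `Γ`:
`∇ h_T = 0`, `∇ h_M = 0` and `∇ v = 0`. -/
structure IsGammaLinear : Prop where
  smooth : CovariantDerivative.ContMDiffCovariantDerivative D ∞
  projT : ∀ (c : JetChart p n T M), ∀ e ∈ c.source, ∀ Y, DiffFieldAt Y e →
    ∀ v, D (fun e' => S.projT c e' (Y e')) e v = S.projT c e (D Y e v)
  projX : ∀ (c : JetChart p n T M), ∀ e ∈ c.source, ∀ Y, DiffFieldAt Y e →
    ∀ v, D (fun e' => S.projX c e' (Y e')) e v = S.projX c e (D Y e v)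
  projV : ∀ (c : JetChart p n T M), ∀ e ∈ c.source, ∀ Y, DiffFieldAt Y e →
    ∀ v, D (fun e' => S.projV c e' (Y e')) e v = S.projV c e (D Y e v)

variable (c : JetChart p n T M)

/-- `Ḡ^α_{βγ}`: the `δ/δt^α` component of `∇_{δ/δt^γ} δ/δt^β`. -/
def coeffGbar (α β γ : Fin p) (e : J1 p n T M) : ℝ :=
  c.coframeT α e (D (S.frameT c β) e (S.frameT c γ e))

/-- `L̄^α_{βj}`: the `δ/δt^α` component of `∇_{δ/δx^j} δ/δt^β`. -/
def coeffLbar (α β : Fin p) (j : Fin n) (e : J1 p n T M) : ℝ :=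
  c.coframeT α e (D (S.frameT c β) e (S.frameX c j e))

/-- `C̄^{α(γ)}_{β(j)}`: the `δ/δt^α` component of `∇_{∂/∂x^j_γ} δ/δt^β`. -/
def coeffCbar (α β : Fin p) (j : Fin n) (γ : Fin p) (e : J1 p n T M) : ℝ :=
  c.coframeT α e (D (S.frameT c β) e (c.frameV j γ e))

/-- `G^k_{iγ}`: the `δ/δx^k` component of `∇_{δ/δt^γ} δ/δx^i`. -/
def coeffG (k i : Fin n) (γ : Fin p) (e : J1 p n T M) : ℝ :=
  c.coframeX k e (D (S.frameX c i) e (S.frameT c γ e))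

/-- `L^k_{ij}`: the `δ/δx^k` component of `∇_{δ/δx^j} δ/δx^i`. -/
def coeffL (k i j : Fin n) (e : J1 p n T M) : ℝ :=
  c.coframeX k e (D (S.frameX c i) e (S.frameX c j e))

/-- `C^{k(γ)}_{i(j)}`: the `δ/δx^k` component of `∇_{∂/∂x^j_γ} δ/δx^i`. -/
def coeffC (k i j : Fin n) (γ : Fin p) (e : J1 p n T M) : ℝ :=
  c.coframeX k e (D (S.frameX c i) e (c.frameV j γ e))

/-- `D` is an `h`-normal `Γ`-linear connection: `Ḡ^α_{βγ} = H^α_{βγ}`, `L̄ = 0`, `C̄ = 0` and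
`∇ J = 0`. -/
structure IsHNormal : Prop extends S.IsGammaLinear D where
  gbar : ∀ (c : JetChart p n T M), ∀ e ∈ c.source, ∀ α β γ,
    S.coeffGbar D c α β γ e = h.christoffel c.time α β γ (c.time e.1.1)
  lbar : ∀ (c : JetChart p n T M), ∀ e ∈ c.source, ∀ α β j, S.coeffLbar D c α β j e = 0
  cbar : ∀ (c : JetChart p n T M), ∀ e ∈ c.source, ∀ α β j γ, S.coeffCbar D c α β j γ e = 0
  nablaJ : ∀ (c : JetChart p n T M), ∀ e ∈ c.source, ∀ X Y, DiffFieldAt X e → DiffFieldAt Y e →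
    ∀ v, D (fun e' => normalization h c e' (X e') (Y e')) e v
      = normalization h c e (D X e v) (Y e) + normalization h c e (X e) (D Y e v)

/-- The `M`-horizontal covariant derivative `g_{ij|k}`. -/
def gCovX (i j k : Fin n) (e : J1 p n T M) : ℝ :=
  S.deltaX c k (S.lo c i j) (c.coord e)
    - (∑ m, S.lo c m j (c.coord e) * S.coeffL D c m i k e)
    - ∑ m, S.lo c i m (c.coord e) * S.coeffL D c m j k e

/-- The vertical covariant derivative `g_{ij}|^{(γ)}_{(k)}`. -/
def gCovV (i j k : Fin n) (γ : Fin p) (e : J1 p n T M) : ℝ :=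
  dV k γ (S.lo c i j) (c.coord e)
    - (∑ m, S.lo c m j (c.coord e) * S.coeffC D c m i k γ e)
    - ∑ m, S.lo c i m (c.coord e) * S.coeffC D c m j k γ e

/-- `D` is a Cartan connection: an `h`-normal `Γ`-linear connection with
`g_{ij|k} = 0`, `g_{ij}|^{(γ)}_{(k)} = 0`, `G^k_{jγ} = (g^{ki}/2) δg_{ij}/δt^γ`,
`L^k_{ij} = L^k_{ji}` and `C^{i(γ)}_{j(k)} = C^{i(γ)}_{k(j)}`. -/
structure IsCartan : Prop extends S.IsHNormal D where
  metricalX : ∀ (c : JetChart p n T M), ∀ e ∈ c.source, ∀ i j k, S.gCovX D c i j k e = 0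
  metricalV : ∀ (c : JetChart p n T M), ∀ e ∈ c.source, ∀ i j k γ, S.gCovV D c i j k γ e = 0
  timeCoeff : ∀ (c : JetChart p n T M), ∀ e ∈ c.source, ∀ k j γ,
    S.coeffG D c k j γ e
      = ∑ i, S.up c k i (c.coord e) / 2 * S.deltaT c γ (S.lo c i j) (c.coord e)
  symmL : ∀ (c : JetChart p n T M), ∀ e ∈ c.source, ∀ k i j,
    S.coeffL D c k i j e = S.coeffL D c k j i e
  symmC : ∀ (c : JetChart p n T M), ∀ e ∈ c.source, ∀ i j k γ,
    S.coeffC D c i j k γ e = S.coeffC D c i k j γ e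

end LagrangeSpace

end Charts

end MultiTime

end

/-! Uniqueness. A `Γ`-linear connection preserves the three summands of the adapted decomposition,
so it consists of three blocks. Being `h`-normal prescribes the temporal block: the Christoffel
symbols of `h`, acting along temporal directions only. The tensor `J` sends a temporal vector `a`
and a spatial vector `u` to the vertical vector `u ⊗ a♭`. Such vectors span the vertical summand, so
`∇J = 0` forces the vertical block to be the one induced by the other two. In the remaining spatial
block, `G` is prescribed, while `L` and, for each fixed `γ`, `C` are metrical and symmetric. A
trilinear form that is skew in one pair of arguments and symmetric in another vanishes
(`eq_zero_of_skew_of_symm`), which leaves only the generalized Christoffel symbols (`eq_koszul`).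
Two connections differ by a tensor, so these checks on an adapted frame suffice (`diffBil_timeL`,
`diffBil_spaceL`, `diffBil_vertL`).

Existence. The argument above dictates the connection form in each induced chart (`connForm`):
Christoffel symbols of `h` on the temporal block, a form `omega` built from `G`, `L`, `C` on the
spatial block, and the induced action on homomorphisms on the vertical block. The substance is that
these local formulas agree on overlaps, which takes three transformation laws.

First, the adapted decomposition itself must be independent of the chart (`adapt_change`). Its
temporal part `M` needs the classical law of the Christoffel symbols (`chr_trans`). Its spatial part
`N` needs the law of the spray `𝒢` (`sprayVec_change`). The latter follows from writing the linear
form dual to `4𝒢` as a trace of second derivatives of `L` along the lifts `timeLift`, plus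
first-order terms. Under a coordinate change the first-order terms cancel, and by Kronecker
regularity (`mom2_vert`) what survives is a quadratic term in the velocities with the Hessian of the
change of `M`. Differentiating in a vertical direction polarises this term and gives the law of `N`
(`spatialL_change`).

Secondly, `omega` must transform as a connection form (`omega_change`). Pairing it with `g`
expresses it through adapted derivatives of `g`, whose Hessian terms either are absent, for temporal
and vertical directions, or combine in the Koszul formula to exactly one inhomogeneous term.

Thirdly, these inhomogeneous terms cancel against those produced by differentiating adapted
components (`covLoc_change`). The global operator can therefore be defined at each point by a
preferred chart and computed in any chart (`acomp_cartanFun`); smoothness and the required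
identities become local computations. -/

noncomputable section

namespace MultiTime

open Bundle Filter Topology

set_option linter.unusedSectionVars false
set_option synthInstance.maxHeartbeats 200000

/-! ### Derivatives of charts and of coordinate changes. -/

section ChartDerivative

variable {m : ℕ} {X : Type*} [TopologicalSpace X] [ChartedSpace (Vec m) X]

/-- The derivative of a chart. -/
def chartD (φ : OpenPartialHomeomorph X (Vec m)) (x : X) : TangentSpace (𝓡 m) x →L[ℝ] Vec m :=
  mfderiv (𝓡 m) (𝓡 m) φ x

/-- The coordinate change between two charts. -/
def trans (φ χ : OpenPartialHomeomorph X (Vec m)) (u : Vec m) : Vec m := χ (φ.symm u)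

variable [IsManifold (𝓡 m) ∞ X] {φ χ ρ : OpenPartialHomeomorph X (Vec m)}

theorem mdifferentiableAt_chart (hφ : φ ∈ IsManifold.maximalAtlas (𝓡 m) ∞ X) {x : X}
    (hx : x ∈ φ.source) : MDifferentiableAt (𝓡 m) (𝓡 m) φ x :=
  (contMDiffAt_of_mem_maximalAtlas hφ hx).mdifferentiableAt (by simp)

theorem mdifferentiableAt_chart_symm (hφ : φ ∈ IsManifold.maximalAtlas (𝓡 m) ∞ X) {u : Vec m}
    (hu : u ∈ φ.target) : MDifferentiableAt (𝓡 m) (𝓡 m) φ.symm u :=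
  (contMDiffAt_symm_of_mem_maximalAtlas hφ hu).mdifferentiableAt (by simp)

/-- The two composites of the chart and its inverse are the identity near the point, so by the chain
rule the two derivatives are mutually inverse. -/
theorem chartD_isInvertible (hφ : φ ∈ IsManifold.maximalAtlas (𝓡 m) ∞ X) {x : X}
    (hx : x ∈ φ.source) : (chartD φ x).IsInvertible := by
  have h1 := (mdifferentiableAt_chart hφ hx).hasMFDerivAt
  have h2 := (mdifferentiableAt_chart_symm hφ (φ.map_source hx)).hasMFDerivAt
  have h2' := h2
  -- The chain rule needs the base point literally in the form `φ.symm (φ x)`; the rewriting is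
  -- undone once the composite has been differentiated.
  rw [← φ.left_inv hx] at h1
  have e1 := (h1.comp _ h2).mfderiv
  rw [φ.left_inv hx] at h1
  have e2 := (h2.comp _ h1).mfderiv
  have k1 : (φ ∘ φ.symm) =ᶠ[𝓝 (φ x)] id := by
    filter_upwards [φ.open_target.mem_nhds (φ.map_source hx)] with u hu using φ.right_inv hu
  have k2 : (φ.symm ∘ φ) =ᶠ[𝓝 x] id := by
    filter_upwards [φ.open_source.mem_nhds hx] with u hu using φ.left_inv hu
  rw [k1.mfderiv_eq, mfderiv_id] at e1
  rw [k2.mfderiv_eq, mfderiv_id] at e2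
  rw [φ.left_inv hx] at e1
  exact ContinuousLinearMap.IsInvertible.of_inverse
    (g := (mfderiv (𝓡 m) (𝓡 m) φ.symm (φ x) : Vec m →L[ℝ] TangentSpace (𝓡 m) x)) e1.symm e2.symm

theorem trans_contDiffAt (hφ : φ ∈ IsManifold.maximalAtlas (𝓡 m) ∞ X)
    (hχ : χ ∈ IsManifold.maximalAtlas (𝓡 m) ∞ X) {u : Vec m}
    (hu : u ∈ φ.target) (hu' : φ.symm u ∈ χ.source) : ContDiffAt ℝ ∞ (trans φ χ) u := by
  rw [← contMDiffAt_iff_contDiffAt]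
  exact (contMDiffAt_of_mem_maximalAtlas hχ hu').comp u (contMDiffAt_symm_of_mem_maximalAtlas hφ hu)

theorem chartD_trans (hφ : φ ∈ IsManifold.maximalAtlas (𝓡 m) ∞ X)
    (hχ : χ ∈ IsManifold.maximalAtlas (𝓡 m) ∞ X) {u : Vec m}
    (hu : u ∈ φ.target) (hu' : φ.symm u ∈ χ.source) :
    chartD χ (φ.symm u) = fderiv ℝ (trans φ χ) u ∘L chartD φ (φ.symm u) := by
  have h1 := (mdifferentiableAt_chart hφ (φ.map_target hu)).hasMFDerivAt
  have h2 := (mdifferentiableAt_chart_symm hφ hu).hasMFDerivAt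
  have h3 := (mdifferentiableAt_chart hχ hu').hasMFDerivAt
  have h4 := ((trans_contDiffAt hφ hχ hu hu').differentiableAt (by simp)).hasFDerivAt.hasMFDerivAt
  rw [← φ.right_inv hu] at h4
  have h5 := (h4.comp _ h1).mfderiv
  have k : (trans φ χ ∘ φ) =ᶠ[𝓝 (φ.symm u)] χ := by
    filter_upwards [φ.open_source.mem_nhds (φ.map_target hu)] with x hx
    simp [trans, φ.left_inv hx]
  rw [k.mfderiv_eq] at h5
  rw [φ.right_inv hu] at h5
  exact h5

theorem trans_isInvertible (hφ : φ ∈ IsManifold.maximalAtlas (𝓡 m) ∞ X)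
    (hχ : χ ∈ IsManifold.maximalAtlas (𝓡 m) ∞ X) {u : Vec m}
    (hu : u ∈ φ.target) (hu' : φ.symm u ∈ χ.source) :
    (fderiv ℝ (trans φ χ) u).IsInvertible := by
  have h1 := chartD_trans hφ hχ hu hu'
  have i1 := chartD_isInvertible hφ (φ.map_target hu)
  have i2 := chartD_isInvertible hχ hu'
  rw [h1] at i2
  have : fderiv ℝ (trans φ χ) u = (fderiv ℝ (trans φ χ) u ∘L chartD φ (φ.symm u)) ∘L
      (chartD φ (φ.symm u)).inverse := by
    rw [ContinuousLinearMap.comp_assoc, i1.self_comp_inverse, ContinuousLinearMap.comp_id]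
  rw [this]
  exact i2.comp i1.inverse

theorem isOpen_overlap (φ χ : OpenPartialHomeomorph X (Vec m)) :
    IsOpen {u | u ∈ φ.target ∧ φ.symm u ∈ χ.source} :=
  φ.symm.isOpen_inter_preimage χ.open_source

/-- A coordinate change carries the inverse of one chart derivative to that of the other. -/
theorem chartD_inverse_trans (hφ : φ ∈ IsManifold.maximalAtlas (𝓡 m) ∞ X)
    (hχ : χ ∈ IsManifold.maximalAtlas (𝓡 m) ∞ X) {u : Vec m}
    (hu : u ∈ φ.target) (hu' : φ.symm u ∈ χ.source) (w : Vec m) :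
    (chartD χ (φ.symm u)).inverse (fderiv ℝ (trans φ χ) u w) = (chartD φ (φ.symm u)).inverse w := by
  have i1 := chartD_isInvertible hφ (φ.map_target hu)
  have i2 := chartD_isInvertible hχ hu'
  have : fderiv ℝ (trans φ χ) u w = chartD χ (φ.symm u) ((chartD φ (φ.symm u)).inverse w) := by
    rw [chartD_trans hφ hχ hu hu']
    simp only [ContinuousLinearMap.comp_apply]
    rw [i1.self_apply_inverse]
  rw [this, i2.inverse_apply_self]

end ChartDerivative

/-! ### Induced coordinates on the jet bundle and their smoothness. -/

section JetCoordinates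

variable {p n : ℕ}
  {T : Type*} [TopologicalSpace T] [ChartedSpace (Vec p) T] [IsManifold (𝓡 p) ∞ T]
  {M : Type*} [TopologicalSpace M] [ChartedSpace (Vec n) M] [IsManifold (𝓡 n) ∞ M]

namespace JetChart

variable (c c' : JetChart p n T M)

theorem coord_def (e : J1 p n T M) :
    c.coord e = ((c.time e.1.1, c.space e.1.2),
      chartD c.space e.1.2 ∘L
        (e.2 : TangentSpace (𝓡 p) e.1.1 →L[ℝ] TangentSpace (𝓡 n) e.1.2) ∘L
        (chartD c.time e.1.1).inverse) := rfl

theorem param_def (y : JetModel p n) :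
    c.param y = ⟨(c.time.symm y.1.1, c.space.symm y.1.2),
      ((chartD c.space (c.space.symm y.1.2)).inverse ∘L y.2 ∘L
        chartD c.time (c.time.symm y.1.1) :
      TangentSpace (𝓡 p) (c.time.symm y.1.1) →L[ℝ]
        TangentSpace (𝓡 n) (c.space.symm y.1.2))⟩ := rfl

variable {c c'}

theorem param_mem {y : JetModel p n} (hy : y ∈ c.target) : c.param y ∈ c.source :=
  ⟨c.time.map_target hy.1, c.space.map_target hy.2⟩

theorem coord_mem {e : J1 p n T M} (he : e ∈ c.source) : c.coord e ∈ c.target :=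
  ⟨c.time.map_source he.1, c.space.map_source he.2⟩

/-- The induced coordinate change of a pair of coordinate changes of `T` and `M`. -/
def change (c c' : JetChart p n T M) (y : JetModel p n) : JetModel p n :=
  ((trans c.time c'.time y.1.1, trans c.space c'.space y.1.2),
    fderiv ℝ (trans c.space c'.space) y.1.2 ∘L y.2 ∘L
      (fderiv ℝ (trans c.time c'.time) y.1.1).inverse)

theorem coord_param_eq_change {y : JetModel p n} (hy : y ∈ c.target)
    (hy' : c.param y ∈ c'.source) : c'.coord (c.param y) = c.change c' y := by
  have i1 := chartD_isInvertible c.time_mem (c.time.map_target hy.1)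
  have i2 := chartD_isInvertible c.space_mem (c.space.map_target hy.2)
  have j1 := trans_isInvertible c.time_mem c'.time_mem hy.1 hy'.1
  rw [coord_def, param_def, change]
  refine Prod.ext rfl ?_
  simp only
  rw [chartD_trans c.time_mem c'.time_mem hy.1 hy'.1,
    chartD_trans c.space_mem c'.space_mem hy.2 hy'.2, j1.inverse_comp_of_left]
  ext1 v
  exact congrArg (fderiv ℝ (trans c.space c'.space) y.1.2)
    ((i2.self_apply_inverse _).trans (congrArg y.2 (i1.self_apply_inverse _)))

theorem coord_param {y : JetModel p n} (hy : y ∈ c.target) : c.coord (c.param y) = y := by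
  have i1 := chartD_isInvertible c.time_mem (c.time.map_target hy.1)
  have i2 := chartD_isInvertible c.space_mem (c.space.map_target hy.2)
  rw [coord_def, param_def]
  refine Prod.ext (Prod.ext (c.time.right_inv hy.1) (c.space.right_inv hy.2)) ?_
  simp only
  ext1 v
  exact (i2.self_apply_inverse _).trans (congrArg y.2 (i1.self_apply_inverse _))

/-- Every tangent space is the model space as a type, so homomorphisms over base points that are
only propositionally equal can be compared through their values in the model. -/
theorem ext_J1 {t t' : T} {x x' : M} (ht : t = t') (hx : x = x')
    {A : TangentSpace (𝓡 p) t →L[ℝ] TangentSpace (𝓡 n) x}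
    {A' : TangentSpace (𝓡 p) t' →L[ℝ] TangentSpace (𝓡 n) x'}
    (hA : ∀ v : Vec p, (A v : Vec n) = (A' v : Vec n)) :
    (⟨(t, x), A⟩ : J1 p n T M) = ⟨(t', x'), A'⟩ := by
  subst ht hx
  congr 1
  ext1 v
  exact hA v

theorem param_coord {e : J1 p n T M} (he : e ∈ c.source) : c.param (c.coord e) = e := by
  have i1 := chartD_isInvertible c.time_mem he.1
  have i2 := chartD_isInvertible c.space_mem he.2
  obtain ⟨⟨t, x⟩, A⟩ := e
  rw [coord_def, param_def]
  refine ext_J1 (c.time.left_inv he.1) (c.space.left_inv he.2) fun v => ?_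
  rw [c.time.left_inv he.1, c.space.left_inv he.2]
  exact (i2.inverse_apply_self _).trans (congrArg A (i1.inverse_apply_self _))

theorem isOpen_source (c : JetChart p n T M) : IsOpen c.source := by
  have h : Continuous (fun e : J1 p n T M => e.1) := FiberBundle.continuous_proj _ _
  exact (c.time.open_source.preimage (continuous_fst.comp h)).inter
    (c.space.open_source.preimage (continuous_snd.comp h))

theorem isOpen_target (c : JetChart p n T M) : IsOpen c.target :=
  (c.time.open_target.preimage (continuous_fst.comp continuous_fst)).inter
    (c.space.open_target.preimage (continuous_snd.comp continuous_fst))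

/-- The part of the range of the coordinates of `c` on which those of `c'` are defined. -/
def overlap (c c' : JetChart p n T M) : Set (JetModel p n) :=
  {y | y ∈ c.target ∧ c.param y ∈ c'.source}

theorem isOpen_overlap (c c' : JetChart p n T M) : IsOpen (c.overlap c') := by
  have : c.overlap c' = {y : JetModel p n |
      y.1.1 ∈ {u | u ∈ c.time.target ∧ c.time.symm u ∈ c'.time.source} ∧
      y.1.2 ∈ {u | u ∈ c.space.target ∧ c.space.symm u ∈ c'.space.source}} := by
    ext y
    constructor
    · rintro ⟨h1, h2⟩; exact ⟨⟨h1.1, h2.1⟩, h1.2, h2.2⟩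
    · rintro ⟨⟨h1, h2⟩, h3, h4⟩; exact ⟨⟨h1, h3⟩, h2, h4⟩
  rw [this]
  exact ((MultiTime.isOpen_overlap c.time c'.time).preimage
    (continuous_fst.comp continuous_fst)).inter
    ((MultiTime.isOpen_overlap c.space c'.space).preimage (continuous_snd.comp continuous_fst))

theorem change_contDiffAt {y : JetModel p n} (hy : y ∈ c.overlap c') :
    ContDiffAt ℝ ∞ (c.change c') y := by
  have hψ := trans_contDiffAt c.time_mem c'.time_mem hy.1.1 hy.2.1
  have hφ := trans_contDiffAt c.space_mem c'.space_mem hy.1.2 hy.2.2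
  have a1 : ContDiffAt ℝ ∞ (fun y : JetModel p n => y.1.1) y := by fun_prop
  have a2 : ContDiffAt ℝ ∞ (fun y : JetModel p n => y.1.2) y := by fun_prop
  have hψ' : ContDiffAt ℝ ∞ (fderiv ℝ (trans c.time c'.time)) y.1.1 :=
    hψ.fderiv_right (by simp)
  have hφ' : ContDiffAt ℝ ∞ (fderiv ℝ (trans c.space c'.space)) y.1.2 :=
    hφ.fderiv_right (by simp)
  obtain ⟨E, hE⟩ := trans_isInvertible c.time_mem c'.time_mem hy.1.1 hy.2.1
  have hi : ContDiffAt ℝ ∞ ContinuousLinearMap.inverse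
      (fderiv ℝ (trans c.time c'.time) y.1.1) := by
    rw [← hE]; exact contDiffAt_map_inverse E
  have b1 := hi.comp y (hψ'.comp y a1)
  have b2 := hφ'.comp y a2
  have b3 := hψ.comp y a1
  have b4 := hφ.comp y a2
  have b5 : ContDiffAt ℝ ∞ (fun y : JetModel p n => y.2) y := by fun_prop
  exact (b3.prodMk b4).prodMk (b2.clm_comp (b5.clm_comp b1))

variable (p n T M) in
/-- The pair of preferred charts at the base point of a jet. -/
def pref (e : J1 p n T M) : JetChart p n T M where
  time := chartAt _ e.1.1
  time_mem := IsManifold.chart_mem_maximalAtlas _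
  space := chartAt _ e.1.2
  space_mem := IsManifold.chart_mem_maximalAtlas _

theorem mem_pref (e : J1 p n T M) : e ∈ (pref p n T M e).source :=
  ⟨mem_chart_source _ _, mem_chart_source _ _⟩

theorem extChartAt_source (e : J1 p n T M) :
    (extChartAt (jetI p n) e).source = (pref p n T M e).source := by
  rw [_root_.extChartAt_source, FiberBundle.chartedSpace_chartAt]
  ext e'
  simp only [mfld_simps, hom_trivializationAt_source, hom_trivializationAt_apply]
  exact ⟨fun h => h.2, fun h => ⟨h, h⟩⟩

/-- On fibres a pulled-back trivialization acts as the original one, and that of the tangent bundle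
is the derivative of the preferred chart. -/
theorem time_continuousLinearMapAt {q₀ q : T × M}
    (hq : q.1 ∈ (chartAt (Vec p) q₀.1).source) (v : TimeBundle p n T M q) :
    (trivializationAt (Vec p) (TimeBundle p n T M) q₀).continuousLinearMapAt ℝ q v
      = chartD (chartAt (Vec p) q₀.1) q.1 v := by
  have h1 := congrArg (fun f => f v)
    (TangentBundle.continuousLinearMapAt_trivializationAt (I := 𝓡 p) hq)
  exact (Trivialization.continuousLinearMapAt_apply_of_mem ℝ
    (trivializationAt (Vec p) (TimeBundle p n T M) q₀) (b := q) hq v).trans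
    ((Trivialization.continuousLinearMapAt_apply_of_mem ℝ
      (trivializationAt (Vec p) (TangentSpace (𝓡 p) : T → Type _) q₀.1)
      (b := q.1) hq v).symm.trans h1)

theorem space_continuousLinearMapAt {q₀ q : T × M}
    (hq : q.2 ∈ (chartAt (Vec n) q₀.2).source) (v : SpaceBundle p n T M q) :
    (trivializationAt (Vec n) (SpaceBundle p n T M) q₀).continuousLinearMapAt ℝ q v
      = chartD (chartAt (Vec n) q₀.2) q.2 v := by
  have h1 := congrArg (fun f => f v)
    (TangentBundle.continuousLinearMapAt_trivializationAt (I := 𝓡 n) hq)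
  exact (Trivialization.continuousLinearMapAt_apply_of_mem ℝ
    (trivializationAt (Vec n) (SpaceBundle p n T M) q₀) (b := q) hq v).trans
    ((Trivialization.continuousLinearMapAt_apply_of_mem ℝ
      (trivializationAt (Vec n) (TangentSpace (𝓡 n) : M → Type _) q₀.2)
      (b := q.2) hq v).symm.trans h1)

theorem time_symmL {q₀ q : T × M} (hq : q.1 ∈ (chartAt (Vec p) q₀.1).source) (v : Vec p) :
    ((trivializationAt (Vec p) (TimeBundle p n T M) q₀).symmL ℝ q v : TangentSpace (𝓡 p) q.1)
      = (chartD (chartAt (Vec p) q₀.1) q.1).inverse v := by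
  have i1 := chartD_isInvertible (m := p) (X := T)
    (IsManifold.chart_mem_maximalAtlas q₀.1) hq
  apply i1.injective
  rw [i1.self_apply_inverse]
  exact (time_continuousLinearMapAt hq _).symm.trans
    (Trivialization.continuousLinearMapAt_symmL _ hq v)

/-- This ties the manifold structure of the homomorphism bundle to the induced coordinates:
smoothness of `coord` and `param` for general charts then reduces to smoothness of `change`. -/
theorem extChartAt_eq_coord (e : J1 p n T M) {e' : J1 p n T M} (he : e' ∈ (pref p n T M e).source) :
    extChartAt (jetI p n) e e' = (pref p n T M e).coord e' := by
  rw [FiberBundle.extChartAt]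
  simp only [mfld_simps, hom_trivializationAt_apply]
  refine Prod.ext rfl ?_
  ext1 v
  refine (space_continuousLinearMapAt he.2 _).trans ?_
  exact congrArg (fun w => chartD (chartAt (Vec n) e.1.2) e'.1.2 (e'.2 w)) (time_symmL he.1 v)

theorem contMDiffAt_coord (c : JetChart p n T M) {e : J1 p n T M} (he : e ∈ c.source) :
    ContMDiffAt (jetI p n) 𝓘(ℝ, JetModel p n) ∞ c.coord e := by
  have h1 : ContMDiffAt (jetI p n) 𝓘(ℝ, JetModel p n) ∞ (pref p n T M e).coord e := by
    refine (contMDiffAt_extChartAt (I := jetI p n) (x := e)).congr_of_eventuallyEq ?_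
    filter_upwards [(pref p n T M e).isOpen_source.mem_nhds (mem_pref e)] with e' he'
    exact (extChartAt_eq_coord e he').symm
  have h2 : (pref p n T M e).coord e ∈ (pref p n T M e).overlap c :=
    ⟨coord_mem (mem_pref e), by rw [param_coord (mem_pref e)]; exact he⟩
  -- Near `e` the coordinates of `c` are those of the preferred charts followed by a smooth change
  -- of coordinates.
  have h3 := (contMDiffAt_iff_contDiffAt.2 (change_contDiffAt h2)).comp e h1
  refine h3.congr_of_eventuallyEq ?_
  filter_upwards [(pref p n T M e).isOpen_source.mem_nhds (mem_pref e),
    c.isOpen_source.mem_nhds he] with e' he' hc'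
  have := coord_param_eq_change (c' := c) (coord_mem he') (by rwa [param_coord he'])
  rw [param_coord he'] at this
  exact this

theorem contMDiffAt_param (c : JetChart p n T M) {y : JetModel p n} (hy : y ∈ c.target) :
    ContMDiffAt 𝓘(ℝ, JetModel p n) (jetI p n) ∞ c.param y := by
  set e := c.param y with he
  have h2 : y ∈ c.overlap (pref p n T M e) := ⟨hy, by rw [← he]; exact mem_pref e⟩
  have h0 : c.change (pref p n T M e) y = extChartAt (jetI p n) e e := by
    rw [← coord_param_eq_change h2.1 h2.2, extChartAt_eq_coord e (mem_pref e), ← he]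
  have h1 : ContMDiffAt 𝓘(ℝ, JetModel p n) (jetI p n) ∞ (extChartAt (jetI p n) e).symm
      (c.change (pref p n T M e) y) := by
    rw [h0]
    exact (contMDiffOn_extChartAt_symm e).contMDiffAt (extChartAt_target_mem_nhds e)
  have h3 := h1.comp y (contMDiffAt_iff_contDiffAt.2 (change_contDiffAt h2))
  refine h3.congr_of_eventuallyEq ?_
  filter_upwards [(c.isOpen_overlap (pref p n T M e)).mem_nhds h2] with z hz
  rw [Function.comp_apply, ← coord_param_eq_change hz.1 hz.2, ← extChartAt_eq_coord e hz.2,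
    PartialEquiv.left_inv]
  rw [extChartAt_source]; exact hz.2

end JetChart
end JetCoordinates

/-! ### Differentiable vector fields on a vector space. -/

section VectorSpaceFields

theorem mdifferentiableAt_vectorSpace_iff {E : Type*} [NormedAddCommGroup E] [NormedSpace ℝ E]
    {V : ∀ x : E, TangentSpace 𝓘(ℝ, E) x} {x : E} :
    MDifferentiableAt 𝓘(ℝ, E) 𝓘(ℝ, E).tangent
      (fun x => (⟨x, V x⟩ : TangentBundle 𝓘(ℝ, E) E)) x ↔
      DifferentiableAt ℝ (fun x => (V x : E)) x := by
  refine ⟨fun h => ?_, fun h => ?_⟩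
  · exact MDifferentiableAt.differentiableAt <|
      ((contMDiff_snd_tangentBundle_modelSpace (n := 1) E 𝓘(ℝ, E)).contMDiffAt.mdifferentiableAt
        (by simp)).comp x h
  · apply (mdifferentiableAt_totalSpace _ _).2
    refine ⟨mdifferentiableAt_id, ?_⟩
    convert! h.mdifferentiableAt with y
    simp

end VectorSpaceFields

/-! ### Vector fields in natural components. -/

section Fields

variable {p n : ℕ}
  {T : Type*} [TopologicalSpace T] [ChartedSpace (Vec p) T] [IsManifold (𝓡 p) ∞ T]
  {M : Type*} [TopologicalSpace M] [ChartedSpace (Vec n) M] [IsManifold (𝓡 n) ∞ M]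

namespace JetChart

variable (c : JetChart p n T M) {c' : JetChart p n T M}

/-- The components of a tangent vector in the natural basis, as a continuous linear map. -/
def compL (e : J1 p n T M) : TangentSpace (jetI p n) e →L[ℝ] JetModel p n :=
  mfderiv (jetI p n) 𝓘(ℝ, JetModel p n) c.coord e

/-- The derivative of the inverse coordinates. -/
def paramD (y : JetModel p n) : JetModel p n →L[ℝ] TangentSpace (jetI p n) (c.param y) :=
  mfderiv 𝓘(ℝ, JetModel p n) (jetI p n) c.param y

variable {c}

theorem mdifferentiableAt_coord {e : J1 p n T M} (he : e ∈ c.source) :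
    MDifferentiableAt (jetI p n) 𝓘(ℝ, JetModel p n) c.coord e :=
  (c.contMDiffAt_coord he).mdifferentiableAt (by simp)

theorem mdifferentiableAt_param {y : JetModel p n} (hy : y ∈ c.target) :
    MDifferentiableAt 𝓘(ℝ, JetModel p n) (jetI p n) c.param y :=
  (c.contMDiffAt_param hy).mdifferentiableAt (by simp)

theorem compL_comp_paramD {y : JetModel p n} (hy : y ∈ c.target) :
    c.compL (c.param y) ∘L c.paramD y = ContinuousLinearMap.id ℝ _ := by
  have h1 := (mdifferentiableAt_param hy).hasMFDerivAt
  have h2 := (mdifferentiableAt_coord (param_mem hy)).hasMFDerivAt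
  have e1 := (h2.comp _ h1).mfderiv
  have k : (c.coord ∘ c.param) =ᶠ[𝓝 y] id := by
    filter_upwards [c.isOpen_target.mem_nhds hy] with z hz using coord_param hz
  rw [k.mfderiv_eq, mfderiv_id] at e1
  exact e1.symm

theorem paramD_comp_compL {y : JetModel p n} (hy : y ∈ c.target) :
    c.paramD y ∘L c.compL (c.param y) = ContinuousLinearMap.id ℝ _ := by
  have h1 := (mdifferentiableAt_param hy).hasMFDerivAt
  have h2 := (mdifferentiableAt_coord (param_mem hy)).hasMFDerivAt
  rw [← coord_param hy] at h1
  have e1 := (h1.comp _ h2).mfderiv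
  have k : (c.param ∘ c.coord) =ᶠ[𝓝 (c.param y)] id := by
    filter_upwards [c.isOpen_source.mem_nhds (param_mem hy)] with z hz using param_coord hz
  rw [k.mfderiv_eq, mfderiv_id] at e1
  rw [coord_param hy] at e1
  exact e1.symm

theorem paramD_isInvertible {y : JetModel p n} (hy : y ∈ c.target) :
    (c.paramD y).IsInvertible :=
  ContinuousLinearMap.IsInvertible.of_inverse (paramD_comp_compL hy) (compL_comp_paramD hy)

theorem compL_isInvertible {e : J1 p n T M} (he : e ∈ c.source) : (c.compL e).IsInvertible := by
  rw [← param_coord he]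
  exact ContinuousLinearMap.IsInvertible.of_inverse (compL_comp_paramD (coord_mem he))
    (paramD_comp_compL (coord_mem he))

theorem paramD_inverse {y : JetModel p n} (hy : y ∈ c.target) :
    (c.paramD y).inverse = c.compL (c.param y) := by
  ext1 v
  obtain ⟨w, rfl⟩ := (paramD_isInvertible hy).surjective v
  rw [(paramD_isInvertible hy).inverse_apply_self]
  exact (congrArg (fun f => f w) (compL_comp_paramD hy)).symm

theorem compL_change {e : J1 p n T M} (he : e ∈ c.source) (he' : e ∈ c'.source) :
    c'.compL e = fderiv ℝ (c.change c') (c.coord e) ∘L c.compL e := by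
  have ho : c.coord e ∈ c.overlap c' := ⟨coord_mem he, by rwa [param_coord he]⟩
  have h1 := ((change_contDiffAt ho).differentiableAt (by simp)).hasFDerivAt.hasMFDerivAt
  have h2 := (mdifferentiableAt_coord he).hasMFDerivAt
  have e1 := (h1.comp _ h2).mfderiv
  have k : (c.change c' ∘ c.coord) =ᶠ[𝓝 e] c'.coord := by
    filter_upwards [c.isOpen_source.mem_nhds he, c'.isOpen_source.mem_nhds he'] with z hz hz'
    rw [Function.comp_apply, ← coord_param_eq_change (coord_mem hz) (by rwa [param_coord hz]),
      param_coord hz]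
  rw [k.mfderiv_eq] at e1
  exact e1

/-- The components of a vector field in the natural basis, in coordinates. -/
def nrep (c : JetChart p n T M) (Y : ∀ e : J1 p n T M, TangentSpace (jetI p n) e)
    (y : JetModel p n) : JetModel p n :=
  c.compL (c.param y) (Y (c.param y))

/-- The vector field with given components in the natural basis. -/
def lift (c : JetChart p n T M) (W : JetModel p n → JetModel p n) :
    ∀ e : J1 p n T M, TangentSpace (jetI p n) e :=
  VectorField.mpullback (jetI p n) 𝓘(ℝ, JetModel p n) c.coord W

theorem compL_lift {e : J1 p n T M} (he : e ∈ c.source) (W : JetModel p n → JetModel p n) :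
    c.compL e (c.lift W e) = W (c.coord e) :=
  (compL_isInvertible he).self_apply_inverse _

theorem lift_nrep {e : J1 p n T M} (he : e ∈ c.source)
    (Y : ∀ e : J1 p n T M, TangentSpace (jetI p n) e) : c.lift (c.nrep Y) e = Y e := by
  apply (compL_isInvertible he).injective
  rw [compL_lift he, nrep, param_coord he]

/-- Recognising the components as a pullback along `param` makes the differentiability and
smoothness of pulled-back fields available. -/
theorem nrep_eq_mpullback {y : JetModel p n} (hy : y ∈ c.target)
    (Y : ∀ e : J1 p n T M, TangentSpace (jetI p n) e) :
    c.nrep Y y = VectorField.mpullback 𝓘(ℝ, JetModel p n) (jetI p n) c.param Y y := by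
  rw [nrep, ← paramD_inverse hy]
  rfl

theorem diffFieldAt_congr {Y Z : ∀ e : J1 p n T M, TangentSpace (jetI p n) e} {e : J1 p n T M}
    (hY : DiffFieldAt Y e) (h : ∀ᶠ e' in 𝓝 e, Z e' = Y e') : DiffFieldAt Z e := by
  refine MDifferentiableAt.congr_of_eventuallyEq hY ?_
  filter_upwards [h] with e' he'
  rw [he']

theorem diffFieldAt_lift {e : J1 p n T M} (he : e ∈ c.source) {W : JetModel p n → JetModel p n}
    (hW : DifferentiableAt ℝ W (c.coord e)) : DiffFieldAt (c.lift W) e :=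
  MDifferentiableAt.mpullback_vectorField (n := ∞) (mdifferentiableAt_vectorSpace_iff.2 hW)
    (c.contMDiffAt_coord he) (compL_isInvertible he) (by norm_cast)

/-- Components are a pullback along `param`, and the field is recovered from them by a pullback
along `coord`; both maps are smooth with invertible derivative, so differentiability passes in each
direction. -/
theorem diffFieldAt_iff {e : J1 p n T M} (he : e ∈ c.source)
    {Y : ∀ e : J1 p n T M, TangentSpace (jetI p n) e} :
    DiffFieldAt Y e ↔ DifferentiableAt ℝ (c.nrep Y) (c.coord e) := by
  constructor
  · intro h
    rw [← param_coord he] at h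
    have := MDifferentiableAt.mpullback_vectorField (n := ∞) h
      (c.contMDiffAt_param (coord_mem he)) (paramD_isInvertible (coord_mem he))
      (by norm_cast)
    refine (mdifferentiableAt_vectorSpace_iff.1 this).congr_of_eventuallyEq ?_
    filter_upwards [c.isOpen_target.mem_nhds (coord_mem he)] with y hy
    exact nrep_eq_mpullback hy Y
  · intro h
    refine diffFieldAt_congr (diffFieldAt_lift he h) ?_
    filter_upwards [c.isOpen_source.mem_nhds he] with e' he'
    exact (lift_nrep he' Y).symm

theorem nrep_contDiffAt {e : J1 p n T M} (he : e ∈ c.source)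
    {Y : ∀ e : J1 p n T M, TangentSpace (jetI p n) e}
    (h : ContMDiffAt (jetI p n) (jetI p n).tangent ∞
      (fun e' => (⟨e', Y e'⟩ : TangentBundle (jetI p n) (J1 p n T M))) e) :
    ContDiffAt ℝ ∞ (c.nrep Y) (c.coord e) := by
  rw [← param_coord he] at h
  have := ContMDiffAt.mpullback_vectorField_preimage (n := ∞) (m := ∞) h
    (c.contMDiffAt_param (coord_mem he)) (paramD_isInvertible (coord_mem he)) (by simp)
  refine (contMDiffAt_vectorSpace_iff_contDiffAt.1 this).congr_of_eventuallyEq ?_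
  filter_upwards [c.isOpen_target.mem_nhds (coord_mem he)] with y hy
  exact nrep_eq_mpullback hy Y

end JetChart
end Fields

section ShortcutInstances

variable (p n : ℕ)

instance : ContinuousSMul ℝ (Vec p →L[ℝ] Vec n) := inferInstance

instance : ContinuousSMul ℝ (JetModel p n) := inferInstance

instance : T2Space (JetModel p n) := inferInstance

end ShortcutInstances

/-! ### Bilinear maps in coordinates, second derivatives and traces. -/

section LinearAlgebra

attribute [-instance] pullbackAddCommGroup pullbackIsTopologicalAddGroup pullbackContinuousSMul

/-- The basis vectors of a coordinate space. -/
abbrev bv {m : ℕ} (i : Fin m) : Vec m := EuclideanSpace.single i 1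

theorem vec_eq_sum {m : ℕ} (w : Vec m) : w = ∑ i, w i • bv i := by
  ext j
  simp [Pi.single_apply]

/-- Expansion of a linear map in the coordinates of its argument. -/
theorem map_eq_sum {m : ℕ} {V F : Type*} [AddCommGroup V] [Module ℝ V] [FunLike F (Vec m) V]
    [LinearMapClass F ℝ (Vec m) V] (f : F) (w : Vec m) : f w = ∑ i, w i • f (bv i) := by
  conv_lhs => rw [vec_eq_sum w]
  rw [map_sum]
  simp

theorem clm_ext_bv {m : ℕ} {V : Type*} [AddCommGroup V] [Module ℝ V] [TopologicalSpace V]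
    {f g : Vec m →L[ℝ] V} (h : ∀ i, f (bv i) = g (bv i)) : f = g := by
  ext1 w
  rw [map_eq_sum f, map_eq_sum g]
  simp [h]

/-- The bilinear form with given entries. -/
def bil {m : ℕ} (a : Fin m → Fin m → ℝ) : Vec m →ₗ[ℝ] Vec m →ₗ[ℝ] ℝ :=
  LinearMap.mk₂ ℝ (fun u v => ∑ i, ∑ j, a i j * (u i * v j))
    (fun u u' v => by simp [add_mul, mul_add, Finset.sum_add_distrib])
    (fun r u v => by simp [Finset.mul_sum, mul_left_comm, mul_assoc])
    (fun u v v' => by simp [mul_add, Finset.sum_add_distrib])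
    (fun r u v => by simp [Finset.mul_sum, mul_left_comm])

theorem bil_apply {m : ℕ} (a : Fin m → Fin m → ℝ) (u v : Vec m) :
    bil a u v = ∑ i, ∑ j, a i j * (u i * v j) := rfl

theorem bil_bv {m : ℕ} (a : Fin m → Fin m → ℝ) (i j : Fin m) : bil a (bv i) (bv j) = a i j := by
  simp [bil_apply]

theorem bil_symm {m : ℕ} {a : Fin m → Fin m → ℝ} (h : ∀ i j, a i j = a j i) (u v : Vec m) :
    bil a u v = bil a v u := by
  rw [bil_apply, bil_apply, Finset.sum_comm]
  exact Finset.sum_congr rfl fun i _ => Finset.sum_congr rfl fun j _ => by rw [h]; ring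

/-- The bilinear map with given coefficients. -/
def bilV {k l m : ℕ} (a : Fin k → Fin l → Fin m → ℝ) : Vec l →ₗ[ℝ] Vec m →ₗ[ℝ] Vec k :=
  LinearMap.mk₂ ℝ (fun u v => WithLp.toLp 2 fun γ => ∑ i, ∑ j, a γ i j * (u i * v j))
    (fun u u' v => by ext; simp [add_mul, mul_add, Finset.sum_add_distrib])
    (fun r u v => by ext; simp [Finset.mul_sum, mul_left_comm, mul_assoc])
    (fun u v v' => by ext; simp [mul_add, Finset.sum_add_distrib])
    (fun r u v => by ext; simp [Finset.mul_sum, mul_left_comm])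

theorem bilV_apply {k l m : ℕ} (a : Fin k → Fin l → Fin m → ℝ) (u : Vec l) (v : Vec m)
    (γ : Fin k) : bilV a u v γ = ∑ i, ∑ j, a γ i j * (u i * v j) := rfl

theorem bilV_bv {k l m : ℕ} (a : Fin k → Fin l → Fin m → ℝ) (i : Fin l) (j : Fin m)
    (γ : Fin k) : bilV a (bv i) (bv j) γ = a γ i j := by
  simp [bilV_apply]

theorem bilV_symm {k m : ℕ} {a : Fin k → Fin m → Fin m → ℝ} (h : ∀ γ i j, a γ i j = a γ j i)
    (u v : Vec m) : bilV a u v = bilV a v u := by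
  ext γ
  rw [bilV_apply, bilV_apply, Finset.sum_comm]
  exact Finset.sum_congr rfl fun i _ => Finset.sum_congr rfl fun j _ => by rw [h]; ring

theorem bilin_ext_bv {l m : ℕ} {V : Type*} [AddCommGroup V] [Module ℝ V]
    {f g : Vec l →ₗ[ℝ] Vec m →ₗ[ℝ] V} (h : ∀ i j, f (bv i) (bv j) = g (bv i) (bv j))
    (u : Vec l) (v : Vec m) : f u v = g u v := by
  rw [map_eq_sum f u, map_eq_sum g u, LinearMap.sum_apply, LinearMap.sum_apply]
  refine Finset.sum_congr rfl fun i _ => ?_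
  rw [LinearMap.smul_apply, LinearMap.smul_apply, map_eq_sum (f (bv i)) v,
    map_eq_sum (g (bv i)) v]
  simp [h]

theorem bil_eq {m : ℕ} {V : Type*} [AddCommGroup V] [Module ℝ V] (B : V →ₗ[ℝ] V →ₗ[ℝ] ℝ)
    (e : Vec m →ₗ[ℝ] V) (u v : Vec m) :
    bil (fun i j => B (e (bv i)) (e (bv j))) u v = B (e u) (e v) :=
  bilin_ext_bv (f := bil fun i j => B (e (bv i)) (e (bv j))) (g := B.compl₁₂ e e)
    (fun i j => bil_bv _ i j) u v

section Calculus

variable {E : Type*} [NormedAddCommGroup E] [NormedSpace ℝ E]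

theorem vec_hasFDerivAt {m : ℕ} {U : E → Vec m} {y : E} (hU : DifferentiableAt ℝ U y) (i : Fin m) :
    HasFDerivAt (fun s => U s i) ((EuclideanSpace.proj i : Vec m →L[ℝ] ℝ) ∘L fderiv ℝ U y) y :=
  (EuclideanSpace.proj i : Vec m →L[ℝ] ℝ).hasFDerivAt.comp y hU.hasFDerivAt

theorem bilV_contDiffAt {k l m : ℕ} {a : Fin k → Fin l → Fin m → E → ℝ} {U : E → Vec l}
    {V : E → Vec m} {y : E} {r : ℕ∞ω}
    (h : ∀ γ i j, ContDiffAt ℝ r (a γ i j) y) (hU : ContDiffAt ℝ r U y) (hV : ContDiffAt ℝ r V y) :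
    ContDiffAt ℝ r (fun y => bilV (fun γ i j => a γ i j y) (U y) (V y)) y := by
  rw [contDiffAt_euclidean] at hU hV ⊢
  simp only [bilV_apply]
  exact fun γ => ContDiffAt.sum fun i _ => ContDiffAt.sum fun j _ =>
    (h γ i j).mul ((hU i).mul (hV j))

theorem bil_fderiv {m : ℕ} {a : Fin m → Fin m → E → ℝ} {U V : E → Vec m} {y : E}
    (h : ∀ i j, DifferentiableAt ℝ (a i j) y) (hU : DifferentiableAt ℝ U y)
    (hV : DifferentiableAt ℝ V y) (w : E) :
    fderiv ℝ (fun y => bil (fun i j => a i j y) (U y) (V y)) y w =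
      bil (fun i j => fderiv ℝ (a i j) y w) (U y) (V y)
        + bil (fun i j => a i j y) (fderiv ℝ U y w) (V y)
        + bil (fun i j => a i j y) (U y) (fderiv ℝ V y w) := by
  have : HasFDerivAt (fun y => ∑ i, ∑ j, a i j y * (U y i * V y j)) _ y :=
    HasFDerivAt.fun_sum fun i _ => HasFDerivAt.fun_sum fun j _ =>
      (h i j).hasFDerivAt.mul ((vec_hasFDerivAt hU i).mul (vec_hasFDerivAt hV j))
  simp only [bil_apply]
  rw [this.fderiv]
  simp only [sum_apply, ← Finset.sum_add_distrib]
  refine Finset.sum_congr rfl fun i _ => Finset.sum_congr rfl fun j _ => ?_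
  simp
  ring

/-- The second derivative. -/
def D2 {l m : ℕ} (f : Vec l → Vec m) (x u v : Vec l) : Vec m :=
  fderiv ℝ (fun x => fderiv ℝ f x v) x u

theorem fderiv_clm_apply_vec {l m : ℕ} {A : E → Vec l →L[ℝ] Vec m} {U : E → Vec l} {y : E}
    (hA : DifferentiableAt ℝ A y) (hU : DifferentiableAt ℝ U y) (w : E) :
    fderiv ℝ (fun y => A y (U y)) y w = fderiv ℝ A y w (U y) + A y (fderiv ℝ U y w) := by
  rw [fderiv_clm_apply hA hU]
  simp [add_comm]

theorem D2_eq {l m : ℕ} {f : Vec l → Vec m} {x : Vec l} (hf : ContDiffAt ℝ ∞ f x) (u v : Vec l) :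
    D2 f x u v = fderiv ℝ (fderiv ℝ f) x u v := by
  have : DifferentiableAt ℝ (fderiv ℝ f) x :=
    (hf.fderiv_right (m := ∞) (by simp)).differentiableAt (by simp)
  rw [D2, fderiv_clm_apply_vec this (differentiableAt_const v)]
  simp

theorem D2_symm {l m : ℕ} {f : Vec l → Vec m} {x : Vec l} (hf : ContDiffAt ℝ ∞ f x) (u v : Vec l) :
    D2 f x u v = D2 f x v u := by
  rw [D2_eq hf, D2_eq hf]
  exact (hf.isSymmSndFDerivAt (by simp; norm_cast)).eq u v

/-- The second derivative as a bilinear map. -/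
def D2L {l m : ℕ} (f : Vec l → Vec m) (x : Vec l) : Vec l →ₗ[ℝ] Vec l →ₗ[ℝ] Vec m :=
  ContinuousLinearMap.coeLM ℝ ∘ₗ (fderiv ℝ (fderiv ℝ f) x).toLinearMap

end Calculus

/-- The trace pairing is invariant under a change of basis. -/
theorem sum_pairing_invariant {m : ℕ} {V : Type*} [AddCommGroup V] [Module ℝ V]
    (F : Vec m →ₗ[ℝ] (Vec m →L[ℝ] ℝ) →ₗ[ℝ] V) {P : Vec m →L[ℝ] Vec m} (hP : P.IsInvertible) :
    ∑ α, F (P (bv α)) ((EuclideanSpace.proj α : Vec m →L[ℝ] ℝ) ∘L P.inverse)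
      = ∑ α, F (bv α) (EuclideanSpace.proj α) := by
  -- Expanding `P (bv α)` moves its entries to the covector argument, where summing over `α` gives
  -- the coordinate covectors of `P ∘ P⁻¹`.
  have h1 : ∀ α, F (P (bv α)) ((EuclideanSpace.proj α : Vec m →L[ℝ] ℝ) ∘L P.inverse)
      = ∑ μ, F (bv μ) ((P (bv α) μ) • ((EuclideanSpace.proj α : Vec m →L[ℝ] ℝ) ∘L P.inverse)) := by
    intro α
    rw [map_eq_sum F, LinearMap.sum_apply]
    simp
  simp_rw [h1]
  rw [Finset.sum_comm]
  refine Finset.sum_congr rfl fun μ _ => ?_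
  rw [← map_sum]
  congr 1
  ext1 w
  rw [sum_apply]
  conv_rhs => rw [← hP.self_apply_inverse w, map_eq_sum P (P.inverse w)]
  simp [mul_comm]

/-- Applying the two transpositions alternately, three times each, returns to the original order of
the arguments with the sign reversed. This is the combinatorial core of every uniqueness argument
for Levi-Civita type coefficients below. -/
theorem eq_zero_of_skew_of_symm {V : Type*} {t : V → V → V → ℝ} (h1 : ∀ u v w, t u v w = -t v u w)
    (h2 : ∀ u v w, t u v w = t w v u) (u v w : V) : t u v w = 0 := by
  have e1 := h2 u v w
  have e2 := h1 w v u
  have e3 := h2 v w u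
  have e4 := h1 u w v
  have e5 := h2 w u v
  have e6 := h1 v u w
  linarith

/-! ### The Koszul formula in components. -/

section Koszul

variable {m : ℕ} {lo up : Fin m → Fin m → ℝ} (hs : ∀ i j, lo i j = lo j i)
  (hinv : ∀ i j, ∑ k, up i k * lo k j = if i = j then 1 else 0)
  (hinv' : ∀ i j, ∑ k, lo i k * up k j = if i = j then 1 else 0)
  {d : Fin m → Fin m → Fin m → ℝ} (hd : ∀ i j k, d i j k = d j i k)

include hinv' in
theorem sum_lo_mul_sum_up (v : Fin m → ℝ) (j : Fin m) :
    ∑ k, lo j k * ∑ l, up k l * v l = v j := by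
  simp_rw [Finset.mul_sum, ← mul_assoc]
  rw [Finset.sum_comm]
  simp_rw [← Finset.sum_mul, hinv']
  simp

include hinv in
theorem sum_up_mul_sum_lo (v : Fin m → ℝ) (j : Fin m) :
    ∑ k, up j k * ∑ l, lo k l * v l = v j := by
  simp_rw [Finset.mul_sum, ← mul_assoc]
  rw [Finset.sum_comm]
  simp_rw [← Finset.sum_mul, hinv]
  simp

/-- The coefficients of the Levi-Civita type. -/
def koszul (up : Fin m → Fin m → ℝ) (d : Fin m → Fin m → Fin m → ℝ) (i j k : Fin m) : ℝ :=
  ∑ l, up i l / 2 * (d j l k + d k l j - d j k l)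

include hinv' in
theorem sum_lo_mul_koszul (i j k : Fin m) :
    ∑ l, lo i l * koszul up d l j k = (d j i k + d k i j - d j k i) / 2 := by
  rw [← sum_lo_mul_sum_up hinv' (fun i => (d j i k + d k i j - d j k i) / 2) i]
  refine Finset.sum_congr rfl fun l _ => ?_
  rw [koszul]
  congr 1
  exact Finset.sum_congr rfl fun l' _ => by ring

include hs hinv' hd in
-- After lowering the upper index, the two sums are half-sums of three derivatives of the metric; by
-- its symmetry four of the six terms cancel and the other two coincide.
theorem koszul_metrical (i j k : Fin m) :
    (∑ l, lo l j * koszul up d l i k) + ∑ l, lo i l * koszul up d l j k = d i j k := by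
  have := sum_lo_mul_koszul hinv' (d := d) j i k
  simp_rw [fun l => hs l j]
  rw [this, sum_lo_mul_koszul hinv', hd j i k, hd k j i, hd k i j, hd i k j, hd j k i]
  ring

include hd in
theorem koszul_symm (i j k : Fin m) : koszul up d i j k = koszul up d i k j := by
  refine Finset.sum_congr rfl fun l _ => ?_
  rw [hd j k l]
  ring

include hs hinv hinv' hd in
-- Two metrical symmetric families differ by one whose lowered version is skew in one pair and
-- symmetric in another, hence zero; nondegeneracy then raises the index again.
theorem eq_koszul {A : Fin m → Fin m → Fin m → ℝ} (hA : ∀ i j k, A i j k = A i k j)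
    (h : ∀ i j k, (∑ l, lo l j * A l i k) + ∑ l, lo i l * A l j k = d i j k) (i j k : Fin m) :
    A i j k = koszul up d i j k := by
  have key : ∀ u v w, ∑ l, lo v l * (A l u w - koszul up d l u w) = 0 := by
    refine eq_zero_of_skew_of_symm (fun u v w => ?_) fun u v w => ?_
    · have e1 := h u v w
      have e2 := koszul_metrical hs hinv' hd u v w
      simp_rw [fun l => hs l v] at e1 e2
      simp_rw [mul_sub, Finset.sum_sub_distrib]
      linarith
    · exact Finset.sum_congr rfl fun l _ => by rw [hA l u w, koszul_symm hd l u w]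
  have e := sum_up_mul_sum_lo hinv (fun l => A l j k - koszul up d l j k) i
  simp_rw [key] at e
  simp at e
  linarith

end Koszul

/-! ### Smoothness of inverse matrices, and invertibility of Gram matrices. -/

section Inverse

variable {E : Type*} [NormedAddCommGroup E] [NormedSpace ℝ E] {m : ℕ}

theorem det_contDiffAt {f : E → Matrix (Fin m) (Fin m) ℝ} {y : E} {r : ℕ∞ω}
    (h : ∀ i j, ContDiffAt ℝ r (fun y => f y i j) y) : ContDiffAt ℝ r (fun y => (f y).det) y := by
  simp_rw [Matrix.det_apply']
  exact ContDiffAt.sum fun σ _ => contDiffAt_const.mul (contDiffAt_prod fun i _ => h _ _)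

/-- By Cramer's rule the entries are quotients of determinants, hence of polynomials in the entries
of the matrix. -/
theorem inv_contDiffAt {f : E → Matrix (Fin m) (Fin m) ℝ} {y : E} {r : ℕ∞ω}
    (h : ∀ i j, ContDiffAt ℝ r (fun y => f y i j) y) (hd : (f y).det ≠ 0) (i j : Fin m) :
    ContDiffAt ℝ r (fun y => (f y)⁻¹ i j) y := by
  simp_rw [Matrix.inv_def, Matrix.smul_apply, Ring.inverse_eq_inv', Matrix.adjugate_apply]
  refine ((det_contDiffAt h).inv hd).smul (det_contDiffAt fun a b => ?_)
  by_cases hab : a = j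
  · subst hab
    simp only [Matrix.updateRow_self]
    exact contDiffAt_const
  · simp only [Matrix.updateRow_ne hab]
    exact h a b

/-- A kernel vector of the Gram matrix would be the coordinate vector of an element in the right
radical of the form. -/
theorem det_ne_zero_of_nondegenerate {V : Type*} [AddCommGroup V] [Module ℝ V]
    {B : LinearMap.BilinForm ℝ V} (hB : B.Nondegenerate) (e : Vec m ≃ₗ[ℝ] V) :
    (Matrix.of fun i j => B (e (bv i)) (e (bv j))).det ≠ 0 := by
  intro h0
  obtain ⟨w, hw, h⟩ := Matrix.exists_mulVec_eq_zero_iff.2 h0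
  apply hw
  have hz : e (WithLp.toLp 2 w) = 0 := by
    apply hB.2
    intro v
    obtain ⟨u, rfl⟩ := e.surjective v
    have h1 : ∀ i, B (e (bv i)) (e (WithLp.toLp 2 w)) = 0 := by
      intro i
      have h2 := congrFun h i
      rw [map_eq_sum e (WithLp.toLp 2 w), map_sum]
      simp only [Matrix.mulVec, dotProduct, Matrix.of_apply, Pi.zero_apply] at h2
      rw [← h2]
      exact Finset.sum_congr rfl fun j _ => by rw [map_smul, smul_eq_mul, mul_comm]
    rw [map_eq_sum e u, map_sum, LinearMap.sum_apply]
    simp [h1]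
  have := e.injective (hz.trans e.map_zero.symm)
  funext i
  exact congrArg (fun v : Vec m => v i) this

end Inverse

end LinearAlgebra

/-! ### Metrics as bilinear maps, and the Christoffel symbols of the temporal metric. -/

section Metrics

section Algebra

variable {m : ℕ} {lo up : Fin m → Fin m → ℝ} (hs : ∀ i j, lo i j = lo j i)
  (hinv : ∀ i j, ∑ k, up i k * lo k j = if i = j then 1 else 0)
  (hinv' : ∀ i j, ∑ k, lo i k * up k j = if i = j then 1 else 0)

theorem bil_bv_right (a : Fin m → Fin m → ℝ) (u : Vec m) (j : Fin m) :
    bil a u (bv j) = ∑ i, a i j * u i := by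
  simp [bil_apply]

theorem bil_bv_left (a : Fin m → Fin m → ℝ) (u : Vec m) (i : Fin m) :
    bil a (bv i) u = ∑ j, a i j * u j := by
  simp [bil_apply]

include hinv in
theorem bil_left_cancel {u : Vec m} (h : ∀ v, bil lo v u = 0) : u = 0 := by
  ext i
  have e := sum_up_mul_sum_lo hinv (fun l => u l) i
  rw [← e]
  simp_rw [← bil_bv_left lo u, h]
  simp

include hs hinv in
theorem bil_injective {u u' : Vec m} (h : ∀ v, bil lo u v = bil lo u' v) : u = u' := by
  rw [← sub_eq_zero]
  refine bil_left_cancel (lo := lo) hinv fun v => ?_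
  rw [bil_symm hs, map_sub, LinearMap.sub_apply, h, sub_self]

include hs hinv' in
-- The index-free version of `koszul_metrical`, with the direction of differentiation contracted
-- with `w`; both sides are bilinear in `u` and `v`, so basis vectors suffice.
theorem koszul_bil {d : Fin m → Fin m → Fin m → ℝ} (hd : ∀ i j k, d i j k = d j i k)
    (u v w : Vec m) :
    bil (fun i j => ∑ k, w k * d i j k) u v
      = bil lo (bilV (koszul up d) u w) v + bil lo u (bilV (koszul up d) v w) := by
  have key := bilin_ext_bv (f := bil (fun i j => ∑ k, w k * d i j k))
    (g := (bil lo) ∘ₗ ((bilV (koszul up d)).flip w)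
      + (((bil lo).flip ∘ₗ ((bilV (koszul up d)).flip w)).flip)) ?_ u v
  · exact key
  intro i j
  rw [bil_bv]
  change _ = bil lo (bilV (koszul up d) (bv i) w) (bv j) +
    bil lo (bv i) (bilV (koszul up d) (bv j) w)
  have e : ∀ l i, bilV (koszul up d) (bv i) w l = ∑ k, koszul up d l i k * w k := by
    intro l i
    simp [bilV_apply]
  rw [bil_bv_left, bil_bv_right]
  simp_rw [e, Finset.mul_sum]
  rw [Finset.sum_comm, Finset.sum_comm (f := fun x i_1 => lo i x * _), ← Finset.sum_add_distrib]
  refine Finset.sum_congr rfl fun k _ => ?_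
  rw [← koszul_metrical hs hinv' hd i j k, mul_add, Finset.mul_sum, Finset.mul_sum]
  congr 1 <;> exact Finset.sum_congr rfl fun l _ => by ring

include hs hinv in
/-- A symmetric bilinear map is determined by its metricity. -/
theorem eq_of_metrical_of_symm {K K' : Vec m → Vec m → Vec m} (hK : ∀ u w, K u w = K w u)
    (hK' : ∀ u w, K' u w = K' w u)
    (h : ∀ u v w, bil lo (K u w) v + bil lo u (K v w) = bil lo (K' u w) v + bil lo u (K' v w))
    (u w : Vec m) : K u w = K' u w := by
  refine bil_injective hs hinv fun v => ?_
  have := eq_zero_of_skew_of_symm (t := fun u v w => bil lo (K u w) v - bil lo (K' u w) v)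
    (fun u v w => ?_) (fun u v w => ?_) u v w
  · linarith
  · have e := h u v w
    rw [bil_symm hs u, bil_symm hs u] at e
    linarith
  · simp only [hK u w, hK' u w]

end Algebra

/-! ### The temporal metric -/

section Time

variable {p : ℕ} {T : Type*} [TopologicalSpace T] [ChartedSpace (Vec p) T]
  [IsManifold (𝓡 p) ∞ T] (h : SemiRiemannianMetric p T) {φ χ : OpenPartialHomeomorph T (Vec p)}

namespace SemiRiemannianMetric

theorem lo_symm (φ : OpenPartialHomeomorph T (Vec p)) (α β : Fin p) (u : Vec p) :
    h.lo φ α β u = h.lo φ β α u := (h.symm _).eq _ _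

theorem lo_contDiffAt (hφ : φ ∈ IsManifold.maximalAtlas (𝓡 p) ∞ T) {u : Vec p}
    (hu : u ∈ φ.target) (α β : Fin p) : ContDiffAt ℝ ∞ (h.lo φ α β) u :=
  (h.smooth φ hφ α β).contDiffAt (φ.open_target.mem_nhds hu)

/-- Expressing the components through the intrinsic form reduces their tensor law to the behaviour
of the inverse chart derivatives. -/
theorem bil_lo (φ : OpenPartialHomeomorph T (Vec p)) (u a b : Vec p) :
    bil (fun α β => h.lo φ α β u) a b = h.form (φ.symm u)
      ((chartD φ (φ.symm u)).inverse a) ((chartD φ (φ.symm u)).inverse b) :=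
  bil_eq (h.form (φ.symm u)) (chartD φ (φ.symm u)).inverse.toLinearMap a b

theorem det_ne_zero (hφ : φ ∈ IsManifold.maximalAtlas (𝓡 p) ∞ T) {u : Vec p} (hu : u ∈ φ.target) :
    (Matrix.of fun α β => h.lo φ α β u).det ≠ 0 := by
  obtain ⟨E, hE⟩ := (chartD_isInvertible hφ (φ.map_target hu)).inverse
  have := det_ne_zero_of_nondegenerate (h.nondegenerate (φ.symm u)) E.toLinearEquiv
  have e : ∀ a, E.toLinearEquiv a = (chartD φ (φ.symm u)).inverse a := fun a => by
    rw [← hE]; rfl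
  simp_rw [e] at this
  exact this

theorem up_mul_lo (hφ : φ ∈ IsManifold.maximalAtlas (𝓡 p) ∞ T) {u : Vec p} (hu : u ∈ φ.target)
    (α β : Fin p) : ∑ γ, h.up φ α γ u * h.lo φ γ β u = if α = β then 1 else 0 := by
  have := Matrix.nonsing_inv_mul (Matrix.of fun α β => h.lo φ α β u)
    (isUnit_iff_ne_zero.2 (h.det_ne_zero hφ hu))
  have e := congrFun (congrFun this α) β
  rw [Matrix.mul_apply, Matrix.one_apply] at e
  exact e

theorem lo_mul_up (hφ : φ ∈ IsManifold.maximalAtlas (𝓡 p) ∞ T) {u : Vec p} (hu : u ∈ φ.target)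
    (α β : Fin p) : ∑ γ, h.lo φ α γ u * h.up φ γ β u = if α = β then 1 else 0 := by
  have := Matrix.mul_nonsing_inv (Matrix.of fun α β => h.lo φ α β u)
    (isUnit_iff_ne_zero.2 (h.det_ne_zero hφ hu))
  have e := congrFun (congrFun this α) β
  rw [Matrix.mul_apply, Matrix.one_apply] at e
  exact e

theorem up_contDiffAt (hφ : φ ∈ IsManifold.maximalAtlas (𝓡 p) ∞ T) {u : Vec p}
    (hu : u ∈ φ.target) (α β : Fin p) : ContDiffAt ℝ ∞ (h.up φ α β) u :=
  inv_contDiffAt (f := fun u => Matrix.of fun α β => h.lo φ α β u)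
    (fun i j => h.lo_contDiffAt hφ hu i j) (h.det_ne_zero hφ hu) α β

theorem fderiv_contDiffAt {E : Type*} [NormedAddCommGroup E] [NormedSpace ℝ E] {f : E → ℝ} {y : E}
    (hf : ContDiffAt ℝ ∞ f y) (w : E) : ContDiffAt ℝ ∞ (fun y => fderiv ℝ f y w) y :=
  (hf.fderiv_right (m := ∞) (by simp)).clm_apply contDiffAt_const

theorem christoffel_contDiffAt (hφ : φ ∈ IsManifold.maximalAtlas (𝓡 p) ∞ T) {u : Vec p}
    (hu : u ∈ φ.target) (γ α β : Fin p) : ContDiffAt ℝ ∞ (h.christoffel φ γ α β) u :=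
  ContDiffAt.sum fun _ _ => ((h.up_contDiffAt hφ hu _ _).div_const 2).mul
    (((fderiv_contDiffAt (h.lo_contDiffAt hφ hu _ _) _).add
      (fderiv_contDiffAt (h.lo_contDiffAt hφ hu _ _) _)).sub
      (fderiv_contDiffAt (h.lo_contDiffAt hφ hu _ _) _))

theorem christoffel_eq_koszul (γ α β : Fin p) (u : Vec p) :
    h.christoffel φ γ α β u = koszul (fun α β => h.up φ α β u)
      (fun α β μ => fderiv ℝ (h.lo φ α β) u (bv μ)) γ α β := rfl

/-- The Christoffel symbols as a bilinear map. -/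
def chr (φ : OpenPartialHomeomorph T (Vec p)) (u : Vec p) : Vec p →ₗ[ℝ] Vec p →ₗ[ℝ] Vec p :=
  bilV fun γ α β => h.christoffel φ γ α β u

theorem dlo_symm (α β : Fin p) (u w : Vec p) :
    fderiv ℝ (h.lo φ α β) u w = fderiv ℝ (h.lo φ β α) u w := by
  have : h.lo φ α β = h.lo φ β α := funext fun u => h.lo_symm φ α β u
  rw [this]

theorem chr_symm (u a b : Vec p) : h.chr φ u a b = h.chr φ u b a := by
  refine bilV_symm (fun γ i j => ?_) a b
  rw [christoffel_eq_koszul, christoffel_eq_koszul]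
  exact koszul_symm (d := fun α β μ => fderiv ℝ (h.lo φ α β) u (bv μ))
    (fun i j k => h.dlo_symm i j u (bv k)) γ i j

theorem chr_metrical (hφ : φ ∈ IsManifold.maximalAtlas (𝓡 p) ∞ T) {u : Vec p}
    (hu : u ∈ φ.target) (a b w : Vec p) :
    bil (fun α β => fderiv ℝ (h.lo φ α β) u w) a b
      = bil (fun α β => h.lo φ α β u) (h.chr φ u a w) b
        + bil (fun α β => h.lo φ α β u) a (h.chr φ u b w) := by
  have e : ∀ α β, fderiv ℝ (h.lo φ α β) u w = ∑ μ, w μ * fderiv ℝ (h.lo φ α β) u (bv μ) :=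
    fun α β => by rw [map_eq_sum]; rfl
  simp_rw [e]
  exact koszul_bil (d := fun α β μ => fderiv ℝ (h.lo φ α β) u (bv μ))
    (fun i j => h.lo_symm φ i j u) (h.lo_mul_up hφ hu) (fun _ _ _ => h.dlo_symm _ _ _ _) a b w

theorem bil_lo_trans (hφ : φ ∈ IsManifold.maximalAtlas (𝓡 p) ∞ T)
    (hχ : χ ∈ IsManifold.maximalAtlas (𝓡 p) ∞ T) {u : Vec p} (hu : u ∈ φ.target)
    (hu' : φ.symm u ∈ χ.source) (a b : Vec p) :
    bil (fun α β => h.lo φ α β u) a b = bil (fun α β => h.lo χ α β (trans φ χ u))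
      (fderiv ℝ (trans φ χ) u a) (fderiv ℝ (trans φ χ) u b) := by
  rw [bil_lo, bil_lo]
  have e : χ.symm (trans φ χ u) = φ.symm u := χ.left_inv hu'
  rw [e, chartD_inverse_trans hφ hχ hu hu', chartD_inverse_trans hφ hχ hu hu']

theorem trans_mem_target {u : Vec p} (hu' : φ.symm u ∈ χ.source) :
    trans φ χ u ∈ χ.target := χ.map_source hu'

/-- Differentiating the tensor law of the metric, including the moving Jacobians. The two terms with
second derivatives are the source of the inhomogeneous term in the law of the Christoffel symbols.
-/
theorem bil_dlo_trans (hφ : φ ∈ IsManifold.maximalAtlas (𝓡 p) ∞ T)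
    (hχ : χ ∈ IsManifold.maximalAtlas (𝓡 p) ∞ T) {u : Vec p} (hu : u ∈ φ.target)
    (hu' : φ.symm u ∈ χ.source) (a b w : Vec p) :
    bil (fun α β => fderiv ℝ (h.lo φ α β) u w) a b =
      bil (fun α β => fderiv ℝ (h.lo χ α β) (trans φ χ u) (fderiv ℝ (trans φ χ) u w))
        (fderiv ℝ (trans φ χ) u a) (fderiv ℝ (trans φ χ) u b)
      + bil (fun α β => h.lo χ α β (trans φ χ u)) (D2 (trans φ χ) u w a) (fderiv ℝ (trans φ χ) u b)
      + bil (fun α β => h.lo χ α β (trans φ χ u)) (fderiv ℝ (trans φ χ) u a)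
          (D2 (trans φ χ) u w b) := by
  have ht := trans_contDiffAt hφ hχ hu hu'
  have htd : DifferentiableAt ℝ (trans φ χ) u := ht.differentiableAt (by simp)
  have hd : ∀ a, DifferentiableAt ℝ (fun u => fderiv ℝ (trans φ χ) u a) u := fun a =>
    ((ht.fderiv_right (m := ∞) (by simp)).clm_apply contDiffAt_const).differentiableAt (by simp)
  have hl : ∀ α β, DifferentiableAt ℝ (h.lo φ α β) u := fun α β =>
    (h.lo_contDiffAt hφ hu α β).differentiableAt (by simp)
  have hl' : ∀ α β, DifferentiableAt ℝ (h.lo χ α β) (trans φ χ u) := fun α β =>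
    (h.lo_contDiffAt hχ (χ.map_source hu') α β).differentiableAt (by simp)
  have e1 := bil_fderiv (a := h.lo φ) (U := fun _ => a) (V := fun _ => b) hl
    (differentiableAt_const a) (differentiableAt_const b) w
  have e2 := bil_fderiv (a := fun α β u => h.lo χ α β (trans φ χ u))
    (U := fun u => fderiv ℝ (trans φ χ) u a) (V := fun u => fderiv ℝ (trans φ χ) u b)
    (fun α β => (hl' α β).comp u htd) (hd a) (hd b) w
  have k : (fun u => bil (fun α β => h.lo φ α β u) a b) =ᶠ[𝓝 u] fun u =>
      bil (fun α β => h.lo χ α β (trans φ χ u))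
      (fderiv ℝ (trans φ χ) u a) (fderiv ℝ (trans φ χ) u b) := by
    filter_upwards [(isOpen_overlap φ χ).mem_nhds ⟨hu, hu'⟩] with z hz
    exact h.bil_lo_trans hφ hχ hz.1 hz.2 a b
  rw [k.fderiv_eq, e2] at e1
  have e3 : ∀ α β, fderiv ℝ (fun u => h.lo χ α β (trans φ χ u)) u w
      = fderiv ℝ (h.lo χ α β) (trans φ χ u) (fderiv ℝ (trans φ χ) u w) := fun α β => by
    rw [fderiv_fun_comp u (hl' α β) htd]
    rfl
  simp only [e3, fderiv_fun_const, Pi.zero_apply, zero_apply, map_zero,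
    LinearMap.zero_apply, add_zero] at e1
  exact e1.symm

/-- The transformation law of the Christoffel symbols. -/
theorem chr_trans (hφ : φ ∈ IsManifold.maximalAtlas (𝓡 p) ∞ T)
    (hχ : χ ∈ IsManifold.maximalAtlas (𝓡 p) ∞ T) {u : Vec p} (hu : u ∈ φ.target)
    (hu' : φ.symm u ∈ χ.source) (a b : Vec p) :
    fderiv ℝ (trans φ χ) u (h.chr φ u a b) = h.chr χ (trans φ χ u) (fderiv ℝ (trans φ χ) u a)
      (fderiv ℝ (trans φ χ) u b) + D2 (trans φ χ) u a b := by
  have hi := trans_isInvertible hφ hχ hu hu'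
  have ht := trans_contDiffAt hφ hχ hu hu'
  set P := fderiv ℝ (trans φ χ) u with hP
  -- `K'` is the pullback of the symbols of `χ`, inhomogeneous term included. It is symmetric and
  -- metrical for the components of `h` in `φ`, as are the symbols of `φ`, so the two agree by
  -- uniqueness.
  set K' : Vec p → Vec p → Vec p := fun a b => P.inverse (h.chr χ (trans φ χ u) (P a) (P b)
    + D2 (trans φ χ) u a b) with hK'
  have hPK : ∀ a b, P (K' a b) = h.chr χ (trans φ χ u) (P a) (P b) + D2 (trans φ χ) u a b :=
    fun a b => hi.self_apply_inverse _
  rw [← hPK]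
  congr 1
  refine eq_of_metrical_of_symm (lo := fun α β => h.lo φ α β u) (fun i j => h.lo_symm φ i j u)
    (h.up_mul_lo hφ hu) (h.chr_symm u) (fun a b => ?_) (fun a b w => ?_) a b
  · rw [hK']
    simp only
    rw [h.chr_symm, D2_symm ht]
  · rw [← h.chr_metrical hφ hu, h.bil_dlo_trans hφ hχ hu hu',
      h.chr_metrical hχ (trans_mem_target hu'), h.bil_lo_trans hφ hχ hu hu',
      h.bil_lo_trans hφ hχ hu hu', ← hP, hPK, hPK, D2_symm ht w a, D2_symm ht w b]
    simp only [map_add, LinearMap.add_apply]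
    ring

end SemiRiemannianMetric
end Time

end Metrics

/-! ### Derivatives of the induced coordinate change, and the change of the spatial metric. -/

section CoordinateChange

variable {p n : ℕ}
  {T : Type*} [TopologicalSpace T] [ChartedSpace (Vec p) T] [IsManifold (𝓡 p) ∞ T]
  {M : Type*} [TopologicalSpace M] [ChartedSpace (Vec n) M] [IsManifold (𝓡 n) ∞ M]
  {h : SemiRiemannianMetric p T} (S : LagrangeSpace n M h) (c c' : JetChart p n T M)

namespace JetChart

/-- The Jacobian of the coordinate change of `T`. -/
def jacT (y : JetModel p n) : Vec p →L[ℝ] Vec p := fderiv ℝ (trans c.time c'.time) y.1.1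

/-- The Jacobian of the coordinate change of `M`. -/
def jacX (y : JetModel p n) : Vec n →L[ℝ] Vec n := fderiv ℝ (trans c.space c'.space) y.1.2

/-- The second derivative of the coordinate change of `T`. -/
def hessT (y : JetModel p n) (a b : Vec p) : Vec p := D2 (trans c.time c'.time) y.1.1 a b

/-- The second derivative of the coordinate change of `M`. -/
def hessX (y : JetModel p n) : Vec n → Vec n → Vec n := D2 (trans c.space c'.space) y.1.2

/-- The derivative of the induced coordinate change. -/
def changeD (y : JetModel p n) : JetModel p n →L[ℝ] JetModel p n := fderiv ℝ (c.change c') y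

variable {c c'} {y : JetModel p n} (hy : y ∈ c.overlap c')
include hy

theorem jacT_isInvertible : (c.jacT c' y).IsInvertible :=
  trans_isInvertible c.time_mem c'.time_mem hy.1.1 hy.2.1

theorem jacX_isInvertible : (c.jacX c' y).IsInvertible :=
  trans_isInvertible c.space_mem c'.space_mem hy.1.2 hy.2.2

theorem transT_contDiffAt : ContDiffAt ℝ ∞ (trans c.time c'.time) y.1.1 :=
  trans_contDiffAt c.time_mem c'.time_mem hy.1.1 hy.2.1

theorem transX_contDiffAt : ContDiffAt ℝ ∞ (trans c.space c'.space) y.1.2 :=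
  trans_contDiffAt c.space_mem c'.space_mem hy.1.2 hy.2.2

theorem change_mem : c.change c' y ∈ c'.target := by
  rw [← coord_param_eq_change hy.1 hy.2]
  exact coord_mem hy.2

theorem param_change : c'.param (c.change c' y) = c.param y := by
  rw [← coord_param_eq_change hy.1 hy.2, param_coord hy.2]

theorem hessT_symm (a b : Vec p) : c.hessT c' y a b = c.hessT c' y b a :=
  D2_symm (transT_contDiffAt hy) a b

theorem hessX_symm (a b : Vec n) : c.hessX c' y a b = c.hessX c' y b a :=
  D2_symm (transX_contDiffAt hy) a b

theorem hessT_eq (a b : Vec p) : c.hessT c' y a b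
    = D2L (trans c.time c'.time) y.1.1 a b := D2_eq (transT_contDiffAt hy) a b

theorem hessX_eq (a b : Vec n) : c.hessX c' y a b
    = D2L (trans c.space c'.space) y.1.2 a b := D2_eq (transX_contDiffAt hy) a b

/-- The velocities of `change` contain the inverse temporal Jacobian. Evaluating on the image of
that Jacobian removes it, so derivatives can be found from this identity without a formula for the
derivative of an inverse. -/
theorem change_snd_apply (z : Vec p) :
    (c.change c' y).2 (c.jacT c' y z) = c.jacX c' y (y.2 z) := by
  change (c.jacX c' y) (y.2 ((c.jacT c' y).inverse (c.jacT c' y z))) = _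
  rw [(jacT_isInvertible hy).inverse_apply_self]

theorem change_differentiableAt : DifferentiableAt ℝ (c.change c') y :=
  (change_contDiffAt hy).differentiableAt (by simp)

theorem jacT_differentiableAt : DifferentiableAt ℝ (c.jacT c') y :=
  (((transT_contDiffAt hy).fderiv_right (m := ∞) (by simp)).differentiableAt (by simp)).comp y
    (f := fun y : JetModel p n => y.1.1) (by fun_prop)

theorem jacX_differentiableAt : DifferentiableAt ℝ (c.jacX c') y :=
  (((transX_contDiffAt hy).fderiv_right (m := ∞) (by simp)).differentiableAt (by simp)).comp y
    (f := fun y : JetModel p n => y.1.2) (by fun_prop)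

theorem fderiv_jacT (w : JetModel p n) (z : Vec p) :
    fderiv ℝ (c.jacT c') y w z = c.hessT c' y w.1.1 z := by
  have h1 := ((transT_contDiffAt hy).fderiv_right (m := ∞) (by simp)).differentiableAt (by simp)
  have h2 := h1.hasFDerivAt.comp y
    (((ContinuousLinearMap.fst ℝ (Vec p) (Vec n)) ∘L
      (ContinuousLinearMap.fst ℝ (Vec p × Vec n) (Vec p →L[ℝ] Vec n))).hasFDerivAt)
  have h3 : fderiv ℝ (c.jacT c') y = _ := h2.fderiv
  rw [h3, hessT, D2_eq (transT_contDiffAt hy)]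
  rfl

theorem fderiv_jacX (w : JetModel p n) (z : Vec n) :
    fderiv ℝ (c.jacX c') y w z = c.hessX c' y w.1.2 z := by
  have h1 := ((transX_contDiffAt hy).fderiv_right (m := ∞) (by simp)).differentiableAt (by simp)
  have h2 := h1.hasFDerivAt.comp y
    (((ContinuousLinearMap.snd ℝ (Vec p) (Vec n)) ∘L
      (ContinuousLinearMap.fst ℝ (Vec p × Vec n) (Vec p →L[ℝ] Vec n))).hasFDerivAt)
  have h3 : fderiv ℝ (c.jacX c') y = _ := h2.fderiv
  rw [h3, hessX, D2_eq (transX_contDiffAt hy)]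
  rfl

theorem changeD_time (w : JetModel p n) : (c.changeD c' y w).1.1 = c.jacT c' y w.1.1 := by
  have h1 := (((ContinuousLinearMap.fst ℝ (Vec p) (Vec n)) ∘L
      (ContinuousLinearMap.fst ℝ (Vec p × Vec n) (Vec p →L[ℝ] Vec n))).hasFDerivAt).comp y
    (change_differentiableAt hy).hasFDerivAt
  have h2 := ((transT_contDiffAt hy).differentiableAt (by simp)).hasFDerivAt.comp y
    (((ContinuousLinearMap.fst ℝ (Vec p) (Vec n)) ∘L
      (ContinuousLinearMap.fst ℝ (Vec p × Vec n) (Vec p →L[ℝ] Vec n))).hasFDerivAt)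
  exact congrArg (fun f => f w) (h1.unique h2)

theorem changeD_space (w : JetModel p n) : (c.changeD c' y w).1.2 = c.jacX c' y w.1.2 := by
  have h1 := (((ContinuousLinearMap.snd ℝ (Vec p) (Vec n)) ∘L
      (ContinuousLinearMap.fst ℝ (Vec p × Vec n) (Vec p →L[ℝ] Vec n))).hasFDerivAt).comp y
    (change_differentiableAt hy).hasFDerivAt
  have h2 := ((transX_contDiffAt hy).differentiableAt (by simp)).hasFDerivAt.comp y
    (((ContinuousLinearMap.snd ℝ (Vec p) (Vec n)) ∘L
      (ContinuousLinearMap.fst ℝ (Vec p × Vec n) (Vec p →L[ℝ] Vec n))).hasFDerivAt)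
  exact congrArg (fun f => f w) (h1.unique h2)

/-- Obtained by differentiating `change_snd_apply`: the spatial Hessian comes from the moving
spatial Jacobian, the temporal one from the moving argument on the left-hand side. -/
theorem changeD_vert (w : JetModel p n) (z : Vec p) :
    (c.changeD c' y w).2 (c.jacT c' y z)
      = c.hessX c' y w.1.2 (y.2 z) + c.jacX c' y (w.2 z)
        - (c.change c' y).2 (c.hessT c' y w.1.1 z) := by
  have h1 : HasFDerivAt (fun y => (c.change c' y).2)
      ((ContinuousLinearMap.snd ℝ (Vec p × Vec n) (Vec p →L[ℝ] Vec n)) ∘L c.changeD c' y) y :=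
    ((ContinuousLinearMap.snd ℝ (Vec p × Vec n) (Vec p →L[ℝ] Vec n)).hasFDerivAt).comp y
      (change_differentiableAt hy).hasFDerivAt
  have h2 : HasFDerivAt (fun y : JetModel p n => y.2)
      (ContinuousLinearMap.snd ℝ (Vec p × Vec n) (Vec p →L[ℝ] Vec n)) y :=
    (ContinuousLinearMap.snd ℝ (Vec p × Vec n) (Vec p →L[ℝ] Vec n)).hasFDerivAt
  have h3 := (jacT_differentiableAt hy).hasFDerivAt.clm_apply (hasFDerivAt_const z y)
  have h4 := h1.clm_apply h3
  have h5 := (jacX_differentiableAt hy).hasFDerivAt.clm_apply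
    (h2.clm_apply (hasFDerivAt_const z y))
  have k : (fun y => (c.change c' y).2 (c.jacT c' y z)) =ᶠ[𝓝 y]
      fun y => c.jacX c' y (y.2 z) := by
    filter_upwards [(c.isOpen_overlap c').mem_nhds hy] with s hs
    exact change_snd_apply hs z
  have h6 := congrArg (fun f => f w) (h4.unique (h5.congr_of_eventuallyEq k))
  simp only [ContinuousLinearMap.comp_zero, zero_add, add_apply,
    ContinuousLinearMap.comp_apply, ContinuousLinearMap.flip_apply,
    ContinuousLinearMap.coe_snd', fderiv_jacT hy, fderiv_jacX hy] at h6
  rw [eq_sub_iff_add_eq, add_comm, h6, add_comm]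

/-- Two vertical vectors with the same values on the image of the Jacobian are equal. -/
theorem ext_jacT {V : Type*} [NormedAddCommGroup V] [NormedSpace ℝ V] {A B : Vec p →L[ℝ] V}
    (h : ∀ z, A (c.jacT c' y z) = B (c.jacT c' y z)) : A = B := by
  ext1 z
  rw [← (jacT_isInvertible hy).self_apply_inverse z]
  exact h _

end JetChart

namespace LagrangeSpace

open JetChart

variable {c c'} {y : JetModel p n}

theorem lo_symm (c : JetChart p n T M) (i j : Fin n) (y : JetModel p n) :
    S.lo c i j y = S.lo c j i y := (S.g_symm _).eq _ _

theorem lo_contDiffAt (hy : y ∈ c.target) (i j : Fin n) : ContDiffAt ℝ ∞ (S.lo c i j) y :=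
  (S.g_smooth c i j).contDiffAt (c.isOpen_target.mem_nhds hy)

theorem bil_lo (c : JetChart p n T M) (y : JetModel p n) (u v : Vec n) :
    bil (fun i j => S.lo c i j y) u v = S.g (c.param y)
      ((chartD c.space (c.param y).1.2).inverse u) ((chartD c.space (c.param y).1.2).inverse v) :=
  bil_eq (S.g (c.param y)) (chartD c.space (c.param y).1.2).inverse.toLinearMap u v

theorem det_ne_zero (hy : y ∈ c.target) : (Matrix.of fun i j => S.lo c i j y).det ≠ 0 := by
  obtain ⟨E, hE⟩ := (chartD_isInvertible c.space_mem (c.space.map_target hy.2)).inverse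
  have := det_ne_zero_of_nondegenerate (S.g_nondegenerate (c.param y)) E.toLinearEquiv
  have e : ∀ a, E.toLinearEquiv a = (chartD c.space (c.space.symm y.1.2)).inverse a := fun a => by
    rw [← hE]; rfl
  convert this using 2
  funext i j
  exact (congrArg₂ (fun a b => S.g (c.param y) a b) (e (bv i)) (e (bv j))).symm

theorem up_mul_lo (hy : y ∈ c.target) (i j : Fin n) :
    ∑ k, S.up c i k y * S.lo c k j y = if i = j then 1 else 0 := by
  have := Matrix.nonsing_inv_mul (Matrix.of fun i j => S.lo c i j y)
    (isUnit_iff_ne_zero.2 (S.det_ne_zero hy))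
  have e := congrFun (congrFun this i) j
  rw [Matrix.mul_apply, Matrix.one_apply] at e
  exact e

theorem lo_mul_up (hy : y ∈ c.target) (i j : Fin n) :
    ∑ k, S.lo c i k y * S.up c k j y = if i = j then 1 else 0 := by
  have := Matrix.mul_nonsing_inv (Matrix.of fun i j => S.lo c i j y)
    (isUnit_iff_ne_zero.2 (S.det_ne_zero hy))
  have e := congrFun (congrFun this i) j
  rw [Matrix.mul_apply, Matrix.one_apply] at e
  exact e

theorem up_contDiffAt (hy : y ∈ c.target) (i j : Fin n) : ContDiffAt ℝ ∞ (S.up c i j) y :=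
  inv_contDiffAt (f := fun y => Matrix.of fun i j => S.lo c i j y)
    (fun i j => S.lo_contDiffAt hy i j) (S.det_ne_zero hy) i j

theorem lag_contDiffAt (hy : y ∈ c.target) : ContDiffAt ℝ ∞ (S.lag c) y :=
  contMDiffAt_iff_contDiffAt.1 ((S.smooth.contMDiffAt).comp y (c.contMDiffAt_param hy))

theorem bil_lo_change (hy : y ∈ c.overlap c') (u v : Vec n) :
    bil (fun i j => S.lo c i j y) u v = bil (fun i j => S.lo c' i j (c.change c' y))
      (c.jacX c' y u) (c.jacX c' y v) := by
  rw [bil_lo, bil_lo, param_change hy]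
  have e := chartD_inverse_trans c.space_mem c'.space_mem hy.1.2 hy.2.2
  exact (congrArg₂ (fun a b => S.g (c.param y) a b) (e u) (e v)).symm

/-- The spatial analogue of `bil_dlo_trans`. The direction is an arbitrary tangent vector of the jet
space, but only its spatial component enters the Hessians, since the spatial Jacobian depends on `x`
alone. -/
theorem bil_dlo_change (hy : y ∈ c.overlap c') (u v : Vec n) (w : JetModel p n) :
    bil (fun i j => fderiv ℝ (S.lo c i j) y w) u v =
      bil (fun i j => fderiv ℝ (S.lo c' i j) (c.change c' y) (c.changeD c' y w))
        (c.jacX c' y u) (c.jacX c' y v)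
      + bil (fun i j => S.lo c' i j (c.change c' y)) (c.hessX c' y w.1.2 u) (c.jacX c' y v)
      + bil (fun i j => S.lo c' i j (c.change c' y)) (c.jacX c' y u) (c.hessX c' y w.1.2 v) := by
  have hcd := change_differentiableAt hy
  have hl : ∀ i j, DifferentiableAt ℝ (S.lo c i j) y := fun i j =>
    (S.lo_contDiffAt hy.1 i j).differentiableAt (by simp)
  have hl' : ∀ i j, DifferentiableAt ℝ (S.lo c' i j) (c.change c' y) := fun i j =>
    (S.lo_contDiffAt (change_mem hy) i j).differentiableAt (by simp)
  have hd : ∀ u, DifferentiableAt ℝ (fun y => c.jacX c' y u) y := fun u =>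
    (jacX_differentiableAt hy).clm_apply (differentiableAt_const u)
  have hd' : ∀ u, fderiv ℝ (fun y => c.jacX c' y u) y w = c.hessX c' y w.1.2 u := fun u => by
    rw [fderiv_clm_apply_vec (jacX_differentiableAt hy) (differentiableAt_const u),
      fderiv_jacX hy]
    simp
  have e1 := bil_fderiv (a := S.lo c) (U := fun _ => u) (V := fun _ => v) hl
    (differentiableAt_const u) (differentiableAt_const v) w
  have e2 := bil_fderiv (a := fun i j y => S.lo c' i j (c.change c' y))
    (U := fun y => c.jacX c' y u) (V := fun y => c.jacX c' y v)
    (fun i j => (hl' i j).comp y hcd) (hd u) (hd v) w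
  have k : (fun y => bil (fun i j => S.lo c i j y) u v) =ᶠ[𝓝 y] fun y =>
      bil (fun i j => S.lo c' i j (c.change c' y)) (c.jacX c' y u) (c.jacX c' y v) := by
    filter_upwards [(c.isOpen_overlap c').mem_nhds hy] with z hz
    exact S.bil_lo_change hz u v
  rw [k.fderiv_eq, e2, hd', hd'] at e1
  have e3 : ∀ i j, fderiv ℝ (fun y => S.lo c' i j (c.change c' y)) y w
      = fderiv ℝ (S.lo c' i j) (c.change c' y) (c.changeD c' y w) := fun i j => by
    rw [fderiv_fun_comp y (hl' i j) hcd]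
    rfl
  simp only [e3, fderiv_fun_const, Pi.zero_apply, zero_apply, map_zero,
    LinearMap.zero_apply, add_zero] at e1
  exact e1.symm

theorem lag_change (hy : y ∈ c.overlap c') : S.lag c y = S.lag c' (c.change c' y) := by
  rw [lag, lag, param_change hy]

end LagrangeSpace

end CoordinateChange

/-! ### First and second vertical derivatives of the Lagrangian. -/

section Momentum

/-- The second derivative of a function as a bilinear map. -/
def hess2 {E : Type*} [NormedAddCommGroup E] [NormedSpace ℝ E] (f : E → ℝ) (y : E) :
    E →ₗ[ℝ] E →ₗ[ℝ] ℝ :=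
  ContinuousLinearMap.coeLM ℝ ∘ₗ (fderiv ℝ (fderiv ℝ f) y).toLinearMap

theorem hess2_apply {E : Type*} [NormedAddCommGroup E] [NormedSpace ℝ E] (f : E → ℝ) (y v w : E) :
    hess2 f y v w = fderiv ℝ (fderiv ℝ f) y v w := rfl

theorem fderiv_fderiv_comp_inr {E₁ E₂ G : Type*} [NormedAddCommGroup E₁] [NormedSpace ℝ E₁]
    [NormedAddCommGroup E₂] [NormedSpace ℝ E₂] [NormedAddCommGroup G] [NormedSpace ℝ G]
    {f : E₁ × E₂ → ℝ} {F : G → E₁ × E₂} {B : G → E₂} {y : G}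
    (hf : DifferentiableAt ℝ (fderiv ℝ f) (F y)) (hF : DifferentiableAt ℝ F y)
    (hB : DifferentiableAt ℝ B y) (w : G) :
    fderiv ℝ (fun s => fderiv ℝ f (F s) (0, B s)) y w
      = fderiv ℝ (fderiv ℝ f) (F y) (fderiv ℝ F y w) (0, B y)
        + fderiv ℝ f (F y) (0, fderiv ℝ B y w) := by
  have hV : HasFDerivAt (fun s => ((0, B s) : E₁ × E₂))
      (ContinuousLinearMap.inr ℝ E₁ E₂ ∘L fderiv ℝ B y) y :=
    (ContinuousLinearMap.inr ℝ E₁ E₂).hasFDerivAt.comp y hB.hasFDerivAt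
  have hL : HasFDerivAt (fun s => fderiv ℝ f (F s))
      (fderiv ℝ (fderiv ℝ f) (F y) ∘L fderiv ℝ F y) y :=
    HasFDerivAt.comp (g := fderiv ℝ f) y hf.hasFDerivAt hF.hasFDerivAt
  rw [(hL.clm_apply hV).fderiv]
  simp [add_comm]

variable {p n : ℕ}

/-- The rank one map `u ⊗ θ`. -/
def rk (u : Vec n) (θ : Vec p →L[ℝ] ℝ) : Vec p →L[ℝ] Vec n := θ.smulRight u

theorem rk_apply (u : Vec n) (θ : Vec p →L[ℝ] ℝ) (z : Vec p) : rk u θ z = θ z • u := rfl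

theorem rk_add_left (u u' : Vec n) (θ : Vec p →L[ℝ] ℝ) : rk (u + u') θ = rk u θ + rk u' θ := by
  ext1 z; simp [rk_apply]

theorem rk_smul_left (r : ℝ) (u : Vec n) (θ : Vec p →L[ℝ] ℝ) : rk (r • u) θ = r • rk u θ := by
  ext1 z; simp [rk_apply, smul_comm r]

theorem rk_add_right (u : Vec n) (θ θ' : Vec p →L[ℝ] ℝ) : rk u (θ + θ') = rk u θ + rk u θ' := by
  ext1 z; simp [rk_apply, add_smul]

theorem rk_smul_right (r : ℝ) (u : Vec n) (θ : Vec p →L[ℝ] ℝ) : rk u (r • θ) = r • rk u θ := by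
  ext1 z; simp [rk_apply, mul_smul]

/-- `u ⊗ θ` as a bilinear map. -/
def rkL : Vec n →ₗ[ℝ] (Vec p →L[ℝ] ℝ) →ₗ[ℝ] (Vec p →L[ℝ] Vec n) :=
  LinearMap.mk₂ ℝ rk rk_add_left rk_smul_left rk_add_right rk_smul_right

theorem rkL_apply (u : Vec n) (θ : Vec p →L[ℝ] ℝ) : rkL u θ = rk u θ := rfl

/-- The coordinate covectors. -/
abbrev cv (α : Fin p) : Vec p →L[ℝ] ℝ := EuclideanSpace.proj α

theorem vertUnit_eq (i : Fin n) (α : Fin p) : vertUnit i α = rk (bv i) (cv α) := rfl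

theorem hom_eq_sum_rk (B : Vec p →L[ℝ] Vec n) : B = ∑ α, rk (B (bv α)) (cv α) := by
  ext1 z
  rw [map_eq_sum B z, sum_apply]
  rfl

theorem hom_eq_sum (B : Vec p →L[ℝ] Vec n) : B = ∑ i, ∑ α, (B (bv α) i) • vertUnit i α := by
  conv_lhs => rw [hom_eq_sum_rk B]
  rw [Finset.sum_comm]
  refine Finset.sum_congr rfl fun α _ => ?_
  rw [← rkL_apply, vec_eq_sum (B (bv α)), map_sum, LinearMap.sum_apply]
  refine Finset.sum_congr rfl fun i _ => ?_
  rw [map_smul, LinearMap.smul_apply, rkL_apply, vertUnit_eq, ← vec_eq_sum]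

theorem covec_eq_sum (θ : Vec p →L[ℝ] ℝ) : θ = ∑ α, θ (bv α) • cv α := by
  ext1 z
  rw [map_eq_sum θ z, sum_apply]
  exact Finset.sum_congr rfl fun α _ => by simp [mul_comm]

/-- The inclusion of the vertical directions. -/
def vertL : (Vec p →L[ℝ] Vec n) →ₗ[ℝ] JetModel p n :=
  LinearMap.inr ℝ (Vec p × Vec n) (Vec p →L[ℝ] Vec n)

theorem vertL_apply (B : Vec p →L[ℝ] Vec n) : (vertL B : JetModel p n) = ((0, 0), B) := rfl

theorem jet_ext {w w' : JetModel p n} (h1 : w.1.1 = w'.1.1) (h2 : w.1.2 = w'.1.2)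
    (h3 : w.2 = w'.2) : w = w' := Prod.ext (Prod.ext h1 h2) h3

variable {T : Type*} [TopologicalSpace T] [ChartedSpace (Vec p) T] [IsManifold (𝓡 p) ∞ T]
  {M : Type*} [TopologicalSpace M] [ChartedSpace (Vec n) M] [IsManifold (𝓡 n) ∞ M]

namespace SemiRiemannianMetric

variable (h : SemiRiemannianMetric p T) {φ χ : OpenPartialHomeomorph T (Vec p)}

/-- The vector dual to a covector. -/
def sharp (φ : OpenPartialHomeomorph T (Vec p)) (u : Vec p) (θ : Vec p →L[ℝ] ℝ) : Vec p :=
  WithLp.toLp 2 fun α => ∑ β, h.up φ α β u * θ (bv β)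

theorem bil_sharp (hφ : φ ∈ IsManifold.maximalAtlas (𝓡 p) ∞ T) {u : Vec p}
    (hu : u ∈ φ.target) (θ : Vec p →L[ℝ] ℝ) (b : Vec p) :
    bil (fun α β => h.lo φ α β u) (h.sharp φ u θ) b = θ b := by
  rw [bil_symm (fun i j => h.lo_symm φ i j u), map_eq_sum θ b]
  simp only [bil_apply, smul_eq_mul]
  refine Finset.sum_congr rfl fun α _ => ?_
  rw [← sum_lo_mul_sum_up (h.lo_mul_up hφ hu) (fun β => θ (bv β)) α, Finset.mul_sum]
  exact Finset.sum_congr rfl fun β _ => by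
    rw [show (h.sharp φ u θ) β = ∑ μ, h.up φ β μ u * θ (bv μ) from rfl]; ring

theorem sharp_trans (hφ : φ ∈ IsManifold.maximalAtlas (𝓡 p) ∞ T)
    (hχ : χ ∈ IsManifold.maximalAtlas (𝓡 p) ∞ T) {u : Vec p} (hu : u ∈ φ.target)
    (hu' : φ.symm u ∈ χ.source) (θ : Vec p →L[ℝ] ℝ) :
    h.sharp χ (trans φ χ u) (θ ∘L (fderiv ℝ (trans φ χ) u).inverse)
      = fderiv ℝ (trans φ χ) u (h.sharp φ u θ) := by
  have hi := trans_isInvertible hφ hχ hu hu'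
  refine bil_injective (lo := fun α β => h.lo χ α β (trans φ χ u))
    (fun i j => h.lo_symm χ i j _) (h.up_mul_lo hχ (trans_mem_target hu')) fun v => ?_
  obtain ⟨b, rfl⟩ := hi.surjective v
  rw [h.bil_sharp hχ (trans_mem_target hu'), ← h.bil_lo_trans hφ hχ hu hu', h.bil_sharp hφ hu]
  simp [hi.inverse_apply_self]

/-- The trace `H^γ_{αγ}`. -/
def trChr (φ : OpenPartialHomeomorph T (Vec p)) (u : Vec p) : Vec p →ₗ[ℝ] ℝ :=
  ∑ γ, (cv γ).toLinearMap ∘ₗ (h.chr φ u).flip (bv γ)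

theorem trChr_apply (u a : Vec p) : h.trChr φ u a = ∑ γ, cv γ (h.chr φ u a (bv γ)) := by
  simp [trChr]

theorem trChr_trans (hφ : φ ∈ IsManifold.maximalAtlas (𝓡 p) ∞ T)
    (hχ : χ ∈ IsManifold.maximalAtlas (𝓡 p) ∞ T) {u : Vec p} (hu : u ∈ φ.target)
    (hu' : φ.symm u ∈ χ.source) (a : Vec p) :
    h.trChr χ (trans φ χ u) (fderiv ℝ (trans φ χ) u a) = h.trChr φ u a
      - ∑ γ, cv γ ((fderiv ℝ (trans φ χ) u).inverse (D2 (trans φ χ) u a (bv γ))) := by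
  have hi := trans_isInvertible hφ hχ hu hu'
  have e := sum_pairing_invariant (V := ℝ) (LinearMap.mk₂ ℝ
    (fun (b : Vec p) (θ : Vec p →L[ℝ] ℝ) =>
      θ (h.chr χ (trans φ χ u) (fderiv ℝ (trans φ χ) u a) b))
    (by simp) (by simp) (by simp) (by simp)) hi
  simp only [LinearMap.mk₂_apply] at e
  rw [trChr_apply, ← e, trChr_apply, ← Finset.sum_sub_distrib]
  refine Finset.sum_congr rfl fun γ _ => ?_
  have e2 := h.chr_trans hφ hχ hu hu' a (bv γ)
  rw [eq_sub_of_add_eq e2.symm, ContinuousLinearMap.comp_apply, map_sub, hi.inverse_apply_self, map_sub]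

end SemiRiemannianMetric

namespace LagrangeSpace

variable {h : SemiRiemannianMetric p T} (S : LagrangeSpace n M h) {c c' : JetChart p n T M}
  {y : JetModel p n}

open JetChart

/-- The vertical derivative of the Lagrangian. -/
def mom (c : JetChart p n T M) (y : JetModel p n) : (Vec p →L[ℝ] Vec n) →ₗ[ℝ] ℝ :=
  (fderiv ℝ (S.lag c) y).toLinearMap ∘ₗ vertL

/-- The second derivative of the Lagrangian, one argument being vertical. -/
def mom2 (c : JetChart p n T M) (y : JetModel p n) :
    JetModel p n →ₗ[ℝ] (Vec p →L[ℝ] Vec n) →ₗ[ℝ] ℝ :=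
  (hess2 (S.lag c) y).compl₂ vertL

theorem mom_apply (B : Vec p →L[ℝ] Vec n) :
    S.mom c y B = fderiv ℝ (S.lag c) y ((0, 0), B) := rfl

theorem mom2_apply (w : JetModel p n) (B : Vec p →L[ℝ] Vec n) :
    S.mom2 c y w B = fderiv ℝ (fderiv ℝ (S.lag c)) y w ((0, 0), B) := by
  rw [mom2, LinearMap.compl₂_apply, hess2_apply]
  rfl

theorem fderiv_lag_differentiableAt (hy : y ∈ c.target) :
    DifferentiableAt ℝ (fderiv ℝ (S.lag c)) y :=
  ((S.lag_contDiffAt hy).fderiv_right (m := ∞) (by simp)).differentiableAt (by simp)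

theorem mom2_eq (hy : y ∈ c.target) (w : JetModel p n) (B : Vec p →L[ℝ] Vec n) :
    S.mom2 c y w B = fderiv ℝ (fun y => fderiv ℝ (S.lag c) y ((0, 0), B)) y w := by
  rw [fderiv_clm_apply (S.fderiv_lag_differentiableAt hy) (differentiableAt_const _)]
  simp [mom2_apply]

/-- Kronecker regularity in index-free form: `h^{αβ}` turns the covector into a vector, on which `B`
is evaluated, and `g` pairs the result with `u`. The factor 2 offsets the one half in the
hypothesis. -/
theorem mom2_vert (hy : y ∈ c.target) (B : Vec p →L[ℝ] Vec n) (u : Vec n) (θ : Vec p →L[ℝ] ℝ) :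
    S.mom2 c y ((0, 0), B) (rk u θ)
      = 2 * bil (fun i j => S.lo c i j y) (B (h.sharp c.time y.1.1 θ)) u := by
  have key : ∀ i α j β, S.mom2 c y ((0, 0), vertUnit i α) (vertUnit j β)
      = 2 * (h.up c.time α β y.1.1 * S.lo c i j y) := by
    intro i α j β
    have e := S.kronecker c y hy i j α β
    rw [mom2_eq S hy]
    change (1 / 2 : ℝ) * fderiv ℝ (fun y => fderiv ℝ (S.lag c) y ((0, 0), vertUnit j β)) y
      ((0, 0), vertUnit i α) = h.up c.time α β y.1.1 * S.lo c i j y at e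
    linarith
  have e1 : S.mom2 c y ((0, 0), B) (rk u θ)
      = ∑ i, ∑ α, B (bv α) i * ∑ j, u j * ∑ β, θ (bv β) *
        S.mom2 c y ((0, 0), vertUnit i α) (vertUnit j β) := by
    have a1 : ∀ w, S.mom2 c y w (rk u θ)
        = ∑ j, u j * ∑ β, θ (bv β) * S.mom2 c y w (vertUnit j β) := by
      intro w
      conv_lhs => rw [← rkL_apply, vec_eq_sum u, map_sum, LinearMap.sum_apply, map_sum]
      refine Finset.sum_congr rfl fun j _ => ?_
      rw [map_smul, LinearMap.smul_apply, map_smul, smul_eq_mul]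
      conv_lhs => rw [covec_eq_sum θ, map_sum, map_sum]
      congr 1
      exact Finset.sum_congr rfl fun β _ => by
        rw [map_smul, map_smul, smul_eq_mul, rkL_apply, vertUnit_eq]
    have a2 : (((0, 0), B) : JetModel p n) = ∑ i, ∑ α, B (bv α) i • ((0, 0), vertUnit i α) := by
      conv_lhs => rw [hom_eq_sum B, ← vertL_apply, map_sum]
      refine Finset.sum_congr rfl fun i _ => ?_
      rw [map_sum]
      exact Finset.sum_congr rfl fun α _ => by rw [map_smul]; rfl
    rw [a2, map_sum, LinearMap.sum_apply]
    refine Finset.sum_congr rfl fun i _ => ?_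
    rw [map_sum, LinearMap.sum_apply]
    refine Finset.sum_congr rfl fun α _ => ?_
    rw [map_smul, LinearMap.smul_apply, smul_eq_mul, a1]
  rw [e1]
  simp_rw [key]
  rw [map_eq_sum B (h.sharp c.time y.1.1 θ), bil_apply, Finset.mul_sum]
  refine Finset.sum_congr rfl fun i _ => ?_
  simp only [WithLp.ofLp_sum, Finset.sum_apply, PiLp.smul_apply, smul_eq_mul, Finset.sum_mul,
    Finset.mul_sum]
  rw [Finset.sum_comm]
  refine Finset.sum_congr rfl fun j _ => Finset.sum_congr rfl fun α _ => ?_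
  rw [show (h.sharp c.time y.1.1 θ) α = ∑ μ, h.up c.time α μ y.1.1 * θ (bv μ) from rfl]
  simp only [Finset.sum_mul, Finset.mul_sum]
  exact Finset.sum_congr rfl fun β _ => by ring

theorem fderiv_lag_change (hy : y ∈ c.overlap c') (w : JetModel p n) :
    fderiv ℝ (S.lag c) y w = fderiv ℝ (S.lag c') (c.change c' y) (c.changeD c' y w) := by
  have k : S.lag c =ᶠ[𝓝 y] fun y => S.lag c' (c.change c' y) := by
    filter_upwards [(c.isOpen_overlap c').mem_nhds hy] with z hz using S.lag_change hz
  rw [k.fderiv_eq, fderiv_fun_comp y ((S.lag_contDiffAt (change_mem hy)).differentiableAt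
    (by simp)) (change_differentiableAt hy)]
  rfl

/-- A vertical vector has no temporal or spatial component, so both Hessian terms of `changeD_vert`
drop out and it transforms as a tensor. -/
theorem changeD_rk (hy : y ∈ c.overlap c') (u : Vec n) (θ : Vec p →L[ℝ] ℝ) :
    c.changeD c' y ((0, 0), rk u θ) = ((0, 0), rk (c.jacX c' y u) (θ ∘L (c.jacT c' y).inverse)) := by
  have z1 : ∀ a, c.hessT c' y 0 a = 0 := fun a => by rw [hessT_eq hy]; simp
  have z2 : ∀ a, c.hessX c' y 0 a = 0 := fun a => by rw [hessX_eq hy]; simp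
  refine jet_ext ?_ ?_ (ext_jacT hy fun z => ?_)
  · rw [changeD_time hy]; simp
  · rw [changeD_space hy]; simp
  · rw [changeD_vert hy]
    simp [rk_apply, z1, z2, (jacT_isInvertible hy).inverse_apply_self]

theorem mom_change (hy : y ∈ c.overlap c') (u : Vec n) (θ : Vec p →L[ℝ] ℝ) :
    S.mom c y (rk u θ)
      = S.mom c' (c.change c' y) (rk (c.jacX c' y u) (θ ∘L (c.jacT c' y).inverse)) := by
  rw [mom_apply, S.fderiv_lag_change hy, changeD_rk hy, mom_apply]

/-- The second derivative of the coordinate change of `T`, as a linear map. -/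
def hessTL (c c' : JetChart p n T M) (y : JetModel p n) (a : Vec p) : Vec p →L[ℝ] Vec p :=
  fderiv ℝ (fderiv ℝ (trans c.time c'.time)) y.1.1 a

theorem rk_change_differentiableAt (hy : y ∈ c.overlap c') (u : Vec n) (θ : Vec p →L[ℝ] ℝ) :
    DifferentiableAt ℝ (fun s => rk (c.jacX c' s u) (θ ∘L (c.jacT c' s).inverse)) y := by
  have h1 := ((change_contDiffAt hy).fderiv_right (m := ∞) (by simp)).differentiableAt (by simp)
  -- The transformed rank one map is the vertical part of the derivative of the smooth map `change`,
  -- hence differentiable.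
  have h2 : DifferentiableAt ℝ (fun s => (c.changeD c' s ((0, 0), rk u θ)).2) y :=
    (ContinuousLinearMap.snd ℝ (Vec p × Vec n) (Vec p →L[ℝ] Vec n)).differentiableAt.comp y
      (h1.clm_apply (differentiableAt_const _))
  refine h2.congr_of_eventuallyEq ?_
  filter_upwards [(c.isOpen_overlap c').mem_nhds hy] with s hs
  rw [changeD_rk hs]

/-- On the image of the temporal Jacobian the moving covector takes the constant value `θ z`.
Differentiating this identity produces the derivative of the inverse Jacobian implicitly. -/
theorem fderiv_rk_change (hy : y ∈ c.overlap c') (w : JetModel p n) (u : Vec n)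
    (θ : Vec p →L[ℝ] ℝ) :
    fderiv ℝ (fun s => rk (c.jacX c' s u) (θ ∘L (c.jacT c' s).inverse)) y w
      = rk (c.hessX c' y w.1.2 u) (θ ∘L (c.jacT c' y).inverse)
      - rk (c.jacX c' y u) (θ ∘L (c.jacT c' y).inverse ∘L
            hessTL c c' y w.1.1 ∘L (c.jacT c' y).inverse) := by
  have hBd := rk_change_differentiableAt hy u θ
  refine ext_jacT hy fun z => ?_
  have h3 := hBd.hasFDerivAt.clm_apply
    ((jacT_differentiableAt hy).hasFDerivAt.clm_apply (hasFDerivAt_const z y))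
  have h4 := ((jacX_differentiableAt hy).hasFDerivAt.clm_apply (hasFDerivAt_const u y)).const_smul
    (θ z)
  have k2 : (fun s => rk (c.jacX c' s u) (θ ∘L (c.jacT c' s).inverse) (c.jacT c' s z)) =ᶠ[𝓝 y]
      fun s => θ z • c.jacX c' s u := by
    filter_upwards [(c.isOpen_overlap c').mem_nhds hy] with s hs
    rw [rk_apply, ContinuousLinearMap.comp_apply, (jacT_isInvertible hs).inverse_apply_self]
  have h5 := congrArg (fun f => f w) (h3.unique (h4.congr_of_eventuallyEq k2))
  simp only [ContinuousLinearMap.comp_zero, zero_add, add_apply, smul_apply,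
    ContinuousLinearMap.comp_apply, ContinuousLinearMap.flip_apply,
    fderiv_jacT hy, fderiv_jacX hy] at h5
  rw [eq_sub_of_add_eq' h5]
  simp [rk_apply, (jacT_isInvertible hy).inverse_apply_self, hessTL, hessT,
    D2_eq (transT_contDiffAt hy)]

/-- The derivative of a vertical derivative along a curve of vertical vectors. -/
theorem fderiv_mom_comp {F : JetModel p n → JetModel p n} {B : JetModel p n → Vec p →L[ℝ] Vec n}
    (hFy : F y ∈ c.target) (hF : DifferentiableAt ℝ F y) (hB : DifferentiableAt ℝ B y)
    (w : JetModel p n) :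
    fderiv ℝ (fun s => S.mom c (F s) (B s)) y w
      = S.mom2 c (F y) (fderiv ℝ F y w) (B y) + S.mom c (F y) (fderiv ℝ B y w) := by
  rw [mom2_apply, mom_apply]
  exact fderiv_fderiv_comp_inr (E₁ := Vec p × Vec n) (S.fderiv_lag_differentiableAt hFy) hF hB w

/-- The mixed second derivative is not tensorial: the last two terms arise because the transformed
vertical vector varies with the base point. In the spray they are cancelled by the remaining
first-order terms. -/
theorem mom2_change (hy : y ∈ c.overlap c') (w : JetModel p n) (u : Vec n) (θ : Vec p →L[ℝ] ℝ) :
    S.mom2 c y w (rk u θ)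
      = S.mom2 c' (c.change c' y) (c.changeD c' y w)
          (rk (c.jacX c' y u) (θ ∘L (c.jacT c' y).inverse))
        + S.mom c' (c.change c' y) (rk (c.hessX c' y w.1.2 u) (θ ∘L (c.jacT c' y).inverse))
        - S.mom c' (c.change c' y) (rk (c.jacX c' y u) (θ ∘L (c.jacT c' y).inverse ∘L
            hessTL c c' y w.1.1 ∘L (c.jacT c' y).inverse)) := by
  have k : (fun s => fderiv ℝ (S.lag c) s ((0, 0), rk u θ)) =ᶠ[𝓝 y]
      fun s => S.mom c' (c.change c' s) (rk (c.jacX c' s u) (θ ∘L (c.jacT c' s).inverse)) := by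
    filter_upwards [(c.isOpen_overlap c').mem_nhds hy] with s hs
    exact S.mom_change hs u θ
  rw [S.mom2_eq hy.1, k.fderiv_eq, S.fderiv_mom_comp (change_mem hy)
    (change_differentiableAt hy) (rk_change_differentiableAt hy u θ),
    fderiv_rk_change hy, map_sub, add_sub_assoc]
  rfl

end LagrangeSpace
end Momentum

/-! ### The transformation law of the spray. -/

section SprayLaw

variable {p n : ℕ}
  {T : Type*} [TopologicalSpace T] [ChartedSpace (Vec p) T] [IsManifold (𝓡 p) ∞ T]
  {M : Type*} [TopologicalSpace M] [ChartedSpace (Vec n) M] [IsManifold (𝓡 n) ∞ M]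

namespace SemiRiemannianMetric

variable (h : SemiRiemannianMetric p T)

/-- The linear map `b ↦ H(a, b)`. -/
def chrL (φ : OpenPartialHomeomorph T (Vec p)) (u a : Vec p) : Vec p →L[ℝ] Vec p :=
  LinearMap.toContinuousLinearMap (h.chr φ u a)

theorem chrL_apply (φ : OpenPartialHomeomorph T (Vec p)) (u a b : Vec p) :
    h.chrL φ u a b = h.chr φ u a b := rfl

theorem up_symm (φ : OpenPartialHomeomorph T (Vec p)) (α β : Fin p) (u : Vec p) :
    h.up φ α β u = h.up φ β α u := by
  have e : (Matrix.of fun α β => h.lo φ α β u).transpose = Matrix.of fun α β => h.lo φ α β u := by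
    ext i j
    exact h.lo_symm φ j i u
  change _ = ((Matrix.of fun α β => h.lo φ α β u)⁻¹).transpose α β
  rw [Matrix.transpose_nonsing_inv, e]
  rfl

/-- The lift of a temporal direction along which the velocities are parallel. -/
def timeLift (c : JetChart p n T M) (y : JetModel p n) : Vec p →ₗ[ℝ] JetModel p n where
  toFun a := ((a, y.2 a), y.2 ∘L h.chrL c.time y.1.1 a)
  map_add' a b := jet_ext rfl (map_add _ _ _) (by ext1 z; simp [chrL_apply])
  map_smul' r a := jet_ext rfl (map_smul _ _ _) (by ext1 z; simp [chrL_apply])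

theorem timeLift_apply (c : JetChart p n T M) (y : JetModel p n) (a : Vec p) :
    h.timeLift c y a = ((a, y.2 a), y.2 ∘L h.chrL c.time y.1.1 a) := rfl

end SemiRiemannianMetric

namespace LagrangeSpace

variable {h : SemiRiemannianMetric p T} (S : LagrangeSpace n M h) {c c' : JetChart p n T M}
  {y : JetModel p n}

open JetChart

/-- The spray as a vector. -/
def sprayVec (c : JetChart p n T M) (y : JetModel p n) : Vec n :=
  WithLp.toLp 2 fun k => S.spray c k y

/-- The linear form dual to the spray. -/
def sprayForm (c : JetChart p n T M) (y : JetModel p n) (u : Vec n) : ℝ :=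
  (∑ α, S.mom2 c y (h.timeLift c y (bv α)) (rk u (cv α)))
    - fderiv ℝ (S.lag c) y ((0, u), 0)
    + ∑ α, S.mom c y (rk u (cv α)) * h.trChr c.time y.1.1 (bv α)

/-- The term `2 g h H x` in the definition of `𝒢` is, by `mom2_vert`, the contribution of the
vertical part of `timeLift` to the second derivative. All second-order terms thus merge into a
single trace, which is what makes the law of the spray accessible. -/
theorem sprayForm_bv (hy : y ∈ c.target) (i : Fin n) :
    S.sprayForm c y (bv i) = (∑ j, ∑ α, dX j (dV i α (S.lag c)) y * vel j α y)
      - dX i (S.lag c) y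
      + (∑ α, dT α (dV i α (S.lag c)) y)
      + (∑ α, ∑ γ, dV i α (S.lag c) y * h.christoffel c.time γ α γ y.1.1)
      + 2 * ∑ j, ∑ α, ∑ β, ∑ γ, S.lo c i j y * h.up c.time α β y.1.1 *
          h.christoffel c.time γ α β y.1.1 * vel j γ y := by
  have e1 : ∀ α, S.mom2 c y (h.timeLift c y (bv α)) (rk (bv i) (cv α))
      = dT α (dV i α (S.lag c)) y + (∑ j, dX j (dV i α (S.lag c)) y * vel j α y)
        + 2 * ∑ j, ∑ β, ∑ γ, S.lo c i j y * h.up c.time α β y.1.1 *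
          h.christoffel c.time γ α β y.1.1 * vel j γ y := by
    intro α
    have d : (h.timeLift c y (bv α) : JetModel p n) = ((bv α, 0), 0)
        + (∑ j, (y.2 (bv α) j) • ((0, bv j), 0))
        + ((0, 0), y.2 ∘L h.chrL c.time y.1.1 (bv α)) := by
      have d' : (∑ j, (y.2 (bv α) j) • ((0, bv j), 0) : JetModel p n) = ((0, y.2 (bv α)), 0) := by
        refine Eq.trans ?_ (map_eq_sum (LinearMap.inl ℝ (Vec p × Vec n) (Vec p →L[ℝ] Vec n) ∘ₗ
          LinearMap.inr ℝ (Vec p) (Vec n)) (y.2 (bv α))).symm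
        rfl
      rw [d']
      refine jet_ext ?_ ?_ ?_ <;> simp [SemiRiemannianMetric.timeLift_apply]
    rw [d, map_add, map_add, LinearMap.add_apply, LinearMap.add_apply, map_sum,
      LinearMap.sum_apply, S.mom2_vert hy]
    congr 1
    · congr 1
      · rw [S.mom2_eq hy]; rfl
      · refine Finset.sum_congr rfl fun j _ => ?_
        rw [map_smul, LinearMap.smul_apply, S.mom2_eq hy, smul_eq_mul, mul_comm]; rfl
    · congr 1
      rw [bil_symm (fun i j => S.lo_symm c i j y), bil_bv_left]
      refine Finset.sum_congr rfl fun j _ => ?_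
      have e2 : ∀ β, (h.sharp c.time y.1.1 (cv α)) β = h.up c.time α β y.1.1 := by
        intro β
        rw [h.up_symm]
        change ∑ μ, h.up c.time β μ y.1.1 * (cv α) (bv μ) = _
        simp
      have e3 : ∀ β, (y.2 (h.chr c.time y.1.1 (bv α) (bv β))) j
          = ∑ γ, h.christoffel c.time γ α β y.1.1 * vel j γ y := by
        intro β
        rw [map_eq_sum y.2, SemiRiemannianMetric.chr]
        simp [bilV_bv, vel]
      rw [ContinuousLinearMap.comp_apply, SemiRiemannianMetric.chrL_apply,
        map_eq_sum (h.chr c.time y.1.1 (bv α)), map_sum]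
      simp only [map_smul, WithLp.ofLp_sum, Finset.sum_apply, PiLp.smul_apply, smul_eq_mul, e2, e3,
        Finset.mul_sum]
      exact Finset.sum_congr rfl fun β _ => Finset.sum_congr rfl fun γ _ => by ring
  have e4 : ∀ α, S.mom c y (rk (bv i) (cv α)) * h.trChr c.time y.1.1 (bv α)
      = ∑ γ, dV i α (S.lag c) y * h.christoffel c.time γ α γ y.1.1 := by
    intro α
    rw [h.trChr_apply, Finset.mul_sum]
    refine Finset.sum_congr rfl fun γ _ => ?_
    exact congrArg (S.mom c y (rk (bv i) (cv α)) * ·)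
      (bilV_bv (fun γ α β => h.christoffel c.time γ α β y.1.1) α γ γ)
  rw [sprayForm]
  simp only [e1, e4, Finset.sum_add_distrib]
  rw [Finset.sum_comm (f := fun j α => dX j (dV i α (S.lag c)) y * vel j α y), ← Finset.mul_sum,
    Finset.sum_comm (s := Finset.univ (α := Fin n))
      (f := fun j α => ∑ β, ∑ γ, S.lo c i j y * h.up c.time α β y.1.1 *
          h.christoffel c.time γ α β y.1.1 * vel j γ y)]
  change _ - dX i (S.lag c) y + _ = _
  ring

/-- The factor 4 collects the two halves in `2𝒢^k = (g^{ki}/2){…}`. -/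
theorem bil_sprayVec (hy : y ∈ c.target) (u : Vec n) :
    4 * bil (fun i j => S.lo c i j y) (S.sprayVec c y) u = S.sprayForm c y u := by
  have hl : ∀ (u : Vec n), S.sprayForm c y u = ∑ i, u i * S.sprayForm c y (bv i) := by
    have l : ∀ w : Vec n, S.sprayForm c y w = ((∑ α, (S.mom2 c y (h.timeLift c y (bv α))) ∘ₗ
        rkL.flip (cv α)) - (fderiv ℝ (S.lag c) y).toLinearMap ∘ₗ
          LinearMap.inl ℝ (Vec p × Vec n) (Vec p →L[ℝ] Vec n) ∘ₗ LinearMap.inr ℝ (Vec p) (Vec n)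
        + ∑ α, h.trChr c.time y.1.1 (bv α) • (S.mom c y ∘ₗ rkL.flip (cv α))) w := by
      intro w
      simp only [LinearMap.add_apply, LinearMap.sub_apply, LinearMap.sum_apply,
        LinearMap.smul_apply, LinearMap.comp_apply, LinearMap.flip_apply, rkL_apply, smul_eq_mul,
        mul_comm (h.trChr c.time y.1.1 _)]
      rfl
    simp only [l]
    exact fun u => map_eq_sum _ u
  rw [hl, bil_symm (fun i j => S.lo_symm c i j y), bil_apply, Finset.mul_sum]
  refine Finset.sum_congr rfl fun i _ => ?_
  have e := sum_lo_mul_sum_up (S.lo_mul_up hy) (fun i => S.sprayForm c y (bv i)) i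
  rw [← e, Finset.mul_sum, Finset.mul_sum]
  refine Finset.sum_congr rfl fun k _ => ?_
  have e2 : (S.sprayVec c y) k = (1 / 4) * ∑ l, S.up c k l y * S.sprayForm c y (bv l) := by
    change S.spray c k y = _
    rw [spray, Finset.mul_sum, Finset.mul_sum]
    refine Finset.sum_congr rfl fun l _ => ?_
    rw [S.sprayForm_bv hy]
    ring
  rw [e2]
  ring

/-- The vertical part of the lift carries the Christoffel symbols, whose inhomogeneous term absorbs
the temporal Hessian; only a vertical vector with the spatial Hessian is left over. -/
theorem changeD_timeLift (hy : y ∈ c.overlap c') (a : Vec p) :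
    c.changeD c' y (h.timeLift c y a) = h.timeLift c' (c.change c' y) (c.jacT c' y a)
      + ((0, 0), LinearMap.toContinuousLinearMap (D2L (trans c.space c'.space) y.1.2 (y.2 a) ∘ₗ
          (y.2 ∘L (c.jacT c' y).inverse).toLinearMap)) := by
  refine jet_ext ?_ ?_ (ext_jacT hy fun z => ?_)
  · rw [changeD_time hy]; simp [SemiRiemannianMetric.timeLift_apply]
  · rw [changeD_space hy]
    simp [SemiRiemannianMetric.timeLift_apply, change_snd_apply hy]
  · rw [changeD_vert hy]
    simp only [SemiRiemannianMetric.timeLift_apply, Prod.snd_add, add_apply,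
      ContinuousLinearMap.comp_apply, SemiRiemannianMetric.chrL_apply,
      LinearMap.coe_toContinuousLinearMap', LinearMap.comp_apply,
      ContinuousLinearMap.coe_coe, (jacT_isInvertible hy).inverse_apply_self]
    rw [← change_snd_apply hy, ← hessX_eq hy]
    have e := h.chr_trans c.time_mem c'.time_mem hy.1.1 hy.2.1 a z
    change c.jacT c' y _ = h.chr c'.time (c.change c' y).1.1 (c.jacT c' y a) (c.jacT c' y z)
      + c.hessT c' y a z at e
    rw [e, map_add]
    abel

/-- The quadratic term of the transformation law of the spray. -/
def sprayDefect (h : SemiRiemannianMetric p T) (c c' : JetChart p n T M) (y : JetModel p n) : Vec n :=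
  ∑ α, c.hessX c' y (y.2 (bv α)) (y.2 (h.sharp c.time y.1.1 (cv α)))

/-- Moving `x` with fixed velocities also moves the new velocities, through the spatial Hessian. The
resulting vertical derivative is minus a term that `mom2_change` contributes once `fderiv_lag_space`
is subtracted in the spray. -/
theorem fderiv_lag_space (hy : y ∈ c.overlap c') (u : Vec n) :
    fderiv ℝ (S.lag c) y ((0, u), 0)
      = fderiv ℝ (S.lag c') (c.change c' y) ((0, c.jacX c' y u), 0)
        + ∑ α, S.mom c' (c.change c' y)
          (rk (c.hessX c' y (y.2 (bv α)) u) (cv α ∘L (c.jacT c' y).inverse)) := by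
  have z1 : ∀ a, c.hessT c' y 0 a = 0 := fun a => by rw [hessT_eq hy]; simp
  have e : c.changeD c' y ((0, u), 0) = ((0, c.jacX c' y u), 0)
      + vertL (∑ α, rk (c.hessX c' y (y.2 (bv α)) u) (cv α ∘L (c.jacT c' y).inverse)) := by
    refine jet_ext ?_ ?_ (ext_jacT hy fun z => ?_)
    · rw [changeD_time hy]
      change c.jacT c' y 0 = (0 : Vec p) + 0
      simp
    · rw [changeD_space hy]
      exact (add_zero _).symm
    · rw [changeD_vert hy]
      simp only [z1, map_zero, zero_apply, add_zero, sub_zero, Prod.snd_add, vertL_apply, zero_add,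
        sum_apply, rk_apply, ContinuousLinearMap.comp_apply,
        (jacT_isInvertible hy).inverse_apply_self]
      rw [hessX_symm hy, hessX_eq hy, map_eq_sum y.2 z, map_sum, LinearMap.sum_apply]
      refine Finset.sum_congr rfl fun α _ => ?_
      rw [map_smul, LinearMap.smul_apply, ← hessX_eq hy]
      simp
  rw [S.fderiv_lag_change hy, e, map_add, ← map_sum]
  rfl

/-- The trace of the Christoffel law. Its Hessian term cancels the temporal Hessian term of
`mom2_change`; the comparison uses the symmetry of second derivatives to exchange the two summation
indices. -/
theorem sum_mom_trChr (hy : y ∈ c.overlap c') (F : (Vec p →L[ℝ] ℝ) →ₗ[ℝ] ℝ) :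
    ∑ α, F (cv α ∘L (c.jacT c' y).inverse) * h.trChr c.time y.1.1 (bv α)
      = ∑ α, F (cv α) * h.trChr c'.time (c.change c' y).1.1 (bv α)
        + ∑ α, F (cv α ∘L (c.jacT c' y).inverse ∘L hessTL c c' y (bv α) ∘L
            (c.jacT c' y).inverse) := by
  have hi := jacT_isInvertible hy
  have e1 := sum_pairing_invariant (LinearMap.mk₂ ℝ
    (fun (a : Vec p) (θ : Vec p →L[ℝ] ℝ) => F θ * h.trChr c'.time (c.change c' y).1.1 a)
    (by intros; simp [mul_add]) (by intros; simp [mul_left_comm]) (by intros; simp [add_mul])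
    (by intros; simp [mul_assoc])) hi
  simp only [LinearMap.mk₂_apply] at e1
  rw [← e1, ← map_sum, ← sub_eq_iff_eq_add', ← Finset.sum_sub_distrib]
  have e2 : ∀ α, F (cv α ∘L (c.jacT c' y).inverse) * h.trChr c.time y.1.1 (bv α)
      - F (cv α ∘L (c.jacT c' y).inverse)
        * h.trChr c'.time (c.change c' y).1.1 (c.jacT c' y (bv α))
      = F ((∑ γ, cv γ ((c.jacT c' y).inverse (c.hessT c' y (bv α) (bv γ)))) •
          (cv α ∘L (c.jacT c' y).inverse)) := by
    intro α
    have e3 := h.trChr_trans c.time_mem c'.time_mem hy.1.1 hy.2.1 (bv α)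
    change h.trChr c'.time (c.change c' y).1.1 (c.jacT c' y (bv α)) = h.trChr c.time y.1.1 (bv α)
      - ∑ γ, cv γ ((c.jacT c' y).inverse (c.hessT c' y (bv α) (bv γ))) at e3
    rw [e3, map_smul, smul_eq_mul]
    ring
  rw [Finset.sum_congr rfl fun α _ => e2 α, ← map_sum]
  congr 1
  refine ext_jacT hy fun z => ?_
  simp only [sum_apply, smul_apply, ContinuousLinearMap.comp_apply, hi.inverse_apply_self]
  have e4 : ∀ α, hessTL c c' y (bv α) z = ∑ μ, z μ • c.hessT c' y (bv μ) (bv α) := by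
    intro α
    rw [map_eq_sum (hessTL c c' y (bv α)) z]
    exact Finset.sum_congr rfl fun μ _ => by
      rw [hessT_symm hy, hessT_eq hy]; rfl
  simp only [e4, map_sum, map_smul, smul_eq_mul, Finset.sum_mul]
  rw [Finset.sum_comm]
  refine Finset.sum_congr rfl fun α _ => Finset.sum_congr rfl fun γ _ => ?_
  rw [mul_comm]
  rfl

theorem sprayForm_change (hy : y ∈ c.overlap c') (u : Vec n) :
    S.sprayForm c y u = S.sprayForm c' (c.change c' y) (c.jacX c' y u)
      + 2 * bil (fun i j => S.lo c' i j (c.change c' y)) (sprayDefect h c c' y)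
          (c.jacX c' y u) := by
  have hi := jacT_isInvertible hy
  have hm := change_mem hy
  have e1 := sum_pairing_invariant ((S.mom2 c' (c.change c' y)).compl₁₂
    (h.timeLift c' (c.change c' y)) (rkL (c.jacX c' y u))) hi
  simp only [LinearMap.compl₁₂_apply, rkL_apply] at e1
  have e2 := sum_mom_trChr (h := h) hy (S.mom c' (c.change c' y) ∘ₗ rkL (c.jacX c' y u))
  simp only [LinearMap.comp_apply, rkL_apply] at e2
  -- Four contributions: a tensorial one, the quadratic term that `mom2_vert` extracts from the
  -- leftover of `changeD_timeLift`, and two first-order terms. The last two are removed by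
  -- `fderiv_lag_space` and `sum_mom_trChr`, while `sum_pairing_invariant` takes care of the
  -- tensorial trace.
  have e3 : ∀ α, S.mom2 c y (h.timeLift c y (bv α)) (rk u (cv α))
      = S.mom2 c' (c.change c' y) (h.timeLift c' (c.change c' y) (c.jacT c' y (bv α)))
          (rk (c.jacX c' y u) (cv α ∘L (c.jacT c' y).inverse))
        + 2 * bil (fun i j => S.lo c' i j (c.change c' y))
            (c.hessX c' y (y.2 (bv α)) (y.2 (h.sharp c.time y.1.1 (cv α)))) (c.jacX c' y u)
        + S.mom c' (c.change c' y) (rk (c.hessX c' y (y.2 (bv α)) u)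
            (cv α ∘L (c.jacT c' y).inverse))
        - S.mom c' (c.change c' y) (rk (c.jacX c' y u) (cv α ∘L (c.jacT c' y).inverse ∘L
            hessTL c c' y (bv α) ∘L (c.jacT c' y).inverse)) := by
    intro α
    have e4 : h.sharp c'.time (c.change c' y).1.1 (cv α ∘L (c.jacT c' y).inverse)
        = c.jacT c' y (h.sharp c.time y.1.1 (cv α)) :=
      h.sharp_trans c.time_mem c'.time_mem hy.1.1 hy.2.1 (cv α)
    rw [S.mom2_change hy, changeD_timeLift hy, map_add, LinearMap.add_apply,
      S.mom2_vert hm, e4]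
    simp only [LinearMap.coe_toContinuousLinearMap', LinearMap.comp_apply,
      ContinuousLinearMap.coe_coe, ContinuousLinearMap.comp_apply, hi.inverse_apply_self]
    rw [← hessX_eq hy]
    rfl
  have e5 : ∀ α, S.mom c y (rk u (cv α)) = S.mom c' (c.change c' y)
      (rk (c.jacX c' y u) (cv α ∘L (c.jacT c' y).inverse)) := fun α => S.mom_change hy u _
  simp only [sprayForm, e3, e5]
  rw [Finset.sum_sub_distrib, Finset.sum_add_distrib, Finset.sum_add_distrib, e1, e2,
    S.fderiv_lag_space hy, ← Finset.mul_sum, sprayDefect, map_sum, LinearMap.sum_apply]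
  ring

/-- The transformation law of the spray. -/
theorem sprayVec_change (hy : y ∈ c.overlap c') :
    c.jacX c' y (S.sprayVec c y) = S.sprayVec c' (c.change c' y)
      + (1 / 2 : ℝ) • sprayDefect h c c' y := by
  have hm := change_mem hy
  refine bil_injective (lo := fun i j => S.lo c' i j (c.change c' y))
    (fun i j => S.lo_symm c' i j _) (S.up_mul_lo hm) fun v => ?_
  obtain ⟨u, rfl⟩ := (jacX_isInvertible hy).surjective v
  rw [← S.bil_lo_change hy, map_add, LinearMap.add_apply, map_smul, LinearMap.smul_apply]
  have e1 := S.bil_sprayVec hy.1 u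
  have e2 := S.bil_sprayVec hm (c.jacX c' y u)
  have e3 := S.sprayForm_change hy u
  rw [smul_eq_mul]
  linarith

end LagrangeSpace
end SprayLaw

/-! ### The canonical nonlinear connection and its transformation law. -/

section Splitting

variable {p n : ℕ}

theorem dX_contDiffAt {f : JetModel p n → ℝ} {y : JetModel p n} (hf : ContDiffAt ℝ ∞ f y)
    (i : Fin n) : ContDiffAt ℝ ∞ (dX i f) y :=
  SemiRiemannianMetric.fderiv_contDiffAt hf _

theorem dT_contDiffAt {f : JetModel p n → ℝ} {y : JetModel p n} (hf : ContDiffAt ℝ ∞ f y)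
    (α : Fin p) : ContDiffAt ℝ ∞ (dT α f) y :=
  SemiRiemannianMetric.fderiv_contDiffAt hf _

theorem dV_contDiffAt {f : JetModel p n → ℝ} {y : JetModel p n} (hf : ContDiffAt ℝ ∞ f y)
    (i : Fin n) (α : Fin p) : ContDiffAt ℝ ∞ (dV i α f) y :=
  SemiRiemannianMetric.fderiv_contDiffAt hf _

theorem vel_contDiffAt (i : Fin n) (α : Fin p) (y : JetModel p n) :
    ContDiffAt ℝ ∞ (vel i α) y :=
  ((EuclideanSpace.proj i : Vec n →L[ℝ] ℝ).contDiff.comp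
    (contDiff_snd.clm_apply contDiff_const)).contDiffAt

/-- The vertical vector with given components. -/
def vertSum (a : Fin n → Fin p → ℝ) : Vec p →L[ℝ] Vec n := ∑ i, ∑ α, a i α • vertUnit i α

theorem vertSum_apply (a : Fin n → Fin p → ℝ) (z : Vec p) (i : Fin n) :
    vertSum a z i = ∑ α, a i α * z α := by
  rw [vertSum, Finset.sum_comm]
  simp only [sum_apply, smul_apply, WithLp.ofLp_sum, Finset.sum_apply, PiLp.smul_apply,
    vertUnit_eq, rk_apply, smul_eq_mul]
  refine Finset.sum_congr rfl fun α _ => ?_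
  rw [Finset.sum_eq_single i (fun j _ hj => by simp [hj.symm]) (by simp)]
  simp

theorem vertSum_bv (a : Fin n → Fin p → ℝ) (i : Fin n) (α : Fin p) :
    vertSum a (bv α) i = a i α := by
  rw [vertSum_apply]
  simp

theorem vertSum_contDiffAt {E : Type*} [NormedAddCommGroup E] [NormedSpace ℝ E] {r : ℕ∞ω}
    {a : E → Fin n → Fin p → ℝ} {y : E} (ha : ∀ i α, ContDiffAt ℝ r (fun y => a y i α) y) :
    ContDiffAt ℝ r (fun y => vertSum (a y)) y :=
  ContDiffAt.sum fun i _ => ContDiffAt.sum fun α _ => (ha i α).smul contDiffAt_const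

theorem vert_ext {A B : Vec p →L[ℝ] Vec n} (h : ∀ i α, A (bv α) i = B (bv α) i) : A = B :=
  clm_ext_bv fun α => by ext i; exact h i α

variable
  {T : Type*} [TopologicalSpace T] [ChartedSpace (Vec p) T] [IsManifold (𝓡 p) ∞ T]
  {M : Type*} [TopologicalSpace M] [ChartedSpace (Vec n) M] [IsManifold (𝓡 n) ∞ M]

namespace SemiRiemannianMetric

variable (h : SemiRiemannianMetric p T)

/-- The covector dual to a vector. -/
def flat (φ : OpenPartialHomeomorph T (Vec p)) (u a : Vec p) : Vec p →L[ℝ] ℝ :=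
  LinearMap.toContinuousLinearMap (bil (fun α β => h.lo φ α β u) a)

theorem flat_apply (φ : OpenPartialHomeomorph T (Vec p)) (u a b : Vec p) :
    h.flat φ u a b = bil (fun α β => h.lo φ α β u) a b := rfl

theorem flat_trans {φ χ : OpenPartialHomeomorph T (Vec p)}
    (hφ : φ ∈ IsManifold.maximalAtlas (𝓡 p) ∞ T)
    (hχ : χ ∈ IsManifold.maximalAtlas (𝓡 p) ∞ T) {u : Vec p} (hu : u ∈ φ.target)
    (hu' : φ.symm u ∈ χ.source) (a : Vec p) :
    h.flat φ u a ∘L (fderiv ℝ (trans φ χ) u).inverse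
      = h.flat χ (trans φ χ u) (fderiv ℝ (trans φ χ) u a) := by
  have hi := trans_isInvertible hφ hχ hu hu'
  ext1 z
  obtain ⟨b, rfl⟩ := hi.surjective z
  rw [ContinuousLinearMap.comp_apply, hi.inverse_apply_self, flat_apply, flat_apply,
    h.bil_lo_trans hφ hχ hu hu']

/-- Paired with an arbitrary vector, the left-hand side becomes the expansion of `a♭` in
coordinates. -/
theorem sum_flat_smul_sharp {φ : OpenPartialHomeomorph T (Vec p)}
    (hφ : φ ∈ IsManifold.maximalAtlas (𝓡 p) ∞ T) {u : Vec p} (hu : u ∈ φ.target) (a : Vec p) :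
    ∑ α, h.flat φ u a (bv α) • h.sharp φ u (cv α) = a := by
  refine bil_injective (lo := fun α β => h.lo φ α β u) (fun i j => h.lo_symm φ i j u)
    (h.up_mul_lo hφ hu) fun v => ?_
  rw [map_sum, LinearMap.sum_apply]
  simp only [map_smul, LinearMap.smul_apply, h.bil_sharp hφ hu]
  rw [← h.flat_apply, map_eq_sum (h.flat φ u a) v]
  exact Finset.sum_congr rfl fun α _ => by simp [mul_comm]

end SemiRiemannianMetric

namespace LagrangeSpace

variable {h : SemiRiemannianMetric p T} (S : LagrangeSpace n M h) {c c' : JetChart p n T M}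
  {y : JetModel p n}

open JetChart

theorem christoffel_contDiffAt (hy : y ∈ c.target) (γ α β : Fin p) :
    ContDiffAt ℝ ∞ (fun y : JetModel p n => h.christoffel c.time γ α β y.1.1) y :=
  ContDiffAt.comp (g := h.christoffel c.time γ α β) y (h.christoffel_contDiffAt c.time_mem hy.1 γ α β)
    (contDiff_fst.comp contDiff_fst).contDiffAt

theorem time_lo_contDiffAt (hy : y ∈ c.target) (α β : Fin p) :
    ContDiffAt ℝ ∞ (fun y : JetModel p n => h.lo c.time α β y.1.1) y :=
  (h.lo_contDiffAt c.time_mem hy.1 α β).comp y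
    (contDiff_fst.comp contDiff_fst).contDiffAt

theorem time_up_contDiffAt (hy : y ∈ c.target) (α β : Fin p) :
    ContDiffAt ℝ ∞ (fun y : JetModel p n => h.up c.time α β y.1.1) y :=
  (h.up_contDiffAt c.time_mem hy.1 α β).comp y
    (contDiff_fst.comp contDiff_fst).contDiffAt

theorem spray_contDiffAt (hy : y ∈ c.target) (k : Fin n) : ContDiffAt ℝ ∞ (S.spray c k) y := by
  have hL := S.lag_contDiffAt hy
  have hV := fun i α => dV_contDiffAt hL i α
  refine contDiffAt_const.mul (ContDiffAt.sum fun i _ =>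
    ((S.up_contDiffAt hy k i).div_const 2).mul
      (((((ContDiffAt.sum fun j _ => ContDiffAt.sum fun α _ =>
        (dX_contDiffAt (hV i α) j).mul (vel_contDiffAt j α y)).sub (dX_contDiffAt hL i)).add
        (ContDiffAt.sum fun α _ => dT_contDiffAt (hV i α) α)).add
        (ContDiffAt.sum fun α _ => ContDiffAt.sum fun γ _ =>
          (hV i α).mul (christoffel_contDiffAt hy γ α γ))).add
        (contDiffAt_const.mul (ContDiffAt.sum fun j _ => ContDiffAt.sum fun α _ =>
          ContDiffAt.sum fun β _ => ContDiffAt.sum fun γ _ =>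
            (((S.lo_contDiffAt hy i j).mul (time_up_contDiffAt hy α β)).mul
              (christoffel_contDiffAt hy γ α β)).mul (vel_contDiffAt j γ y)))))

theorem spatial_contDiffAt (hy : y ∈ c.target) (i : Fin n) (α : Fin p) (j : Fin n) :
    ContDiffAt ℝ ∞ (S.spatial c i α j) y :=
  ContDiffAt.sum fun γ _ => (time_lo_contDiffAt hy α γ).mul
    (dV_contDiffAt (S.spray_contDiffAt hy i) j γ)

theorem temporal_contDiffAt (hy : y ∈ c.target) (i : Fin n) (α β : Fin p) :
    ContDiffAt ℝ ∞ (S.temporal c i α β) y :=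
  (ContDiffAt.sum fun γ _ => (christoffel_contDiffAt hy γ α β).mul (vel_contDiffAt i γ y)).neg

theorem sprayVec_contDiffAt (hy : y ∈ c.target) : ContDiffAt ℝ ∞ (S.sprayVec c) y :=
  contDiffAt_euclidean.2 fun k => S.spray_contDiffAt hy k

/-- The temporal part of the nonlinear connection. -/
def temporalL (c : JetChart p n T M) (y : JetModel p n) : Vec p →ₗ[ℝ] Vec p →L[ℝ] Vec n where
  toFun a := vertSum fun i α => ∑ β, S.temporal c i α β y * a β
  map_add' a b := vert_ext fun i α => by
    simp [vertSum_bv, mul_add, Finset.sum_add_distrib]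
  map_smul' r a := vert_ext fun i α => by
    simp [vertSum_bv, Finset.mul_sum, mul_left_comm]

/-- The spatial part of the nonlinear connection. -/
def spatialL (c : JetChart p n T M) (y : JetModel p n) : Vec n →ₗ[ℝ] Vec p →L[ℝ] Vec n where
  toFun a := vertSum fun i α => ∑ j, S.spatial c i α j y * a j
  map_add' a b := vert_ext fun i α => by
    simp [vertSum_bv, mul_add, Finset.sum_add_distrib]
  map_smul' r a := vert_ext fun i α => by
    simp [vertSum_bv, Finset.mul_sum, mul_left_comm]

theorem temporalL_bv (a : Vec p) (i : Fin n) (α : Fin p) :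
    S.temporalL c y a (bv α) i = ∑ β, S.temporal c i α β y * a β := vertSum_bv _ i α

theorem spatialL_bv (b : Vec n) (i : Fin n) (α : Fin p) :
    S.spatialL c y b (bv α) i = ∑ j, S.spatial c i α j y * b j := vertSum_bv _ i α

theorem temporalL_apply (a z : Vec p) :
    S.temporalL c y a z = - y.2 (h.chr c.time y.1.1 a z) := by
  suffices S.temporalL c y a = -(y.2 ∘L h.chrL c.time y.1.1 a) by rw [this]; rfl
  refine vert_ext fun i α => ?_
  rw [temporalL_bv]
  change _ = -((y.2 (h.chr c.time y.1.1 a (bv α))) i)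
  rw [h.chr_symm, map_eq_sum (h.chr c.time y.1.1 (bv α)), map_sum, WithLp.ofLp_sum,
    Finset.sum_apply, ← Finset.sum_neg_distrib]
  refine Finset.sum_congr rfl fun β _ => ?_
  have e : (y.2 (h.chr c.time y.1.1 (bv α) (bv β))) i
      = ∑ γ, h.christoffel c.time γ α β y.1.1 * vel i γ y := by
    rw [map_eq_sum y.2, SemiRiemannianMetric.chr]
    simp [bilV_bv, vel]
  rw [map_smul, PiLp.smul_apply, e, temporal, smul_eq_mul]
  ring

/-- Contracting `h_{αγ} ∂𝒢/∂x^j_γ` with `a` and `b` is differentiating the spray in the vertical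
direction `b ⊗ a♭`; in this form the law of `N` follows from that of the spray. -/
theorem spatialL_apply (hy : y ∈ c.target) (b : Vec n) (a : Vec p) :
    S.spatialL c y b a = fderiv ℝ (S.sprayVec c) y ((0, 0), rk b (h.flat c.time y.1.1 a)) := by
  have hd := (S.sprayVec_contDiffAt hy).differentiableAt (by simp)
  have hc : ∀ i (w : JetModel p n), (fderiv ℝ (S.sprayVec c) y w) i = fderiv ℝ (S.spray c i) y w :=
    fun i w => (congrArg (fun f => f w) (vec_hasFDerivAt hd i).fderiv).symm
  ext i
  rw [hc, spatialL]
  change vertSum _ a i = _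
  rw [vertSum_apply]
  have e : (((0, 0), rk b (h.flat c.time y.1.1 a)) : JetModel p n)
      = ∑ j, ∑ γ, (h.flat c.time y.1.1 a (bv γ) * b j) • ((0, 0), vertUnit j γ) := by
    have := congrArg vertL (hom_eq_sum (rk b (h.flat c.time y.1.1 a)))
    simp only [map_sum, map_smul, rk_apply, PiLp.smul_apply, smul_eq_mul] at this
    exact this
  rw [e, map_sum]
  simp only [map_sum, map_smul, smul_eq_mul]
  simp_rw [Finset.sum_mul]
  rw [Finset.sum_comm]
  refine Finset.sum_congr rfl fun j _ => ?_
  simp only [spatial, Finset.sum_mul]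
  rw [Finset.sum_comm]
  refine Finset.sum_congr rfl fun γ _ => ?_
  have e2 : h.flat c.time y.1.1 a (bv γ) = ∑ α, h.lo c.time α γ y.1.1 * a α := by
    rw [h.flat_apply, map_eq_sum (bil fun α β => h.lo c.time α β y.1.1) a, LinearMap.sum_apply]
    exact Finset.sum_congr rfl fun α _ => by
      rw [LinearMap.smul_apply, bil_bv, smul_eq_mul, mul_comm]
  rw [e2]
  simp only [Finset.sum_mul]
  refine Finset.sum_congr rfl fun α _ => ?_
  rw [dV]
  ring

/-- The law of the spray is differentiated along the vertical line through `y` in the direction `b ⊗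
a♭`. The quadratic defect polarises into two equal terms, which the factor one half reduces to one
Hessian. -/
theorem spatialL_change (hy : y ∈ c.overlap c') (b : Vec n) (a : Vec p) :
    c.jacX c' y (S.spatialL c y b a)
      = S.spatialL c' (c.change c' y) (c.jacX c' y b) (c.jacT c' y a)
        + c.hessX c' y b (y.2 a) := by
  set B := rk b (h.flat c.time y.1.1 a) with hB
  have hg : HasDerivAt (fun s : ℝ => ((y.1, y.2 + s • B) : JetModel p n)) ((0, 0), B) 0 :=
    (hasDerivAt_const (0 : ℝ) y.1).prodMk
      (((hasDerivAt_id (0 : ℝ)).smul_const B).const_add y.2 |>.congr_deriv (one_smul ℝ B))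
  have g0 : ((y.1, y.2 + (0 : ℝ) • B) : JetModel p n) = y := by
    rw [show (0 : ℝ) • B = 0 from zero_smul ℝ B, add_zero]
  have k1 : HasDerivAt (fun s : ℝ => c.jacX c' y (S.sprayVec c (y.1, y.2 + s • B)))
      (c.jacX c' y (fderiv ℝ (S.sprayVec c) y ((0, 0), B))) 0 := by
    refine (c.jacX c' y).hasFDerivAt.comp_hasDerivAt 0 ?_
    refine HasFDerivAt.comp_hasDerivAt_of_eq (x := 0) (y := y) (l := S.sprayVec c) ?_ hg g0.symm
    exact ((S.sprayVec_contDiffAt hy.1).differentiableAt (by simp)).hasFDerivAt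
  have k2 : HasDerivAt (fun s : ℝ => S.sprayVec c' (c.change c' (y.1, y.2 + s • B)))
      (fderiv ℝ (S.sprayVec c') (c.change c' y) (c.changeD c' y ((0, 0), B))) 0 := by
    have k3 : HasDerivAt (fun s : ℝ => c.change c' (y.1, y.2 + s • B))
        (c.changeD c' y ((0, 0), B)) 0 :=
      HasFDerivAt.comp_hasDerivAt_of_eq (x := 0) (y := y) (l := c.change c')
        (change_differentiableAt hy).hasFDerivAt hg g0.symm
    refine HasFDerivAt.comp_hasDerivAt_of_eq (x := 0) (l := S.sprayVec c') ?_ k3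
      (congrArg (c.change c') g0.symm)
    exact ((S.sprayVec_contDiffAt (change_mem hy)).differentiableAt (by simp)).hasFDerivAt
  have k4 : HasDerivAt (fun s : ℝ => sprayDefect h c c' (y.1, y.2 + s • B))
      (∑ α, (c.hessX c' y (B (bv α)) (y.2 (h.sharp c.time y.1.1 (cv α)))
        + c.hessX c' y (y.2 (bv α)) (B (h.sharp c.time y.1.1 (cv α))))) 0 := by
    refine HasDerivAt.fun_sum fun α _ => ?_
    have e1 : ∀ z, HasDerivAt (fun s : ℝ => (y.2 + s • B) z) (B z) 0 := fun z => by
      have := ((hasDerivAt_id (0 : ℝ)).smul_const (B z)).const_add (y.2 z)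
      exact this.congr_deriv (one_smul ℝ (B z))
    have e2 := ((fderiv ℝ (fderiv ℝ (trans c.space c'.space)) y.1.2).hasFDerivAt.comp_hasDerivAt
      (0 : ℝ) (e1 (bv α))).clm_apply (e1 (h.sharp c.time y.1.1 (cv α)))
    refine (e2.congr_deriv ?_).congr_of_eventuallyEq ?_
    · rw [show (0 : ℝ) • B = 0 from zero_smul ℝ B, add_zero]
      simp only [Function.comp_apply]
      rw [show (0 : ℝ) • B = 0 from zero_smul ℝ B, add_zero]
      rw [hessX_eq hy, hessX_eq hy]
      rfl
    · refine Filter.Eventually.of_forall fun s => ?_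
      exact hessX_eq hy _ _
  -- Along the line only the velocities move, while the Jacobians depend only on the base point
  -- `y.1`; they are therefore constant in `s`.
  have k5 : (fun s : ℝ => c.jacX c' y (S.sprayVec c (y.1, y.2 + s • B))) =ᶠ[𝓝 0]
      fun s => S.sprayVec c' (c.change c' (y.1, y.2 + s • B))
        + (1 / 2 : ℝ) • sprayDefect h c c' (y.1, y.2 + s • B) := by
    have : ∀ᶠ s in 𝓝 (0 : ℝ), ((y.1, y.2 + s • B) : JetModel p n) ∈ c.overlap c' :=
      hg.continuousAt.eventually_mem ((c.isOpen_overlap c').mem_nhds (g0.symm ▸ hy))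
    filter_upwards [this] with s hs
    exact S.sprayVec_change hs
  have k6 := k1.unique ((k2.add (k4.const_smul (1 / 2 : ℝ))).congr_of_eventuallyEq k5)
  have f1 : h.flat c.time y.1.1 a ∘L (c.jacT c' y).inverse
      = h.flat c'.time (c.change c' y).1.1 (c.jacT c' y a) :=
    h.flat_trans c.time_mem c'.time_mem hy.1.1 hy.2.1 a
  -- In the first sum the coefficients of `a♭` contract with the sharps to `a`; in the second `a♭`
  -- evaluated on a sharp gives back a coordinate of `a`.
  have f2 : ∑ α, (c.hessX c' y (B (bv α)) (y.2 (h.sharp c.time y.1.1 (cv α)))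
        + c.hessX c' y (y.2 (bv α)) (B (h.sharp c.time y.1.1 (cv α))))
      = c.hessX c' y b (y.2 a) + c.hessX c' y b (y.2 a) := by
    rw [Finset.sum_add_distrib]
    congr 1
    · conv_rhs => rw [← h.sum_flat_smul_sharp c.time_mem hy.1.1 a, map_sum, hessX_eq hy, map_sum]
      refine Finset.sum_congr rfl fun α _ => ?_
      rw [hessX_eq hy, hB, rk_apply, map_smul, map_smul, map_smul, LinearMap.smul_apply]
    · conv_rhs => rw [hessX_symm hy, hessX_eq hy, map_eq_sum y.2 a, map_sum, LinearMap.sum_apply]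
      refine Finset.sum_congr rfl fun α _ => ?_
      rw [hessX_eq hy, hB, rk_apply, map_smul, map_smul, LinearMap.smul_apply]
      congr 1
      rw [h.flat_apply, bil_symm (fun i j => h.lo_symm c.time i j y.1.1),
        h.bil_sharp c.time_mem hy.1.1]
      rfl
  rw [S.spatialL_apply hy.1, S.spatialL_apply (change_mem hy), k6, f2, hB, changeD_rk hy, f1,
    ← two_smul ℝ, smul_smul]
  norm_num

end LagrangeSpace
end Splitting

/-! ### Adapted components and the spatial connection form. -/

section Adapted

variable {p n : ℕ}
  {T : Type*} [TopologicalSpace T] [ChartedSpace (Vec p) T] [IsManifold (𝓡 p) ∞ T]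
  {M : Type*} [TopologicalSpace M] [ChartedSpace (Vec n) M] [IsManifold (𝓡 n) ∞ M]

/-- The action of a coordinate change on adapted components. -/
def JetChart.act (c c' : JetChart p n T M) (y : JetModel p n) : JetModel p n →ₗ[ℝ] JetModel p n where
  toFun w := ((c.jacT c' y w.1.1, c.jacX c' y w.1.2),
    c.jacX c' y ∘L w.2 ∘L (c.jacT c' y).inverse)
  map_add' a b := jet_ext (by simp) (by simp) (by ext1 z; simp)
  map_smul' r a := jet_ext (by simp) (by simp) (by ext1 z; simp)

namespace LagrangeSpace

variable {h : SemiRiemannianMetric p T} (S : LagrangeSpace n M h) {c c' : JetChart p n T M}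
  {y : JetModel p n}

open JetChart

/-- The components in the adapted basis, in terms of the components in the natural basis. -/
def adapt (c : JetChart p n T M) (y : JetModel p n) : JetModel p n →ₗ[ℝ] JetModel p n where
  toFun w := ((w.1.1, w.1.2), w.2 + S.temporalL c y w.1.1 + S.spatialL c y w.1.2)
  map_add' a b := jet_ext rfl rfl (by
    simp only [Prod.fst_add, Prod.snd_add, map_add]
    abel)
  map_smul' r a := jet_ext rfl rfl (by simp [smul_add])

/-- The components in the natural basis, in terms of the components in the adapted basis. -/
def unadapt (c : JetChart p n T M) (y : JetModel p n) : JetModel p n →ₗ[ℝ] JetModel p n where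
  toFun w := ((w.1.1, w.1.2), w.2 - S.temporalL c y w.1.1 - S.spatialL c y w.1.2)
  map_add' a b := jet_ext rfl rfl (by
    simp only [Prod.fst_add, Prod.snd_add, map_add]
    abel)
  map_smul' r a := jet_ext rfl rfl (by simp [smul_sub])

theorem adapt_unadapt (w : JetModel p n) : S.adapt c y (S.unadapt c y w) = w :=
  jet_ext rfl rfl (by
    change w.2 - S.temporalL c y w.1.1 - S.spatialL c y w.1.2 + S.temporalL c y w.1.1
      + S.spatialL c y w.1.2 = w.2
    abel)

theorem unadapt_adapt (w : JetModel p n) : S.unadapt c y (S.adapt c y w) = w :=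
  jet_ext rfl rfl (by
    change w.2 + S.temporalL c y w.1.1 + S.spatialL c y w.1.2 - S.temporalL c y w.1.1
      - S.spatialL c y w.1.2 = w.2
    abel)

theorem temporalL_contDiffAt (hy : y ∈ c.target) {a : JetModel p n → Vec p} {r : ℕ∞ω} (hr : r ≤ ∞)
    (ha : ContDiffAt ℝ r a y) : ContDiffAt ℝ r (fun y => S.temporalL c y (a y)) y :=
  vertSum_contDiffAt fun i α => ContDiffAt.sum fun β _ =>
    ((S.temporal_contDiffAt hy i α β).of_le hr).mul (contDiffAt_euclidean.1 ha β)

theorem spatialL_contDiffAt (hy : y ∈ c.target) {a : JetModel p n → Vec n} {r : ℕ∞ω} (hr : r ≤ ∞)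
    (ha : ContDiffAt ℝ r a y) : ContDiffAt ℝ r (fun y => S.spatialL c y (a y)) y :=
  vertSum_contDiffAt fun i α => ContDiffAt.sum fun j _ =>
    ((S.spatial_contDiffAt hy i α j).of_le hr).mul (contDiffAt_euclidean.1 ha j)

theorem adapt_contDiffAt (hy : y ∈ c.target) {Z : JetModel p n → JetModel p n} {r : ℕ∞ω}
    (hr : r ≤ ∞) (hZ : ContDiffAt ℝ r Z y) : ContDiffAt ℝ r (fun y => S.adapt c y (Z y)) y :=
  hZ.fst.prodMk ((hZ.snd.add (S.temporalL_contDiffAt hy hr hZ.fst.fst)).add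
    (S.spatialL_contDiffAt hy hr hZ.fst.snd))

theorem unadapt_contDiffAt (hy : y ∈ c.target) {Z : JetModel p n → JetModel p n} {r : ℕ∞ω}
    (hr : r ≤ ∞) (hZ : ContDiffAt ℝ r Z y) : ContDiffAt ℝ r (fun y => S.unadapt c y (Z y)) y :=
  hZ.fst.prodMk ((hZ.snd.sub (S.temporalL_contDiffAt hy hr hZ.fst.fst)).sub
    (S.spatialL_contDiffAt hy hr hZ.fst.snd))

/-- The adapted splitting is invariant under coordinate changes. -/
theorem adapt_change (hy : y ∈ c.overlap c') (w : JetModel p n) :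
    S.adapt c' (c.change c' y) (c.changeD c' y w) = c.act c' y (S.adapt c y w) := by
  refine jet_ext (changeD_time hy w) (changeD_space hy w) (ext_jacT hy fun z => ?_)
  have e := h.chr_trans c.time_mem c'.time_mem hy.1.1 hy.2.1 w.1.1 z
  change c.jacT c' y _ = h.chr c'.time (c.change c' y).1.1 (c.jacT c' y w.1.1) (c.jacT c' y z)
      + c.hessT c' y w.1.1 z at e
  change (c.changeD c' y w).2 (c.jacT c' y z)
      + S.temporalL c' (c.change c' y) (c.changeD c' y w).1.1 (c.jacT c' y z)
      + S.spatialL c' (c.change c' y) (c.changeD c' y w).1.2 (c.jacT c' y z)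
    = c.jacX c' y ((S.adapt c y w).2 ((c.jacT c' y).inverse (c.jacT c' y z)))
  rw [(jacT_isInvertible hy).inverse_apply_self]
  change _ = c.jacX c' y (w.2 z + S.temporalL c y w.1.1 z + S.spatialL c y w.1.2 z)
  -- The temporal Hessian of `changeD_vert` cancels against the Christoffel law inside `M`, the
  -- spatial Hessian against the law of `N`.
  rw [changeD_vert hy, changeD_time hy, changeD_space hy, map_add, map_add, S.spatialL_change hy,
    S.temporalL_apply, S.temporalL_apply, map_neg, ← change_snd_apply hy, e, map_add]
  abel

theorem changeD_unadapt (hy : y ∈ c.overlap c') (w : JetModel p n) :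
    c.changeD c' y (S.unadapt c y w) = S.unadapt c' (c.change c' y) (c.act c' y w) := by
  rw [← S.unadapt_adapt (c := c') (y := c.change c' y) (c.changeD c' y _), S.adapt_change hy,
    S.adapt_unadapt]

/-- The derivative of `g` in the direction with adapted components `w`. -/
def dlo (c : JetChart p n T M) (y w : JetModel p n) (i j : Fin n) : ℝ :=
  fderiv ℝ (S.lo c i j) y (S.unadapt c y w)

theorem dlo_symm (w : JetModel p n) (i j : Fin n) : S.dlo c y w i j = S.dlo c y w j i := by
  rw [dlo, dlo, show S.lo c i j = S.lo c j i from funext fun z => S.lo_symm c i j z]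

/-- In adapted components the direction transforms by `act`, so the only non-tensorial terms left
are the spatial Hessians from differentiating the Jacobians of `g`. -/
theorem dlo_change (hy : y ∈ c.overlap c') (u v : Vec n) (w : JetModel p n) :
    bil (S.dlo c y w) u v =
      bil (S.dlo c' (c.change c' y) (c.act c' y w)) (c.jacX c' y u) (c.jacX c' y v)
      + bil (fun i j => S.lo c' i j (c.change c' y)) (c.hessX c' y w.1.2 u) (c.jacX c' y v)
      + bil (fun i j => S.lo c' i j (c.change c' y)) (c.jacX c' y u) (c.hessX c' y w.1.2 v) := by
  have e := S.bil_dlo_change hy u v (S.unadapt c y w)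
  rw [S.changeD_unadapt hy] at e
  exact e

theorem dlo_time (γ : Fin p) (i j : Fin n) :
    S.dlo c y ((bv γ, 0), 0) i j = S.deltaT c γ (S.lo c i j) y := by
  have e : S.unadapt c y ((bv γ, 0), 0) = ((bv γ, 0), 0)
      - vertL (∑ i, ∑ α, S.temporal c i α γ y • vertUnit i α) := by
    refine jet_ext (sub_zero _).symm (sub_zero _).symm (vert_ext fun i α => ?_)
    change (0 - S.temporalL c y (bv γ) - S.spatialL c y 0) (bv α) i = (0 - vertSum _) (bv α) i
    rw [map_zero, sub_zero, zero_sub, zero_sub]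
    change -(S.temporalL c y (bv γ) (bv α) i) = -(vertSum _ (bv α) i)
    rw [temporalL_bv, vertSum_bv]
    simp
  rw [dlo, e, map_sub]
  simp only [map_sum, map_smul]
  rfl

theorem dlo_space (k : Fin n) (i j : Fin n) :
    S.dlo c y ((0, bv k), 0) i j = S.deltaX c k (S.lo c i j) y := by
  have e : S.unadapt c y ((0, bv k), 0) = ((0, bv k), 0)
      - vertL (∑ i, ∑ α, S.spatial c i α k y • vertUnit i α) := by
    refine jet_ext (sub_zero _).symm (sub_zero _).symm (vert_ext fun i α => ?_)
    change (0 - S.temporalL c y 0 - S.spatialL c y (bv k)) (bv α) i = (0 - vertSum _) (bv α) i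
    rw [map_zero, sub_zero, zero_sub, zero_sub]
    change -(S.spatialL c y (bv k) (bv α) i) = -(vertSum _ (bv α) i)
    rw [spatialL_bv, vertSum_bv]
    simp
  rw [dlo, e, map_sub]
  simp only [map_sum, map_smul]
  rfl

theorem unadapt_vert (B : Vec p →L[ℝ] Vec n) : S.unadapt c y ((0, 0), B) = ((0, 0), B) := by
  refine jet_ext rfl rfl ?_
  change B - S.temporalL c y 0 - S.spatialL c y 0 = B
  simp

theorem dlo_vert (k : Fin n) (γ : Fin p) (i j : Fin n) :
    S.dlo c y ((0, 0), vertUnit k γ) i j = dV k γ (S.lo c i j) y := by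
  rw [dlo, unadapt_vert]
  rfl

/-- The derivative of `g` as a linear map in the direction. -/
def dloL (c : JetChart p n T M) (y : JetModel p n) (u v : Vec n) : JetModel p n →ₗ[ℝ] ℝ where
  toFun w := bil (S.dlo c y w) u v
  map_add' a b := by
    simp [bil_apply, dlo, add_mul, Finset.sum_add_distrib]
  map_smul' r a := by
    simp [bil_apply, dlo, Finset.mul_sum, mul_assoc]

theorem dloL_apply (u v : Vec n) (w : JetModel p n) :
    S.dloL c y u v w = bil (S.dlo c y w) u v := rfl

theorem dloL_congr {u v : Vec n} {w : JetModel p n} {d : Fin n → Fin n → ℝ}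
    (hd : ∀ i j, S.dlo c y w i j = d i j) : S.dloL c y u v w = bil d u v := by
  rw [dloL_apply, show S.dlo c y w = d from funext fun i => funext (hd i)]

theorem dloL_symm (u v : Vec n) (w : JetModel p n) : S.dloL c y u v w = S.dloL c y v u w :=
  bil_symm (fun i j => S.dlo_symm w i j) u v

/-- The inclusion of the temporal directions. -/
def timeL : Vec p →ₗ[ℝ] JetModel p n :=
  LinearMap.inl ℝ (Vec p × Vec n) (Vec p →L[ℝ] Vec n) ∘ₗ LinearMap.inl ℝ (Vec p) (Vec n)

/-- The inclusion of the spatial directions. -/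
def spaceL : Vec n →ₗ[ℝ] JetModel p n :=
  LinearMap.inl ℝ (Vec p × Vec n) (Vec p →L[ℝ] Vec n) ∘ₗ LinearMap.inr ℝ (Vec p) (Vec n)

theorem sum_mul_bil {k m : ℕ} (w : Fin k → ℝ) (d : Fin m → Fin m → Fin k → ℝ) (u v : Vec m) :
    bil (fun i j => ∑ l, w l * d i j l) u v = ∑ l, w l * bil (fun i j => d i j l) u v := by
  simp only [bil_apply, Finset.sum_mul, Finset.mul_sum, mul_assoc]
  conv_rhs => rw [Finset.sum_comm]
  exact Finset.sum_congr rfl fun i _ => Finset.sum_comm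

theorem dloL_timeL (a : Vec p) (u v : Vec n) : S.dloL c y u v (timeL a)
    = bil (fun i j => ∑ γ, a γ * S.deltaT c γ (S.lo c i j) y) u v := by
  rw [← LinearMap.comp_apply, map_eq_sum (S.dloL c y u v ∘ₗ timeL) a, sum_mul_bil]
  exact Finset.sum_congr rfl fun γ _ =>
    congrArg (a γ * ·) (S.dloL_congr (w := timeL (bv γ)) fun i j => S.dlo_time γ i j)

theorem dloL_spaceL (b : Vec n) (u v : Vec n) : S.dloL c y u v (spaceL b)
    = bil (fun i j => ∑ k, b k * S.deltaX c k (S.lo c i j) y) u v := by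
  rw [← LinearMap.comp_apply, map_eq_sum (S.dloL c y u v ∘ₗ spaceL) b, sum_mul_bil]
  exact Finset.sum_congr rfl fun k _ =>
    congrArg (b k * ·) (S.dloL_congr (w := spaceL (bv k)) fun i j => S.dlo_space k i j)

theorem dloL_vertL (γ : Fin p) (b : Vec n) (u v : Vec n) :
    S.dloL c y u v (vertL (rk b (cv γ)))
      = bil (fun i j => ∑ k, b k * dV k γ (S.lo c i j) y) u v := by
  have e := map_eq_sum (S.dloL c y u v ∘ₗ vertL ∘ₗ rkL.flip (cv γ)) b
  simp only [LinearMap.comp_apply, LinearMap.flip_apply, rkL_apply] at e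
  rw [e, sum_mul_bil]
  exact Finset.sum_congr rfl fun k _ =>
    congrArg (b k * ·) (S.dloL_congr (w := vertL (vertUnit k γ)) fun i j => S.dlo_vert k γ i j)

/-- The coefficients `G^k_{iγ}` of the Cartan connection. -/
def cartanG (c : JetChart p n T M) (y : JetModel p n) (k i : Fin n) (γ : Fin p) : ℝ :=
  ∑ m, S.up c k m y / 2 * S.deltaT c γ (S.lo c m i) y

/-- The coefficients `L^k_{ij}` of the Cartan connection. -/
def cartanL (c : JetChart p n T M) (y : JetModel p n) : Fin n → Fin n → Fin n → ℝ :=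
  koszul (fun i j => S.up c i j y) fun i j k => S.deltaX c k (S.lo c i j) y

/-- The coefficients `C^{k(γ)}_{i(j)}` of the Cartan connection. -/
def cartanC (c : JetChart p n T M) (y : JetModel p n) (γ : Fin p) : Fin n → Fin n → Fin n → ℝ :=
  koszul (fun i j => S.up c i j y) fun i j k => dV k γ (S.lo c i j) y

/-- The connection form of the Cartan connection on the spatial horizontal bundle. -/
def omega (c : JetChart p n T M) (y : JetModel p n) : JetModel p n →ₗ[ℝ] Vec n →ₗ[ℝ] Vec n :=
  (bilV (S.cartanG c y)).flip ∘ₗ LinearMap.fst ℝ (Vec p) (Vec n)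
      ∘ₗ LinearMap.fst ℝ (Vec p × Vec n) (Vec p →L[ℝ] Vec n)
    + (bilV (S.cartanL c y)).flip ∘ₗ LinearMap.snd ℝ (Vec p) (Vec n)
      ∘ₗ LinearMap.fst ℝ (Vec p × Vec n) (Vec p →L[ℝ] Vec n)
    + ∑ γ, (bilV (S.cartanC c y γ)).flip ∘ₗ (ContinuousLinearMap.apply ℝ (Vec n) (bv γ)).toLinearMap
      ∘ₗ LinearMap.snd ℝ (Vec p × Vec n) (Vec p →L[ℝ] Vec n)

theorem omega_apply (w : JetModel p n) (u : Vec n) :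
    S.omega c y w u = bilV (S.cartanG c y) u w.1.1 + bilV (S.cartanL c y) u w.1.2
      + ∑ γ, bilV (S.cartanC c y γ) u (w.2 (bv γ)) := by
  simp [omega]

/-- Each derivative of the metric is expanded by `koszul_bil`; by symmetry of the coefficients four
of the six resulting terms cancel in the alternating sum. -/
theorem two_mul_koszul_bil {m : ℕ} {lo up : Fin m → Fin m → ℝ} (hs : ∀ i j, lo i j = lo j i)
    (hinv' : ∀ i j, ∑ k, lo i k * up k j = if i = j then 1 else 0)
    {d : Fin m → Fin m → Fin m → ℝ} (hd : ∀ i j k, d i j k = d j i k) (u v w : Vec m) :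
    2 * bil lo (bilV (koszul up d) u w) v = bil (fun i j => ∑ k, w k * d i j k) u v
      + bil (fun i j => ∑ k, u k * d i j k) w v - bil (fun i j => ∑ k, v k * d i j k) u w := by
  have hK : ∀ u v, bilV (koszul up d) u v = bilV (koszul up d) v u := fun u v =>
    bilV_symm (fun i j k => koszul_symm hd i j k) u v
  rw [koszul_bil hs hinv' hd, koszul_bil hs hinv' hd, koszul_bil hs hinv' hd, hK w u, hK v u,
    hK w v, bil_symm hs w]
  ring

theorem omega_timeL (a : Vec p) (u : Vec n) :
    S.omega c y (timeL a) u = bilV (S.cartanG c y) u a := by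
  rw [omega_apply]
  change bilV (S.cartanG c y) u a + bilV (S.cartanL c y) u 0 + ∑ γ, bilV (S.cartanC c y γ) u 0 = _
  simp

theorem omega_spaceL (b u : Vec n) :
    S.omega c y (spaceL b) u = bilV (S.cartanL c y) u b := by
  rw [omega_apply]
  change bilV (S.cartanG c y) u 0 + bilV (S.cartanL c y) u b + ∑ γ, bilV (S.cartanC c y γ) u 0 = _
  simp

theorem omega_vertL (θ : Vec p →L[ℝ] ℝ) (b u : Vec n) :
    S.omega c y (vertL (rk b θ)) u = ∑ γ, θ (bv γ) • bilV (S.cartanC c y γ) u b := by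
  rw [omega_apply]
  change bilV (S.cartanG c y) u 0 + bilV (S.cartanL c y) u 0
    + ∑ γ, bilV (S.cartanC c y γ) u (θ (bv γ) • b) = _
  simp

/-- Pairing with `g` removes its inverse from `G` and leaves half the temporal derivative of `g`.
With its two companions for spatial and vertical directions, this describes `omega` without indices,
so that its law can be read off from that of `dloL`. -/
theorem bil_omega_time (hy : y ∈ c.target) (a : Vec p) (u v : Vec n) :
    2 * bil (fun i j => S.lo c i j y) (S.omega c y (timeL a) u) v = S.dloL c y u v (timeL a) := by
  have e := S.omega_timeL (c := c) (y := y) a u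
  have e2 : ∀ k, bilV (S.cartanG c y) u a k
      = ∑ m, S.up c k m y * ((∑ i, ∑ γ, S.deltaT c γ (S.lo c m i) y * (u i * a γ)) / 2) := by
    intro k
    rw [bilV_apply]
    simp only [cartanG, Finset.sum_mul, Finset.sum_div, Finset.mul_sum]
    conv_rhs => rw [Finset.sum_comm]
    refine Finset.sum_congr rfl fun i _ => ?_
    rw [Finset.sum_comm]
    exact Finset.sum_congr rfl fun m _ => Finset.sum_congr rfl fun γ _ => by ring
  rw [dloL_symm, dloL_timeL, e, bil_symm (fun i j => S.lo_symm c i j y), bil_apply, bil_apply,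
    Finset.mul_sum]
  refine Finset.sum_congr rfl fun j _ => ?_
  have e3 := sum_lo_mul_sum_up (S.lo_mul_up hy)
    (fun m => (∑ i, ∑ γ, S.deltaT c γ (S.lo c m i) y * (u i * a γ)) / 2) j
  simp only [← e2] at e3
  have e4 : ∑ k, S.lo c j k y * (v j * bilV (S.cartanG c y) u a k)
      = v j * ∑ k, S.lo c j k y * bilV (S.cartanG c y) u a k := by
    rw [Finset.mul_sum]
    exact Finset.sum_congr rfl fun k _ => by ring
  have e5 : ∀ r : ℝ, 2 * (v j * (r / 2)) = v j * r := fun r => by ring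
  rw [e4, e3, e5, Finset.mul_sum]
  refine Finset.sum_congr rfl fun i _ => ?_
  rw [Finset.sum_mul, Finset.mul_sum]
  exact Finset.sum_congr rfl fun γ _ => by ring

theorem bil_omega_space (hy : y ∈ c.target) (b u v : Vec n) :
    2 * bil (fun i j => S.lo c i j y) (S.omega c y (spaceL b) u) v
      = S.dloL c y u v (spaceL b) + S.dloL c y b v (spaceL u) - S.dloL c y u b (spaceL v) := by
  have e := S.omega_spaceL (c := c) (y := y) b u
  rw [e, cartanL, two_mul_koszul_bil (fun i j => S.lo_symm c i j y) (S.lo_mul_up hy)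
    (fun i j k => by rw [show S.lo c i j = S.lo c j i from funext fun z => S.lo_symm c i j z]),
    dloL_spaceL, dloL_spaceL, dloL_spaceL]

/-- The Koszul formula holds for each fixed `γ`. Here the covector `θ` is a spectator, and only the
vectors `b`, `u`, `v` are permuted. -/
theorem bil_omega_vert (hy : y ∈ c.target) (θ : Vec p →L[ℝ] ℝ) (b u v : Vec n) :
    2 * bil (fun i j => S.lo c i j y) (S.omega c y (vertL (rk b θ)) u) v
      = S.dloL c y u v (vertL (rk b θ)) + S.dloL c y b v (vertL (rk u θ))
        - S.dloL c y u b (vertL (rk v θ)) := by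
  have e1 : ∀ u v b, S.dloL c y u v (vertL (rk b θ))
      = ∑ γ, θ (bv γ) * S.dloL c y u v (vertL (rk b (cv γ))) := by
    intro u v b
    conv_lhs => rw [covec_eq_sum θ, ← rkL_apply]
    simp only [map_sum, map_smul]
    rfl
  have e := S.omega_vertL (c := c) (y := y) θ b u
  rw [e, e1, e1, e1, map_sum, LinearMap.sum_apply, Finset.mul_sum, ← Finset.sum_add_distrib,
    ← Finset.sum_sub_distrib]
  refine Finset.sum_congr rfl fun γ _ => ?_
  rw [map_smul, LinearMap.smul_apply, smul_eq_mul, mul_left_comm, cartanC,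
    two_mul_koszul_bil (fun i j => S.lo_symm c i j y) (S.lo_mul_up hy)
    (fun i j k => by rw [show S.lo c i j = S.lo c j i from funext fun z => S.lo_symm c i j z]),
    dloL_vertL, dloL_vertL, dloL_vertL]
  ring

theorem dloL_change (hy : y ∈ c.overlap c') (u v : Vec n) (w : JetModel p n) :
    S.dloL c y u v w =
      S.dloL c' (c.change c' y) (c.jacX c' y u) (c.jacX c' y v) (c.act c' y w)
      + bil (fun i j => S.lo c' i j (c.change c' y)) (c.hessX c' y w.1.2 u) (c.jacX c' y v)
      + bil (fun i j => S.lo c' i j (c.change c' y)) (c.jacX c' y u) (c.hessX c' y w.1.2 v) :=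
  S.dlo_change hy u v w

theorem act_timeL (a : Vec p) : c.act c' y (timeL a) = timeL (c.jacT c' y a) :=
  jet_ext rfl (map_zero (c.jacX c' y)) (by
    ext1 z
    exact map_zero (c.jacX c' y))

theorem act_spaceL (b : Vec n) : c.act c' y (spaceL b) = spaceL (c.jacX c' y b) :=
  jet_ext (map_zero (c.jacT c' y)) rfl (by
    ext1 z
    exact map_zero (c.jacX c' y))

theorem act_vertL (b : Vec n) (θ : Vec p →L[ℝ] ℝ) : c.act c' y (vertL (rk b θ))
    = vertL (rk (c.jacX c' y b) (θ ∘L (c.jacT c' y).inverse)) :=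
  jet_ext (map_zero (c.jacT c' y)) (map_zero (c.jacX c' y)) (by
    ext1 z
    exact map_smul (c.jacX c' y) _ _)

theorem jet_eq_sum (w : JetModel p n) :
    w = timeL w.1.1 + spaceL w.1.2 + ∑ γ, vertL (rk (w.2 (bv γ)) (cv γ)) := by
  rw [← map_sum, ← hom_eq_sum_rk]
  exact jet_ext (by simp [timeL, spaceL, vertL]) (by simp [timeL, spaceL, vertL])
    (by simp [timeL, spaceL, vertL])

/-- The transformation law of the connection form. -/
theorem omega_change (hy : y ∈ c.overlap c') (w : JetModel p n) (u : Vec n) :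
    c.jacX c' y (S.omega c y w u)
      = S.omega c' (c.change c' y) (c.act c' y w) (c.jacX c' y u) + c.hessX c' y w.1.2 u := by
  have hm := change_mem hy
  have hi := jacX_isInvertible hy
  have z1 : ∀ u, c.hessX c' y 0 u = 0 := fun u => by rw [hessX_eq hy]; simp
  have inj : ∀ u₁ u₂ : Vec n, (∀ v, 2 * bil (fun i j => S.lo c' i j (c.change c' y)) u₁ (c.jacX c' y v)
      = 2 * bil (fun i j => S.lo c' i j (c.change c' y)) u₂ (c.jacX c' y v)) → u₁ = u₂ := by
    intro u₁ u₂ H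
    refine bil_injective (lo := fun i j => S.lo c' i j (c.change c' y))
      (fun i j => S.lo_symm c' i j _) (S.up_mul_lo hm) fun v => ?_
    obtain ⟨v, rfl⟩ := hi.surjective v
    linarith [H v]
  -- A temporal direction has no spatial component, so no Hessian appears; the same holds for the
  -- vertical directions in `hV`.
  have hT : ∀ a, c.jacX c' y (S.omega c y (timeL a) u)
      = S.omega c' (c.change c' y) (timeL (c.jacT c' y a)) (c.jacX c' y u) := by
    intro a
    refine inj _ _ fun v => ?_
    rw [← S.bil_lo_change hy, S.bil_omega_time hy.1, S.bil_omega_time hm, S.dloL_change hy,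
      act_timeL, show ((timeL a : JetModel p n)).1.2 = 0 from rfl, z1, z1]
    simp
  -- The three derivatives contribute six Hessian terms. Four cancel in pairs by symmetry, and the
  -- remaining two give twice the Hessian of `b` and `u`.
  have hX : ∀ b, c.jacX c' y (S.omega c y (spaceL b) u)
      = S.omega c' (c.change c' y) (spaceL (c.jacX c' y b)) (c.jacX c' y u)
        + c.hessX c' y b u := by
    intro b
    refine inj _ _ fun v => ?_
    rw [← S.bil_lo_change hy, S.bil_omega_space hy.1, map_add, LinearMap.add_apply, mul_add,
      S.bil_omega_space hm, S.dloL_change hy, S.dloL_change hy, S.dloL_change hy, act_spaceL,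
      act_spaceL, act_spaceL]
    simp only [show ∀ b, ((spaceL b : JetModel p n)).1.2 = b from fun _ => rfl]
    rw [hessX_symm hy u b, hessX_symm hy v u, hessX_symm hy v b,
      bil_symm (fun i j => S.lo_symm c' i j _) (c.jacX c' y b)]
    ring
  have hV : ∀ b θ, c.jacX c' y (S.omega c y (vertL (rk b θ)) u)
      = S.omega c' (c.change c' y) (vertL (rk (c.jacX c' y b) (θ ∘L (c.jacT c' y).inverse)))
        (c.jacX c' y u) := by
    intro b θ
    refine inj _ _ fun v => ?_
    rw [← S.bil_lo_change hy, S.bil_omega_vert hy.1, S.bil_omega_vert hm, S.dloL_change hy,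
      S.dloL_change hy, S.dloL_change hy, act_vertL, act_vertL, act_vertL]
    simp only [show ∀ B, ((vertL B : JetModel p n)).1.2 = 0 from fun _ => rfl, z1, map_zero,
      LinearMap.zero_apply, add_zero]
  have e := jet_eq_sum w
  generalize hb : w.1.2 = b at e
  rw [e]
  simp only [map_add, LinearMap.add_apply, map_sum, LinearMap.sum_apply, hT, hX, hV, act_timeL,
    act_spaceL, act_vertL]
  abel

end LagrangeSpace
end Adapted

/-! ### Construction of the Cartan connection. -/

section CartanConnection

variable {p n : ℕ}
  {T : Type*} [TopologicalSpace T] [ChartedSpace (Vec p) T] [IsManifold (𝓡 p) ∞ T]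
  {M : Type*} [TopologicalSpace M] [ChartedSpace (Vec n) M] [IsManifold (𝓡 n) ∞ M]

namespace JetChart

variable {c c' : JetChart p n T M} {y : JetModel p n}

theorem act_time (w : JetModel p n) : (c.act c' y w).1.1 = c.jacT c' y w.1.1 := rfl

theorem act_space (w : JetModel p n) : (c.act c' y w).1.2 = c.jacX c' y w.1.2 := rfl

theorem act_vert (hy : y ∈ c.overlap c') (w : JetModel p n) (ζ : Vec p) :
    (c.act c' y w).2 (c.jacT c' y ζ) = c.jacX c' y (w.2 ζ) := by
  change c.jacX c' y (w.2 ((c.jacT c' y).inverse (c.jacT c' y ζ))) = _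
  rw [(jacT_isInvertible hy).inverse_apply_self]

section

variable (hy : y ∈ c.overlap c') {Z Z' : JetModel p n → JetModel p n}
  (hZ : DifferentiableAt ℝ Z y) (hZ' : DifferentiableAt ℝ Z' (c.change c' y))
  (hZZ' : ∀ s ∈ c.overlap c', Z' (c.change c' s) = c.act c' s (Z s))

include hy hZ' in
theorem comp_change_hasFDerivAt : HasFDerivAt (fun s => Z' (c.change c' s))
    (fderiv ℝ Z' (c.change c' y) ∘L c.changeD c' y) y :=
  HasFDerivAt.comp (g := Z') y hZ'.hasFDerivAt (change_differentiableAt hy).hasFDerivAt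

include hy hZ hZ' hZZ'

/-- Components that transform by `act` have derivatives that pick up a Hessian from the moving
Jacobian. This term and its analogues in the two theorems below are compensated by the connection
form in `covLoc_change`. -/
theorem fderiv_act_time (w : JetModel p n) :
    (fderiv ℝ Z' (c.change c' y) (c.changeD c' y w)).1.1
      = c.hessT c' y w.1.1 (Z y).1.1 + c.jacT c' y (fderiv ℝ Z y w).1.1 := by
  have k := (jacT_differentiableAt hy).hasFDerivAt.clm_apply hZ.hasFDerivAt.fst.fst
  have k2 : (fun s => (Z' (c.change c' s)).1.1) =ᶠ[𝓝 y] fun s => c.jacT c' s (Z s).1.1 := by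
    filter_upwards [(c.isOpen_overlap c').mem_nhds hy] with s hs
    rw [hZZ' s hs, act_time]
  have k3 := congrArg (fun f => f w)
    ((comp_change_hasFDerivAt hy hZ').fst.fst.unique (k.congr_of_eventuallyEq k2))
  rw [← fderiv_jacT hy, add_comm]
  exact k3

theorem fderiv_act_space (w : JetModel p n) :
    (fderiv ℝ Z' (c.change c' y) (c.changeD c' y w)).1.2
      = c.hessX c' y w.1.2 (Z y).1.2 + c.jacX c' y (fderiv ℝ Z y w).1.2 := by
  have k := (jacX_differentiableAt hy).hasFDerivAt.clm_apply hZ.hasFDerivAt.fst.snd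
  have k2 : (fun s => (Z' (c.change c' s)).1.2) =ᶠ[𝓝 y] fun s => c.jacX c' s (Z s).1.2 := by
    filter_upwards [(c.isOpen_overlap c').mem_nhds hy] with s hs
    rw [hZZ' s hs, act_space]
  have k3 := congrArg (fun f => f w)
    ((comp_change_hasFDerivAt hy hZ').fst.snd.unique (k.congr_of_eventuallyEq k2))
  rw [← fderiv_jacX hy, add_comm]
  exact k3

/-- As for `changeD_vert`, evaluating on the image of the temporal Jacobian avoids differentiating
its inverse. -/
theorem fderiv_act_vert (w : JetModel p n) (ζ : Vec p) :
    (fderiv ℝ Z' (c.change c' y) (c.changeD c' y w)).2 (c.jacT c' y ζ)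
      = c.hessX c' y w.1.2 ((Z y).2 ζ) + c.jacX c' y ((fderiv ℝ Z y w).2 ζ)
        - (Z' (c.change c' y)).2 (c.hessT c' y w.1.1 ζ) := by
  have k := (jacX_differentiableAt hy).hasFDerivAt.clm_apply
    (hZ.hasFDerivAt.snd.clm_apply (hasFDerivAt_const ζ y))
  have k1 := (comp_change_hasFDerivAt hy hZ').snd.clm_apply
    ((jacT_differentiableAt hy).hasFDerivAt.clm_apply (hasFDerivAt_const ζ y))
  have k2 : (fun s => (Z' (c.change c' s)).2 (c.jacT c' s ζ)) =ᶠ[𝓝 y]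
      fun s => c.jacX c' s ((Z s).2 ζ) := by
    filter_upwards [(c.isOpen_overlap c').mem_nhds hy] with s hs
    rw [hZZ' s hs, act_vert hs]
  have k3 := congrArg (fun f => f w) (k1.unique (k.congr_of_eventuallyEq k2))
  simp only [ContinuousLinearMap.comp_zero, zero_add, add_apply,
    ContinuousLinearMap.comp_apply, ContinuousLinearMap.flip_apply,
    fderiv_jacT hy, fderiv_jacX hy] at k3
  rw [eq_sub_iff_add_eq, add_comm]
  refine k3.trans (add_comm _ _)

end

end JetChart

namespace LagrangeSpace

variable {h : SemiRiemannianMetric p T} (S : LagrangeSpace n M h) {c c' : JetChart p n T M}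
  {y : JetModel p n}

open JetChart

/-- The connection form of the Cartan connection in adapted components. -/
def connForm (c : JetChart p n T M) (y : JetModel p n) :
    JetModel p n →ₗ[ℝ] JetModel p n →ₗ[ℝ] JetModel p n :=
  LinearMap.mk₂ ℝ (fun w z => ((h.chr c.time y.1.1 w.1.1 z.1.1, S.omega c y w z.1.2),
      LinearMap.toContinuousLinearMap (S.omega c y w) ∘L z.2
        - z.2 ∘L h.chrL c.time y.1.1 w.1.1))
    (fun w w' z => jet_ext (LinearMap.map_add₂ _ _ _ _) (LinearMap.map_add₂ _ _ _ _) (by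
      ext1 ζ
      change S.omega c y (w + w') (z.2 ζ) - z.2 (h.chr c.time y.1.1 (w.1.1 + w'.1.1) ζ)
        = (S.omega c y w (z.2 ζ) - z.2 (h.chr c.time y.1.1 w.1.1 ζ))
          + (S.omega c y w' (z.2 ζ) - z.2 (h.chr c.time y.1.1 w'.1.1 ζ))
      rw [LinearMap.map_add₂, LinearMap.map_add₂, z.2.map_add]
      abel))
    (fun r w z => jet_ext (LinearMap.map_smul₂ _ _ _ _) (LinearMap.map_smul₂ _ _ _ _) (by
      ext1 ζ
      change S.omega c y (r • w) (z.2 ζ) - z.2 (h.chr c.time y.1.1 (r • w.1.1) ζ)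
        = r • (S.omega c y w (z.2 ζ) - z.2 (h.chr c.time y.1.1 w.1.1 ζ))
      rw [LinearMap.map_smul₂, LinearMap.map_smul₂, z.2.map_smul, smul_sub]))
    (fun w z z' => jet_ext ((h.chr c.time y.1.1 w.1.1).map_add _ _)
      ((S.omega c y w).map_add _ _) (by
      ext1 ζ
      change S.omega c y w (z.2 ζ + z'.2 ζ)
          - (z.2 (h.chr c.time y.1.1 w.1.1 ζ) + z'.2 (h.chr c.time y.1.1 w.1.1 ζ))
        = (S.omega c y w (z.2 ζ) - z.2 (h.chr c.time y.1.1 w.1.1 ζ))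
          + (S.omega c y w (z'.2 ζ) - z'.2 (h.chr c.time y.1.1 w.1.1 ζ))
      rw [(S.omega c y w).map_add]
      abel))
    (fun r w z => jet_ext ((h.chr c.time y.1.1 w.1.1).map_smul _ _)
      ((S.omega c y w).map_smul _ _) (by
      ext1 ζ
      change S.omega c y w (r • z.2 ζ) - r • z.2 (h.chr c.time y.1.1 w.1.1 ζ)
        = r • (S.omega c y w (z.2 ζ) - z.2 (h.chr c.time y.1.1 w.1.1 ζ))
      rw [(S.omega c y w).map_smul, smul_sub]))

theorem connForm_time (w z : JetModel p n) :
    (S.connForm c y w z).1.1 = h.chr c.time y.1.1 w.1.1 z.1.1 := rfl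

theorem connForm_space (w z : JetModel p n) : (S.connForm c y w z).1.2 = S.omega c y w z.1.2 := rfl

theorem connForm_vert (w z : JetModel p n) (ζ : Vec p) : (S.connForm c y w z).2 ζ
    = S.omega c y w (z.2 ζ) - z.2 (h.chr c.time y.1.1 w.1.1 ζ) := rfl

/-- The covariant derivative of a vector field given by its adapted components, in the direction
with natural components `w`. -/
def covLoc (c : JetChart p n T M) (Z : JetModel p n → JetModel p n) (y : JetModel p n) :
    JetModel p n →ₗ[ℝ] JetModel p n :=
  (fderiv ℝ Z y).toLinearMap + (S.connForm c y).flip (Z y) ∘ₗ S.adapt c y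

theorem covLoc_apply (Z : JetModel p n → JetModel p n) (w : JetModel p n) :
    S.covLoc c Z y w = fderiv ℝ Z y w + S.connForm c y (S.adapt c y w) (Z y) := rfl

/-- Block by block, the Hessians from differentiating the components cancel those in the laws of the
Christoffel symbols and of `omega`. On vertical vectors both occur, since there the connection acts
on a homomorphism. -/
theorem covLoc_change (hy : y ∈ c.overlap c') {Z Z' : JetModel p n → JetModel p n}
    (hZ : DifferentiableAt ℝ Z y) (hZ' : DifferentiableAt ℝ Z' (c.change c' y))
    (hZZ' : ∀ s ∈ c.overlap c', Z' (c.change c' s) = c.act c' s (Z s)) (w : JetModel p n) :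
    S.covLoc c' Z' (c.change c' y) (c.changeD c' y w) = c.act c' y (S.covLoc c Z y w) := by
  have hw1 : (S.adapt c y w).1.1 = w.1.1 := rfl
  have hw2 : (S.adapt c y w).1.2 = w.1.2 := rfl
  have e1 : ∀ ζ, c.jacT c' y (h.chr c.time y.1.1 w.1.1 ζ)
      = h.chr c'.time (c.change c' y).1.1 (c.jacT c' y w.1.1) (c.jacT c' y ζ)
        + c.hessT c' y w.1.1 ζ := fun ζ =>
    h.chr_trans c.time_mem c'.time_mem hy.1.1 hy.2.1 w.1.1 ζ
  rw [covLoc_apply, covLoc_apply, S.adapt_change hy, hZZ' y hy]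
  refine jet_ext ?_ ?_ (ext_jacT hy fun ζ => ?_)
  · change (fderiv ℝ Z' (c.change c' y) (c.changeD c' y w)).1.1
        + h.chr c'.time (c.change c' y).1.1 (c.jacT c' y w.1.1) (c.jacT c' y (Z y).1.1)
      = c.jacT c' y ((fderiv ℝ Z y w).1.1 + h.chr c.time y.1.1 w.1.1 (Z y).1.1)
    rw [fderiv_act_time hy hZ hZ' hZZ', (c.jacT c' y).map_add, e1]
    abel
  · change (fderiv ℝ Z' (c.change c' y) (c.changeD c' y w)).1.2
        + S.omega c' (c.change c' y) (c.act c' y (S.adapt c y w)) (c.jacX c' y (Z y).1.2)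
      = c.jacX c' y ((fderiv ℝ Z y w).1.2 + S.omega c y (S.adapt c y w) (Z y).1.2)
    rw [fderiv_act_space hy hZ hZ' hZZ', (c.jacX c' y).map_add, S.omega_change hy, hw2]
    abel
  · have k1 := fderiv_act_vert hy hZ hZ' hZZ' w ζ
    have k2 := act_vert hy (Z y) ζ
    have k3 := act_vert hy (Z y) (h.chr c.time y.1.1 w.1.1 ζ)
    rw [e1, (c.act c' y (Z y)).2.map_add] at k3
    rw [hZZ' y hy] at k1
    refine Eq.trans ?_ (act_vert hy _ ζ).symm
    change (fderiv ℝ Z' (c.change c' y) (c.changeD c' y w)).2 (c.jacT c' y ζ)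
        + (S.omega c' (c.change c' y) (c.act c' y (S.adapt c y w))
            ((c.act c' y (Z y)).2 (c.jacT c' y ζ))
          - (c.act c' y (Z y)).2
            (h.chr c'.time (c.change c' y).1.1 (c.jacT c' y w.1.1) (c.jacT c' y ζ)))
      = c.jacX c' y ((fderiv ℝ Z y w).2 ζ + (S.omega c y (S.adapt c y w) ((Z y).2 ζ)
          - (Z y).2 (h.chr c.time y.1.1 w.1.1 ζ)))
    rw [k1, k2, (c.jacX c' y).map_add, (c.jacX c' y).map_sub, ← k3, S.omega_change hy, hw2]
    abel

/-- The adapted components of a vector field, in coordinates. -/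
def arep (c : JetChart p n T M) (Y : ∀ e : J1 p n T M, TangentSpace (jetI p n) e)
    (y : JetModel p n) : JetModel p n := S.adapt c y (c.nrep Y y)

theorem _root_.MultiTime.JetChart.nrep_change (hy : y ∈ c.overlap c')
    (Y : ∀ e : J1 p n T M, TangentSpace (jetI p n) e) :
    c'.nrep Y (c.change c' y) = c.changeD c' y (c.nrep Y y) := by
  have e := compL_change (c := c) (c' := c') (param_mem hy.1) hy.2
  rw [nrep, param_change hy, e, coord_param hy.1]
  rfl

theorem arep_change (hy : y ∈ c.overlap c') (Y : ∀ e : J1 p n T M, TangentSpace (jetI p n) e) :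
    S.arep c' Y (c.change c' y) = c.act c' y (S.arep c Y y) := by
  rw [arep, nrep_change hy, S.adapt_change hy]
  rfl

theorem arep_differentiableAt {e : J1 p n T M} (he : e ∈ c.source)
    {Y : ∀ e : J1 p n T M, TangentSpace (jetI p n) e} (hY : DiffFieldAt Y e) :
    DifferentiableAt ℝ (S.arep c Y) (c.coord e) := by
  have hZ := (diffFieldAt_iff he).1 hY
  have hy := coord_mem he
  have hT : ∀ i α β, DifferentiableAt ℝ (S.temporal c i α β) (c.coord e) := fun i α β =>
    (S.temporal_contDiffAt hy i α β).differentiableAt (by simp)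
  have hX : ∀ i α j, DifferentiableAt ℝ (S.spatial c i α j) (c.coord e) := fun i α j =>
    (S.spatial_contDiffAt hy i α j).differentiableAt (by simp)
  have hA : ∀ a : JetModel p n → Fin n → Fin p → ℝ,
      (∀ i α, DifferentiableAt ℝ (fun y => a y i α) (c.coord e)) →
      DifferentiableAt ℝ (fun y => vertSum (a y)) (c.coord e) := fun a ha =>
    DifferentiableAt.fun_sum fun i _ => DifferentiableAt.fun_sum fun α _ =>
      (ha i α).smul_const (vertUnit i α)
  refine hZ.fst.prodMk ((hZ.snd.add (hA _ fun i α => ?_)).add (hA _ fun i α => ?_))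
  · exact DifferentiableAt.fun_sum fun β _ => (hT i α β).mul
        (differentiableAt_euclidean.1 hZ.fst.fst β)
  · exact DifferentiableAt.fun_sum fun j _ => (hX i α j).mul
        (differentiableAt_euclidean.1 hZ.fst.snd j)

/-- The adapted components of a tangent vector. -/
def acomp (c : JetChart p n T M) (e : J1 p n T M) : TangentSpace (jetI p n) e →ₗ[ℝ] JetModel p n :=
  S.adapt c (c.coord e) ∘ₗ (c.compL e).toLinearMap

theorem acomp_apply (e : J1 p n T M) (v : TangentSpace (jetI p n) e) :
    S.acomp c e v = S.adapt c (c.coord e) (c.compL e v) := rfl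

theorem acomp_eq_arep {e : J1 p n T M} (he : e ∈ c.source)
    (Y : ∀ e : J1 p n T M, TangentSpace (jetI p n) e) :
    S.acomp c e (Y e) = S.arep c Y (c.coord e) := by
  rw [arep, nrep, param_coord he]
  rfl

/-- Used throughout to verify identities between tangent vectors on their adapted components. -/
theorem acomp_injective {e : J1 p n T M} (he : e ∈ c.source) :
    Function.Injective (S.acomp c e) := by
  intro v w hvw
  apply (compL_isInvertible he).injective
  rw [← S.unadapt_adapt (c := c) (y := c.coord e) (c.compL e v),
    ← S.unadapt_adapt (c := c) (y := c.coord e) (c.compL e w)]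
  exact congrArg _ hvw

/-- The covariant derivative of the Cartan connection. -/
def cartanFun (Y : ∀ e : J1 p n T M, TangentSpace (jetI p n) e) (e : J1 p n T M) :
    TangentSpace (jetI p n) e →L[ℝ] TangentSpace (jetI p n) e :=
  ((pref p n T M e).compL e).inverse ∘L
    LinearMap.toContinuousLinearMap (S.unadapt (pref p n T M e) ((pref p n T M e).coord e) ∘ₗ
      S.covLoc (pref p n T M e) (S.arep (pref p n T M e) Y) ((pref p n T M e).coord e)) ∘L
    (pref p n T M e).compL e

theorem acomp_cartanFun_pref (Y : ∀ e : J1 p n T M, TangentSpace (jetI p n) e) (e : J1 p n T M)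
    (v : TangentSpace (jetI p n) e) :
    S.acomp (pref p n T M e) e (S.cartanFun Y e v)
      = S.covLoc (pref p n T M e) (S.arep (pref p n T M e) Y) ((pref p n T M e).coord e)
          ((pref p n T M e).compL e v) := by
  have e1 := (compL_isInvertible (mem_pref e)).self_apply_inverse
    (S.unadapt (pref p n T M e) ((pref p n T M e).coord e)
      (S.covLoc (pref p n T M e) (S.arep (pref p n T M e) Y) ((pref p n T M e).coord e)
          ((pref p n T M e).compL e v)))
  exact (congrArg _ e1).trans (S.adapt_unadapt _)

theorem _root_.MultiTime.JetChart.coord_change {e : J1 p n T M} (he : e ∈ c.source)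
    (he' : e ∈ c'.source) : c'.coord e = c.change c' (c.coord e) := by
  rw [← coord_param_eq_change (coord_mem he) (by rwa [param_coord he]), param_coord he]

theorem acomp_change {e : J1 p n T M} (he : e ∈ c.source) (he' : e ∈ c'.source)
    (v : TangentSpace (jetI p n) e) :
    S.acomp c' e v = c.act c' (c.coord e) (S.acomp c e v) := by
  have ho : c.coord e ∈ c.overlap c' := ⟨coord_mem he, by rwa [param_coord he]⟩
  rw [acomp_apply, coord_change he he', compL_change he he']
  exact S.adapt_change ho _

/-- The Cartan connection in arbitrary induced coordinates. -/
theorem acomp_cartanFun {e : J1 p n T M} (he : e ∈ c.source)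
    {Y : ∀ e : J1 p n T M, TangentSpace (jetI p n) e} (hY : DiffFieldAt Y e)
    (v : TangentSpace (jetI p n) e) :
    S.acomp c e (S.cartanFun Y e v) = S.covLoc c (S.arep c Y) (c.coord e) (c.compL e v) := by
  have hm := mem_pref e
  have ho : (pref p n T M e).coord e ∈ (pref p n T M e).overlap c :=
    ⟨coord_mem hm, by rwa [param_coord hm]⟩
  rw [S.acomp_change hm he, acomp_cartanFun_pref, coord_change hm he, compL_change hm he]
  -- The definition uses the preferred chart at `e`; `covLoc_change` carries the value to `c`.
  refine (S.covLoc_change ho (S.arep_differentiableAt hm hY) ?_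
    (fun s hs => S.arep_change hs Y) _).symm
  rw [← coord_change hm he]
  exact S.arep_differentiableAt he hY

theorem acomp_cartanFun_eq {e : J1 p n T M} (he : e ∈ c.source)
    {Y : ∀ e : J1 p n T M, TangentSpace (jetI p n) e} (hY : DiffFieldAt Y e)
    (v : TangentSpace (jetI p n) e) :
    S.acomp c e (S.cartanFun Y e v) = fderiv ℝ (S.arep c Y) (c.coord e) (c.compL e v)
      + S.connForm c (c.coord e) (S.acomp c e v) (S.acomp c e (Y e)) := by
  rw [S.acomp_cartanFun he hY, covLoc_apply, S.acomp_eq_arep he]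
  rfl

theorem arep_add (Y Z : ∀ e : J1 p n T M, TangentSpace (jetI p n) e) :
    S.arep c (Y + Z) = S.arep c Y + S.arep c Z := by
  funext y
  exact (congrArg (S.adapt c y) (map_add (c.compL (c.param y)) (Y (c.param y))
    (Z (c.param y)))).trans (map_add (S.adapt c y) _ _)

theorem arep_smul (g : J1 p n T M → ℝ) (Y : ∀ e : J1 p n T M, TangentSpace (jetI p n) e) :
    S.arep c (g • Y) = fun y => g (c.param y) • S.arep c Y y := by
  funext y
  exact (congrArg (S.adapt c y) (map_smul (c.compL (c.param y)) (g (c.param y))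
    (Y (c.param y)))).trans (map_smul (S.adapt c y) _ _)

theorem covLoc_add {Z Z' : JetModel p n → JetModel p n} (hZ : DifferentiableAt ℝ Z y)
    (hZ' : DifferentiableAt ℝ Z' y) (w : JetModel p n) :
    S.covLoc c (Z + Z') y w = S.covLoc c Z y w + S.covLoc c Z' y w := by
  rw [covLoc_apply, covLoc_apply, covLoc_apply, fderiv_add hZ hZ', Pi.add_apply, map_add, add_apply]
  abel

theorem covLoc_smul {Z : JetModel p n → JetModel p n} {g : JetModel p n → ℝ}
    (hZ : DifferentiableAt ℝ Z y) (hg : DifferentiableAt ℝ g y) (w : JetModel p n) :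
    S.covLoc c (fun y => g y • Z y) y w = g y • S.covLoc c Z y w + fderiv ℝ g y w • Z y := by
  rw [covLoc_apply, covLoc_apply, fderiv_fun_smul hg hZ, map_smul, smul_add]
  simp only [add_apply, smul_apply, ContinuousLinearMap.smulRight_apply]
  abel

theorem cartanFun_add {Y Z : ∀ e : J1 p n T M, TangentSpace (jetI p n) e} {e : J1 p n T M}
    (hY : DiffFieldAt Y e) (hZ : DiffFieldAt Z e) (hYZ : DiffFieldAt (Y + Z) e)
    (v : TangentSpace (jetI p n) e) :
    S.cartanFun (Y + Z) e v = S.cartanFun Y e v + S.cartanFun Z e v := by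
  have hm := mem_pref e
  -- The local formula holds in every chart around `e`, so the preferred chart may be replaced by an
  -- arbitrary one.
  generalize pref p n T M e = c at hm
  refine S.acomp_injective hm (Eq.trans ?_
    (map_add (S.acomp c e) (S.cartanFun Y e v) (S.cartanFun Z e v)).symm)
  have e1 := S.acomp_cartanFun hm hYZ v
  rw [S.arep_add, S.covLoc_add (S.arep_differentiableAt hm hY) (S.arep_differentiableAt hm hZ),
    ← S.acomp_cartanFun hm hY, ← S.acomp_cartanFun hm hZ] at e1
  exact e1

/-- The derivative of a function in the direction of a tangent vector. -/
def dirDeriv (g : J1 p n T M → ℝ) (e : J1 p n T M) (v : TangentSpace (jetI p n) e) : ℝ :=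
  mfderiv (jetI p n) 𝓘(ℝ, ℝ) g e v

theorem dirDeriv_eq_fderiv {e : J1 p n T M} (he : e ∈ c.source) {g : J1 p n T M → ℝ}
    (hg : MDifferentiableAt (jetI p n) 𝓘(ℝ, ℝ) g e) :
    DifferentiableAt ℝ (fun y => g (c.param y)) (c.coord e) ∧ ∀ v : TangentSpace (jetI p n) e,
      dirDeriv g e v
        = fderiv ℝ (fun y => g (c.param y)) (c.coord e) (c.compL e v) := by
  have h1 : MDifferentiableAt 𝓘(ℝ, JetModel p n) 𝓘(ℝ, ℝ) (fun y => g (c.param y)) (c.coord e) := by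
    rw [← param_coord he] at hg
    exact hg.comp _ (mdifferentiableAt_param (coord_mem he))
  refine ⟨h1.differentiableAt, fun v => ?_⟩
  have h2 := h1.differentiableAt.hasFDerivAt.hasMFDerivAt
  have h3 := (h2.comp e (mdifferentiableAt_coord he).hasMFDerivAt).mfderiv
  have k : ((fun y => g (c.param y)) ∘ c.coord) =ᶠ[𝓝 e] g := by
    filter_upwards [c.isOpen_source.mem_nhds he] with z hz
    exact congrArg g (param_coord hz)
  rw [k.mfderiv_eq] at h3
  exact congrArg (fun f => f v) h3

theorem cartanFun_leibniz {Y : ∀ e : J1 p n T M, TangentSpace (jetI p n) e} {g : J1 p n T M → ℝ}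
    {e : J1 p n T M} (hY : DiffFieldAt Y e) (hg : MDifferentiableAt (jetI p n) 𝓘(ℝ, ℝ) g e)
    (hgY : DiffFieldAt (g • Y) e) (v : TangentSpace (jetI p n) e) :
    S.cartanFun (g • Y) e v = g e • S.cartanFun Y e v
      + dirDeriv g e v • Y e := by
  have hm := mem_pref e
  generalize pref p n T M e = c at hm
  obtain ⟨hd, hv⟩ := dirDeriv_eq_fderiv hm hg
  refine S.acomp_injective hm (Eq.trans ?_
    (map_add (S.acomp c e) (g e • S.cartanFun Y e v) (dirDeriv g e v • Y e)).symm)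
  have e1 := S.acomp_cartanFun hm hgY v
  rw [S.arep_smul, S.covLoc_smul (S.arep_differentiableAt hm hY) hd, ← hv,
    ← S.acomp_cartanFun hm hY, ← S.acomp_eq_arep hm, param_coord hm] at e1
  refine e1.trans ?_
  exact congrArg₂ (· + ·) (map_smul (S.acomp c e) (g e) (S.cartanFun Y e v)).symm
    (map_smul (S.acomp c e) (dirDeriv g e v) (Y e)).symm

/-- The Cartan connection, as a linear connection. -/
def cartan : LinearConnection p n T M where
  toFun := S.cartanFun
  isCovariantDerivativeOnUniv :=
    { add := fun hY hZ _ => by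
        ext1 v
        exact S.cartanFun_add hY hZ (mdifferentiableAt_add_section hY hZ) v
      leibniz := fun hY hg _ => by
        ext1 v
        exact S.cartanFun_leibniz hY hg (hg.smul_section hY) v }

end LagrangeSpace
end CartanConnection

/-! ### The defining properties of the Cartan connection. -/

section Verification

variable {p n : ℕ}
  {T : Type*} [TopologicalSpace T] [ChartedSpace (Vec p) T] [IsManifold (𝓡 p) ∞ T]
  {M : Type*} [TopologicalSpace M] [ChartedSpace (Vec n) M] [IsManifold (𝓡 n) ∞ M]

namespace LagrangeSpace

variable {h : SemiRiemannianMetric p T} (S : LagrangeSpace n M h) {c c' : JetChart p n T M}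
  {y : JetModel p n} {e : J1 p n T M}

open JetChart

/-- The vector field with given adapted components. -/
def alift (c : JetChart p n T M) (Z : JetModel p n → JetModel p n) :
    ∀ e : J1 p n T M, TangentSpace (jetI p n) e := c.lift fun y => S.unadapt c y (Z y)

theorem acomp_alift (he : e ∈ c.source) (Z : JetModel p n → JetModel p n) :
    S.acomp c e (S.alift c Z e) = Z (c.coord e) :=
  (congrArg (S.adapt c (c.coord e)) (compL_lift he _)).trans (S.adapt_unadapt _)

theorem unadapt_differentiableAt (hy : y ∈ c.target) {Z : JetModel p n → JetModel p n}
    (hZ : DifferentiableAt ℝ Z y) : DifferentiableAt ℝ (fun y => S.unadapt c y (Z y)) y := by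
  have hT : ∀ i α β, DifferentiableAt ℝ (S.temporal c i α β) y := fun i α β =>
    (S.temporal_contDiffAt hy i α β).differentiableAt (by simp)
  have hX : ∀ i α j, DifferentiableAt ℝ (S.spatial c i α j) y := fun i α j =>
    (S.spatial_contDiffAt hy i α j).differentiableAt (by simp)
  have hA : ∀ a : JetModel p n → Fin n → Fin p → ℝ,
      (∀ i α, DifferentiableAt ℝ (fun y => a y i α) y) →
      DifferentiableAt ℝ (fun y => vertSum (a y)) y := fun a ha =>
    DifferentiableAt.fun_sum fun i _ => DifferentiableAt.fun_sum fun α _ =>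
      (ha i α).smul_const (vertUnit i α)
  refine hZ.fst.prodMk ((hZ.snd.sub (hA _ fun i α => ?_)).sub (hA _ fun i α => ?_))
  · exact DifferentiableAt.fun_sum fun β _ => (hT i α β).mul
        (differentiableAt_euclidean.1 hZ.fst.fst β)
  · exact DifferentiableAt.fun_sum fun j _ => (hX i α j).mul
        (differentiableAt_euclidean.1 hZ.fst.snd j)

theorem diffFieldAt_of_arep (he : e ∈ c.source) {Y : ∀ e : J1 p n T M, TangentSpace (jetI p n) e}
    {Z : JetModel p n → JetModel p n} (hZ : DifferentiableAt ℝ Z (c.coord e))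
    (hY : ∀ e ∈ c.source, S.acomp c e (Y e) = Z (c.coord e)) : DiffFieldAt Y e := by
  refine diffFieldAt_congr (Y := S.alift c Z)
    (diffFieldAt_lift he (S.unadapt_differentiableAt (coord_mem he) hZ)) ?_
  filter_upwards [c.isOpen_source.mem_nhds he] with e' he'
  exact S.acomp_injective he' ((hY e' he').trans (S.acomp_alift he' Z).symm)

/-- The Cartan connection on a vector field given by its adapted components. -/
theorem acomp_cartan (he : e ∈ c.source) {Y : ∀ e : J1 p n T M, TangentSpace (jetI p n) e}
    {Z : JetModel p n → JetModel p n} (hZ : DifferentiableAt ℝ Z (c.coord e))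
    (hY : ∀ e ∈ c.source, S.acomp c e (Y e) = Z (c.coord e)) (v : TangentSpace (jetI p n) e) :
    S.acomp c e (S.cartan Y e v) = fderiv ℝ Z (c.coord e) (c.compL e v)
      + S.connForm c (c.coord e) (S.acomp c e v) (Z (c.coord e)) := by
  have h1 := S.acomp_cartanFun_eq he (S.diffFieldAt_of_arep he hZ hY) v
  have k : S.arep c Y =ᶠ[𝓝 (c.coord e)] Z := by
    filter_upwards [c.isOpen_target.mem_nhds (coord_mem he)] with y hy
    rw [← coord_param hy, ← S.acomp_eq_arep (param_mem hy), hY _ (param_mem hy), coord_param hy]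
  rw [k.fderiv_eq, hY e he] at h1
  exact h1

theorem unadapt_timeL (γ : Fin p) : S.unadapt c y (timeL (bv γ))
    = ((bv γ, 0), -∑ i, ∑ α, S.temporal c i α γ y • vertUnit i α) := by
  refine jet_ext rfl rfl (vert_ext fun i α => ?_)
  change (0 - S.temporalL c y (bv γ) - S.spatialL c y 0) (bv α) i = (-vertSum _) (bv α) i
  rw [map_zero, sub_zero, zero_sub]
  change -(S.temporalL c y (bv γ) (bv α) i) = -(vertSum _ (bv α) i)
  rw [temporalL_bv, vertSum_bv]
  simp

theorem unadapt_spaceL (k : Fin n) : S.unadapt c y (spaceL (bv k))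
    = ((0, bv k), -∑ i, ∑ α, S.spatial c i α k y • vertUnit i α) := by
  refine jet_ext rfl rfl (vert_ext fun i α => ?_)
  change (0 - S.temporalL c y 0 - S.spatialL c y (bv k)) (bv α) i = (-vertSum _) (bv α) i
  rw [map_zero, sub_zero, zero_sub]
  change -(S.spatialL c y (bv k) (bv α) i) = -(vertSum _ (bv α) i)
  rw [spatialL_bv, vertSum_bv]
  simp

/-- The adapted frame fields have constant adapted components, so their covariant derivatives are
given by the connection form alone; all coefficients are read off this way. -/
theorem frameT_eq (γ : Fin p) : S.frameT c γ = S.alift c fun _ => timeL (bv γ) := by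
  rw [alift, show (fun y => S.unadapt c y (timeL (bv γ))) = _ from
    funext fun y => S.unadapt_timeL γ]
  rfl

theorem frameX_eq (k : Fin n) : S.frameX c k = S.alift c fun _ => spaceL (bv k) := by
  rw [alift, show (fun y => S.unadapt c y (spaceL (bv k))) = _ from
    funext fun y => S.unadapt_spaceL k]
  rfl

theorem frameV_eq (i : Fin n) (α : Fin p) : c.frameV i α = S.alift c fun _ => vertL (vertUnit i α) := by
  rw [alift, show (fun y => S.unadapt c y (vertL (vertUnit i α))) = _ from
    funext fun y => S.unadapt_vert (vertUnit i α)]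
  rfl

theorem acomp_frameT (he : e ∈ c.source) (γ : Fin p) :
    S.acomp c e (S.frameT c γ e) = timeL (bv γ) := by
  rw [frameT_eq, S.acomp_alift he]

theorem acomp_frameX (he : e ∈ c.source) (k : Fin n) :
    S.acomp c e (S.frameX c k e) = spaceL (bv k) := by
  rw [frameX_eq, S.acomp_alift he]

theorem acomp_frameV (he : e ∈ c.source) (i : Fin n) (α : Fin p) :
    S.acomp c e (c.frameV i α e) = vertL (vertUnit i α) := by
  rw [S.frameV_eq, S.acomp_alift he]

theorem coframeT_eq (α : Fin p) (v : TangentSpace (jetI p n) e) :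
    c.coframeT α e v = (S.acomp c e v).1.1 α := rfl

theorem coframeX_eq (i : Fin n) (v : TangentSpace (jetI p n) e) :
    c.coframeX i e v = (S.acomp c e v).1.2 i := rfl

theorem coframeV_eq (i : Fin n) (α : Fin p) (v : TangentSpace (jetI p n) e) :
    S.coframeV c i α e v = (S.acomp c e v).2 (bv α) i := by
  rw [acomp_apply]
  change _ = (c.compL e v).2 (bv α) i + S.temporalL c (c.coord e) (c.compL e v).1.1 (bv α) i
    + S.spatialL c (c.coord e) (c.compL e v).1.2 (bv α) i
  rw [temporalL_bv, spatialL_bv]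
  rfl

theorem acomp_sum {ι : Type*} (s : Finset ι) (a : ι → ℝ) (F : ι → TangentSpace (jetI p n) e) :
    S.acomp c e (∑ i ∈ s, a i • F i) = ∑ i ∈ s, a i • S.acomp c e (F i) := by
  rw [map_sum]
  exact Finset.sum_congr rfl fun i _ => map_smul (S.acomp c e) (a i) (F i)

/-- The temporal projection. -/
def prT : JetModel p n →L[ℝ] JetModel p n :=
  (ContinuousLinearMap.inl ℝ (Vec p × Vec n) (Vec p →L[ℝ] Vec n) ∘L
    ContinuousLinearMap.inl ℝ (Vec p) (Vec n)) ∘L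
  (ContinuousLinearMap.fst ℝ (Vec p) (Vec n) ∘L
    ContinuousLinearMap.fst ℝ (Vec p × Vec n) (Vec p →L[ℝ] Vec n))

/-- The spatial projection. -/
def prX : JetModel p n →L[ℝ] JetModel p n :=
  (ContinuousLinearMap.inl ℝ (Vec p × Vec n) (Vec p →L[ℝ] Vec n) ∘L
    ContinuousLinearMap.inr ℝ (Vec p) (Vec n)) ∘L
  (ContinuousLinearMap.snd ℝ (Vec p) (Vec n) ∘L
    ContinuousLinearMap.fst ℝ (Vec p × Vec n) (Vec p →L[ℝ] Vec n))

/-- The vertical projection. -/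
def prV : JetModel p n →L[ℝ] JetModel p n :=
  ContinuousLinearMap.inr ℝ (Vec p × Vec n) (Vec p →L[ℝ] Vec n) ∘L
    ContinuousLinearMap.snd ℝ (Vec p × Vec n) (Vec p →L[ℝ] Vec n)

theorem prT_apply (w : JetModel p n) : prT w = timeL w.1.1 := rfl

theorem prX_apply (w : JetModel p n) : prX w = spaceL w.1.2 := rfl

theorem prV_apply (w : JetModel p n) : prV w = vertL w.2 := rfl

theorem acomp_projT (he : e ∈ c.source) (v : TangentSpace (jetI p n) e) :
    S.acomp c e (S.projT c e v) = prT (S.acomp c e v) := by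
  rw [projT, acomp_sum, prT_apply, map_eq_sum timeL]
  exact Finset.sum_congr rfl fun α _ => by rw [S.acomp_frameT he, S.coframeT_eq]

theorem acomp_projX (he : e ∈ c.source) (v : TangentSpace (jetI p n) e) :
    S.acomp c e (S.projX c e v) = prX (S.acomp c e v) := by
  rw [projX, acomp_sum, prX_apply, map_eq_sum spaceL]
  exact Finset.sum_congr rfl fun α _ => by rw [S.acomp_frameX he, S.coframeX_eq]

theorem acomp_projV (he : e ∈ c.source) (v : TangentSpace (jetI p n) e) :
    S.acomp c e (S.projV c e v) = prV (S.acomp c e v) := by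
  rw [projV, map_sum, prV_apply, hom_eq_sum (S.acomp c e v).2, map_sum]
  refine Finset.sum_congr rfl fun i _ => ?_
  rw [acomp_sum, map_sum]
  refine Finset.sum_congr rfl fun α _ => ?_
  rw [S.acomp_frameV he, S.coframeV_eq, map_smul]

/-- In adapted components `J` takes a temporal `a` and a spatial `u` to `u ⊗ a♭`, independently of
the other components. -/
theorem acomp_normalization (he : e ∈ c.source) (v w : TangentSpace (jetI p n) e) :
    S.acomp c e (normalization h c e v w)
      = vertL (rk (S.acomp c e w).1.2 (h.flat c.time (c.coord e).1.1 (S.acomp c e v).1.1)) := by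
  rw [normalization, map_sum, hom_eq_sum (rk _ _), map_sum]
  refine Finset.sum_congr rfl fun i _ => ?_
  rw [map_sum, map_sum]
  refine Finset.sum_congr rfl fun α _ => ?_
  rw [acomp_sum, S.acomp_frameV he, ← Finset.sum_smul, map_smul]
  congr 1
  rw [rk_apply, PiLp.smul_apply, smul_eq_mul, h.flat_apply,
    bil_symm (fun i j => h.lo_symm c.time i j _), bil_bv_left, Finset.sum_mul]
  rfl

/-- In adapted components `P` is a constant linear map, hence commutes with differentiation; it then
suffices that it commutes with the connection form. Applied to the three projections. -/
theorem cartan_comm (he : e ∈ c.source) (P : ∀ e : J1 p n T M, TangentSpace (jetI p n) e →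
    TangentSpace (jetI p n) e) (A : JetModel p n →L[ℝ] JetModel p n)
    (hP : ∀ e ∈ c.source, ∀ v, S.acomp c e (P e v) = A (S.acomp c e v))
    (hA : ∀ y w z, S.connForm c y w (A z) = A (S.connForm c y w z))
    {Y : ∀ e : J1 p n T M, TangentSpace (jetI p n) e} (hY : DiffFieldAt Y e)
    (v : TangentSpace (jetI p n) e) :
    S.cartan (fun e' => P e' (Y e')) e v = P e (S.cartan Y e v) := by
  have hd := S.arep_differentiableAt he hY
  refine S.acomp_injective he ?_
  rw [hP e he, S.acomp_cartan he hd (fun e' he' => S.acomp_eq_arep he' Y) v,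
    S.acomp_cartan he (Z := fun y => A (S.arep c Y y)) (A.differentiableAt.comp _ hd)
      (fun e' he' => by rw [hP e' he', S.acomp_eq_arep he']) v, map_add, hA]
  congr 1
  exact congrArg (fun f => f (c.compL e v)) (A.hasFDerivAt.comp _ hd.hasFDerivAt).fderiv

theorem connForm_prT (w z : JetModel p n) :
    S.connForm c y w (prT z) = prT (S.connForm c y w z) := by
  refine jet_ext rfl ?_ ?_
  · exact map_zero (S.omega c y w)
  · ext1 ζ
    rw [connForm_vert]
    change S.omega c y w 0 - 0 = 0
    simp

theorem connForm_prX (w z : JetModel p n) :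
    S.connForm c y w (prX z) = prX (S.connForm c y w z) := by
  refine jet_ext ?_ rfl ?_
  · exact map_zero (h.chr c.time y.1.1 w.1.1)
  · ext1 ζ
    rw [connForm_vert]
    change S.omega c y w 0 - 0 = 0
    simp

theorem connForm_prV (w z : JetModel p n) :
    S.connForm c y w (prV z) = prV (S.connForm c y w z) :=
  jet_ext (map_zero (h.chr c.time y.1.1 w.1.1)) (map_zero (S.omega c y w)) rfl

theorem acomp_cartan_alift_const (he : e ∈ c.source) (z : JetModel p n)
    (v : TangentSpace (jetI p n) e) :
    S.acomp c e (S.cartan (S.alift c fun _ => z) e v)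
      = S.connForm c (c.coord e) (S.acomp c e v) z := by
  rw [S.acomp_cartan he (differentiableAt_const z) (fun e' he' => S.acomp_alift he' _) v]
  simp

section

variable {a : JetModel p n → Vec p} {u : JetModel p n → Vec n}

theorem flat_bv (φ : OpenPartialHomeomorph T (Vec p)) (s b : Vec p) (α : Fin p) :
    h.flat φ s b (bv α) = ∑ β, h.lo φ β α s * b β := bil_bv_right _ b α

theorem time_lo_differentiableAt (hy : y ∈ c.target) (α β : Fin p) :
    DifferentiableAt ℝ (fun y : JetModel p n => h.lo c.time α β y.1.1) y :=
  (time_lo_contDiffAt hy α β).differentiableAt (by simp)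

theorem rk_flat_differentiableAt (hy : y ∈ c.target) (ha : DifferentiableAt ℝ a y)
    (hu : DifferentiableAt ℝ u y) :
    DifferentiableAt ℝ (fun y => rk (u y) (h.flat c.time y.1.1 (a y))) y := by
  have e1 : (fun y => rk (u y) (h.flat c.time y.1.1 (a y)))
      = fun y => ∑ i, ∑ α, ((∑ β, h.lo c.time β α y.1.1 * a y β) * u y i) • vertUnit i α := by
    funext y
    rw [hom_eq_sum (rk _ _)]
    refine Finset.sum_congr rfl fun i _ => Finset.sum_congr rfl fun α _ => ?_
    rw [rk_apply, flat_bv]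
    rfl
  rw [e1]
  exact DifferentiableAt.fun_sum fun i _ => DifferentiableAt.fun_sum fun α _ =>
    ((DifferentiableAt.fun_sum fun β _ => (time_lo_differentiableAt hy β α).mul
      (differentiableAt_euclidean.1 ha β)).mul (differentiableAt_euclidean.1 hu i)).smul_const _

/-- The product rule for `u ⊗ a♭`, where the metric that lowers the index also varies, with the
temporal coordinates only. -/
theorem fderiv_rk_flat (hy : y ∈ c.target) (ha : DifferentiableAt ℝ a y)
    (hu : DifferentiableAt ℝ u y) (w : JetModel p n) (ζ : Vec p) :
    fderiv ℝ (fun y => rk (u y) (h.flat c.time y.1.1 (a y))) y w ζ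
      = (bil (fun α β => fderiv ℝ (h.lo c.time α β) y.1.1 w.1.1) (a y) ζ
          + bil (fun α β => h.lo c.time α β y.1.1) (fderiv ℝ a y w) ζ) • u y
        + bil (fun α β => h.lo c.time α β y.1.1) (a y) ζ • fderiv ℝ u y w := by
  have h1 := (rk_flat_differentiableAt (h := h) hy ha hu).hasFDerivAt.clm_apply
    (hasFDerivAt_const ζ y)
  have hb : DifferentiableAt ℝ
      (fun y : JetModel p n => bil (fun α β => h.lo c.time α β y.1.1) (a y) ζ) y := by
    simp only [bil_apply]
    exact DifferentiableAt.fun_sum fun i _ => DifferentiableAt.fun_sum fun j _ =>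
      (time_lo_differentiableAt hy i j).mul ((differentiableAt_euclidean.1 ha i).mul_const _)
  have h2 := hb.hasFDerivAt.smul hu.hasFDerivAt
  have h3 := congrArg (fun f => f w) (h1.unique h2)
  have h4 := bil_fderiv (a := fun α β (y : JetModel p n) => h.lo c.time α β y.1.1) (U := a)
    (V := fun _ => ζ) (fun i j => time_lo_differentiableAt hy i j) ha (differentiableAt_const ζ) w
  have h5 : ∀ α β, fderiv ℝ (fun y : JetModel p n => h.lo c.time α β y.1.1) y w
      = fderiv ℝ (h.lo c.time α β) y.1.1 w.1.1 := by
    intro α β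
    have k := (((h.lo_contDiffAt c.time_mem hy.1 α β).differentiableAt
      (by simp)).hasFDerivAt.comp y ((ContinuousLinearMap.fst ℝ (Vec p) (Vec n) ∘L
        ContinuousLinearMap.fst ℝ (Vec p × Vec n) (Vec p →L[ℝ] Vec n))).hasFDerivAt).fderiv
    exact congrArg (fun f => f w) k
  simp only [ContinuousLinearMap.comp_zero, zero_add, add_apply, ContinuousLinearMap.flip_apply,
    smul_apply, ContinuousLinearMap.smulRight_apply] at h3
  rw [h3, h4, add_comm]
  simp [h5]

end

/-- The pointwise algebra behind `∇J = 0`. The hypothesis `hr` is the metricity of the Christoffel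
symbols: its second term cancels the action on the covector factor, and its first supplies the
covariant derivative of the temporal field. -/
theorem rk_flat_parallel (φ : OpenPartialHomeomorph T (Vec p)) {s a a' b ζ ζ' : Vec p}
    {u u' : Vec n} {A : Vec n →ₗ[ℝ] Vec n} {r : ℝ}
    (hr : r = bil (fun α β => h.lo φ α β s) b ζ + bil (fun α β => h.lo φ α β s) a ζ') :
    ((r + bil (fun α β => h.lo φ α β s) a' ζ) • u
      + bil (fun α β => h.lo φ α β s) a ζ • u')
      + (A (rk u (h.flat φ s a) ζ) - rk u (h.flat φ s a) ζ')
    = (rk u (h.flat φ s (a' + b)) + rk (u' + A u) (h.flat φ s a)) ζ := by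
  rw [hr]
  simp only [add_apply, rk_apply, h.flat_apply, map_add, LinearMap.add_apply, map_smul, add_smul,
    smul_add]
  abel

theorem cartan_nablaJ (he : e ∈ c.source) {X Y : ∀ e : J1 p n T M, TangentSpace (jetI p n) e}
    (hX : DiffFieldAt X e) (hY : DiffFieldAt Y e) (v : TangentSpace (jetI p n) e) :
    S.cartan (fun e' => normalization h c e' (X e') (Y e')) e v
      = normalization h c e (S.cartan X e v) (Y e) + normalization h c e (X e) (S.cartan Y e v) := by
  have dX := S.arep_differentiableAt he hX
  have dY := S.arep_differentiableAt he hY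
  have hm := coord_mem he
  have hX1 : DifferentiableAt ℝ (fun y => (S.arep c X y).1.1) (c.coord e) := dX.fst.fst
  have hY1 : DifferentiableAt ℝ (fun y => (S.arep c Y y).1.2) (c.coord e) := dY.fst.snd
  have hb := rk_flat_differentiableAt (h := h) hm hX1 hY1
  have hd : HasFDerivAt (fun y : JetModel p n => (vertL (rk (S.arep c Y y).1.2
      (h.flat c.time y.1.1 (S.arep c X y).1.1)) : JetModel p n))
      (ContinuousLinearMap.inr ℝ (Vec p × Vec n) (Vec p →L[ℝ] Vec n) ∘L fderiv ℝ
        (fun y => rk (S.arep c Y y).1.2 (h.flat c.time y.1.1 (S.arep c X y).1.1)) (c.coord e))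
      (c.coord e) :=
    (ContinuousLinearMap.inr ℝ (Vec p × Vec n) (Vec p →L[ℝ] Vec n)).hasFDerivAt.comp _
      hb.hasFDerivAt
  refine S.acomp_injective he (Eq.trans ?_ (map_add (S.acomp c e) (normalization h c e
    (S.cartan X e v) (Y e)) (normalization h c e (X e) (S.cartan Y e v))).symm)
  rw [S.acomp_cartan he hd.differentiableAt (fun e' he' => by
      rw [S.acomp_normalization he', S.acomp_eq_arep he', S.acomp_eq_arep he']) v, hd.fderiv,
    S.acomp_normalization he, S.acomp_normalization he,
    S.acomp_cartan he dX (fun e' he' => S.acomp_eq_arep he' X) v,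
    S.acomp_cartan he dY (fun e' he' => S.acomp_eq_arep he' Y) v,
    S.acomp_eq_arep he, S.acomp_eq_arep he, ← map_add]
  have hfd := fderiv_rk_flat (h := h) hm hX1 hY1 (c.compL e v)
  have hw : (S.acomp c e v).1.1 = (c.compL e v).1.1 := rfl
  have fX : (fderiv ℝ (fun y => (S.arep c X y).1.1) (c.coord e)) (c.compL e v)
      = (fderiv ℝ (S.arep c X) (c.coord e) (c.compL e v)).1.1 :=
    congrArg (fun f => f (c.compL e v)) dX.hasFDerivAt.fst.fst.fderiv
  have fY : (fderiv ℝ (fun y => (S.arep c Y y).1.2) (c.coord e)) (c.compL e v)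
      = (fderiv ℝ (S.arep c Y) (c.coord e) (c.compL e v)).1.2 :=
    congrArg (fun f => f (c.compL e v)) dY.hasFDerivAt.fst.snd.fderiv
  refine jet_ext ?_ ?_ ?_
  · rw [Prod.fst_add, Prod.fst_add, connForm_time]
    change (0 : Vec p) + h.chr c.time _ _ 0 = 0
    simp
  · rw [Prod.fst_add, Prod.snd_add, connForm_space]
    change (0 : Vec n) + S.omega c _ _ 0 = 0
    simp
  · ext1 ζ
    -- Metricity of `h` in the temporal direction of `v`, with the symbols rearranged so that this
    -- direction comes first, as in `connForm`.
    have hmet := h.chr_metrical c.time_mem hm.1 (S.arep c X (c.coord e)).1.1 ζ (c.compL e v).1.1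
    rw [h.chr_symm _ (S.arep c X (c.coord e)).1.1, h.chr_symm _ ζ] at hmet
    have h1 := hfd ζ
    rw [fX, fY] at h1
    refine (congrArg₂ (· + ·) h1 (S.connForm_vert (c := c) (y := c.coord e)
      (S.acomp c e v) (vertL (rk (S.arep c Y (c.coord e)).1.2
        (h.flat c.time (c.coord e).1.1 (S.arep c X (c.coord e)).1.1))) ζ)).trans ?_
    exact rk_flat_parallel c.time hmet

theorem coeffG_cartan (he : e ∈ c.source) (k i : Fin n) (γ : Fin p) :
    S.coeffG S.cartan c k i γ e = S.cartanG c (c.coord e) k i γ := by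
  rw [coeffG, S.coframeX_eq, S.frameX_eq, S.acomp_cartan_alift_const he, S.acomp_frameT he,
    connForm_space, S.omega_timeL]
  exact bilV_bv _ _ _ _

theorem coeffL_cartan (he : e ∈ c.source) (k i j : Fin n) :
    S.coeffL S.cartan c k i j e = S.cartanL c (c.coord e) k i j := by
  rw [coeffL, S.coframeX_eq, S.frameX_eq i, S.acomp_cartan_alift_const he, S.acomp_frameX he, connForm_space, S.omega_spaceL]
  exact bilV_bv _ _ _ _

theorem coeffC_cartan (he : e ∈ c.source) (k i j : Fin n) (γ : Fin p) :
    S.coeffC S.cartan c k i j γ e = S.cartanC c (c.coord e) γ k i j := by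
  rw [coeffC, S.coframeX_eq, S.frameX_eq, S.acomp_cartan_alift_const he,
    S.acomp_frameV he, connForm_space, vertUnit_eq, S.omega_vertL]
  simp
  exact bilV_bv _ _ _ _

theorem gbar_cartan (he : e ∈ c.source) (α β γ : Fin p) :
    S.coeffGbar S.cartan c α β γ e = h.christoffel c.time α β γ (c.time e.1.1) := by
  rw [coeffGbar, S.coframeT_eq, S.frameT_eq β, S.acomp_cartan_alift_const he, S.acomp_frameT he,
    connForm_time]
  change h.chr c.time (c.time e.1.1) (bv γ) (bv β) α = _
  -- The connection form takes the direction first, the coefficient convention takes it last; the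
  -- symmetry of the Christoffel symbols reconciles them.
  rw [h.chr_symm]
  exact bilV_bv _ _ _ _

theorem lbar_cartan (he : e ∈ c.source) (α β : Fin p) (j : Fin n) :
    S.coeffLbar S.cartan c α β j e = 0 := by
  rw [coeffLbar, S.coframeT_eq, S.frameT_eq β, S.acomp_cartan_alift_const he, S.acomp_frameX he,
    connForm_time]
  change h.chr c.time (c.time e.1.1) 0 (bv β) α = _
  simp

theorem cbar_cartan (he : e ∈ c.source) (α β : Fin p) (j : Fin n) (γ : Fin p) :
    S.coeffCbar S.cartan c α β j γ e = 0 := by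
  rw [coeffCbar, S.coframeT_eq, S.frameT_eq β, S.acomp_cartan_alift_const he, S.acomp_frameV he,
    connForm_time]
  change h.chr c.time (c.time e.1.1) 0 (bv β) α = _
  simp

theorem deltaX_lo_symm (i j k : Fin n) :
    S.deltaX c k (S.lo c i j) y = S.deltaX c k (S.lo c j i) y := by
  rw [show S.lo c i j = S.lo c j i from funext fun z => S.lo_symm c i j z]

theorem dV_lo_symm (i j k : Fin n) (γ : Fin p) :
    dV k γ (S.lo c i j) y = dV k γ (S.lo c j i) y := by
  rw [show S.lo c i j = S.lo c j i from funext fun z => S.lo_symm c i j z]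

theorem gCovX_cartan (he : e ∈ c.source) (i j k : Fin n) : S.gCovX S.cartan c i j k e = 0 := by
  have e1 := koszul_metrical (fun i j => S.lo_symm c i j (c.coord e)) (S.lo_mul_up (coord_mem he))
    (fun i j k => S.deltaX_lo_symm (c := c) (y := c.coord e) i j k) i j k
  rw [gCovX]
  simp only [S.coeffL_cartan he, cartanL]
  linarith

theorem gCovV_cartan (he : e ∈ c.source) (i j k : Fin n) (γ : Fin p) :
    S.gCovV S.cartan c i j k γ e = 0 := by
  have e1 := koszul_metrical (fun i j => S.lo_symm c i j (c.coord e)) (S.lo_mul_up (coord_mem he))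
    (fun i j k => S.dV_lo_symm (c := c) (y := c.coord e) i j k γ) i j k
  rw [gCovV]
  simp only [S.coeffC_cartan he, cartanC]
  linarith

theorem cartan_projT (he : e ∈ c.source) {Y : ∀ e : J1 p n T M, TangentSpace (jetI p n) e}
    (hY : DiffFieldAt Y e) (v : TangentSpace (jetI p n) e) :
    S.cartan (fun e' => S.projT c e' (Y e')) e v = S.projT c e (S.cartan Y e v) := by
  refine S.cartan_comm (P := S.projT c) (A := prT) he ?_ ?_ hY v
  · exact fun _ he' w => S.acomp_projT he' w
  · exact fun _ w z => S.connForm_prT w z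

theorem cartan_projX (he : e ∈ c.source) {Y : ∀ e : J1 p n T M, TangentSpace (jetI p n) e}
    (hY : DiffFieldAt Y e) (v : TangentSpace (jetI p n) e) :
    S.cartan (fun e' => S.projX c e' (Y e')) e v = S.projX c e (S.cartan Y e v) := by
  refine S.cartan_comm (P := S.projX c) (A := prX) he ?_ ?_ hY v
  · exact fun _ he' w => S.acomp_projX he' w
  · exact fun _ w z => S.connForm_prX w z

theorem cartan_projV (he : e ∈ c.source) {Y : ∀ e : J1 p n T M, TangentSpace (jetI p n) e}
    (hY : DiffFieldAt Y e) (v : TangentSpace (jetI p n) e) :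
    S.cartan (fun e' => S.projV c e' (Y e')) e v = S.projV c e (S.cartan Y e v) := by
  refine S.cartan_comm (P := S.projV c) (A := prV) he ?_ ?_ hY v
  · exact fun _ he' w => S.acomp_projV he' w
  · exact fun _ w z => S.connForm_prV w z

theorem isCartan_cartan
    (hs : CovariantDerivative.ContMDiffCovariantDerivative (S.cartan) ∞) : S.IsCartan S.cartan where
  smooth := hs
  projT _ _ he _ hY v := S.cartan_projT he hY v
  projX _ _ he _ hY v := S.cartan_projX he hY v
  projV _ _ he _ hY v := S.cartan_projV he hY v
  gbar _ _ he := S.gbar_cartan he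
  lbar _ _ he := S.lbar_cartan he
  cbar _ _ he := S.cbar_cartan he
  nablaJ _ _ he _ _ hX hY v := S.cartan_nablaJ he hX hY v
  metricalX _ _ he := S.gCovX_cartan he
  metricalV _ _ he := S.gCovV_cartan he
  timeCoeff _ _ he := S.coeffG_cartan he
  symmL c e he k i j := by
    rw [S.coeffL_cartan he, S.coeffL_cartan he]
    exact koszul_symm (fun i j k => S.deltaX_lo_symm i j k) k i j
  symmC c e he i j k γ := by
    rw [S.coeffC_cartan he, S.coeffC_cartan he]
    exact koszul_symm (fun i j k => S.dV_lo_symm i j k γ) i j k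

end LagrangeSpace
end Verification

/-! ### Smoothness of the Cartan connection. -/

section Smoothness

variable {p n : ℕ}
  {T : Type*} [TopologicalSpace T] [ChartedSpace (Vec p) T] [IsManifold (𝓡 p) ∞ T]
  {M : Type*} [TopologicalSpace M] [ChartedSpace (Vec n) M] [IsManifold (𝓡 n) ∞ M]

/-- On a finite-dimensional domain an operator is recovered by a continuous linear map from its
values on a basis, so pointwise smoothness suffices. -/
theorem contDiffAt_clm_apply {D E F : Type*} [NormedAddCommGroup D] [NormedSpace ℝ D]
    [NormedAddCommGroup E] [NormedSpace ℝ E] [NormedAddCommGroup F] [NormedSpace ℝ F]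
    [FiniteDimensional ℝ E] {f : D → E →L[ℝ] F} {y : D} {r : ℕ∞ω}
    (hf : ∀ v, ContDiffAt ℝ r (fun x => f x v) y) : ContDiffAt ℝ r f y := by
  let d := Module.finrank ℝ E
  have hd : d = Module.finrank ℝ (Fin d → ℝ) := (Module.finrank_fin_fun ℝ).symm
  let e₁ := ContinuousLinearEquiv.ofFinrankEq hd
  let e₂ := (e₁.arrowCongr (1 : F ≃L[ℝ] F)).trans (ContinuousLinearEquiv.piRing (Fin d))
  rw [← Function.id_comp f, ← e₂.symm_comp_self]
  exact e₂.symm.contDiff.contDiffAt.comp y (contDiffAt_pi.mpr fun i => hf _)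

namespace LagrangeSpace

variable {h : SemiRiemannianMetric p T} (S : LagrangeSpace n M h) {c c' : JetChart p n T M}
  {y : JetModel p n} {e : J1 p n T M}

open JetChart

theorem koszul_contDiffAt {E : Type*} [NormedAddCommGroup E] [NormedSpace ℝ E] {m : ℕ}
    {up : Fin m → Fin m → E → ℝ} {d : Fin m → Fin m → Fin m → E → ℝ} {y : E} {r : ℕ∞ω}
    (hup : ∀ i j, ContDiffAt ℝ r (up i j) y) (hd : ∀ i j k, ContDiffAt ℝ r (d i j k) y)
    (i j k : Fin m) :
    ContDiffAt ℝ r (fun y => koszul (fun i j => up i j y) (fun i j k => d i j k y) i j k) y :=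
  ContDiffAt.sum fun l _ => ((hup i l).div_const 2).mul
    (((hd j l k).add (hd k l j)).sub (hd j k l))

theorem deltaT_contDiffAt (hy : y ∈ c.target) {f : JetModel p n → ℝ} (hf : ContDiffAt ℝ ∞ f y)
    (γ : Fin p) : ContDiffAt ℝ ∞ (S.deltaT c γ f) y :=
  (dT_contDiffAt hf γ).sub (ContDiffAt.sum fun j _ => ContDiffAt.sum fun β _ =>
    (S.temporal_contDiffAt hy j β γ).mul (dV_contDiffAt hf j β))

theorem deltaX_contDiffAt (hy : y ∈ c.target) {f : JetModel p n → ℝ} (hf : ContDiffAt ℝ ∞ f y)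
    (k : Fin n) : ContDiffAt ℝ ∞ (S.deltaX c k f) y :=
  (dX_contDiffAt hf k).sub (ContDiffAt.sum fun j _ => ContDiffAt.sum fun β _ =>
    (S.spatial_contDiffAt hy j β k).mul (dV_contDiffAt hf j β))

theorem cartanG_contDiffAt (hy : y ∈ c.target) (k i : Fin n) (γ : Fin p) :
    ContDiffAt ℝ ∞ (fun y => S.cartanG c y k i γ) y :=
  ContDiffAt.sum fun m _ => ((S.up_contDiffAt hy k m).div_const 2).mul
    (S.deltaT_contDiffAt hy (S.lo_contDiffAt hy m i) γ)

theorem cartanL_contDiffAt (hy : y ∈ c.target) (i j k : Fin n) :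
    ContDiffAt ℝ ∞ (fun y => S.cartanL c y i j k) y :=
  koszul_contDiffAt (S.up_contDiffAt hy)
    (fun i j k => S.deltaX_contDiffAt hy (S.lo_contDiffAt hy i j) k) i j k

theorem cartanC_contDiffAt (hy : y ∈ c.target) (γ : Fin p) (i j k : Fin n) :
    ContDiffAt ℝ ∞ (fun y => S.cartanC c y γ i j k) y :=
  koszul_contDiffAt (S.up_contDiffAt hy)
    (fun i j k => dV_contDiffAt (S.lo_contDiffAt hy i j) k γ) i j k

theorem omega_contDiffAt (hy : y ∈ c.target) {W : JetModel p n → JetModel p n}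
    {u : JetModel p n → Vec n} (hW : ContDiffAt ℝ ∞ W y) (hu : ContDiffAt ℝ ∞ u y) :
    ContDiffAt ℝ ∞ (fun y => S.omega c y (W y) (u y)) y := by
  simp only [omega_apply]
  exact ((bilV_contDiffAt (S.cartanG_contDiffAt hy) hu hW.fst.fst).add
    (bilV_contDiffAt (S.cartanL_contDiffAt hy) hu hW.fst.snd)).add
    (ContDiffAt.sum fun γ _ => bilV_contDiffAt (S.cartanC_contDiffAt hy γ) hu
      (hW.snd.clm_apply contDiffAt_const))

theorem chr_contDiffAt (hy : y ∈ c.target) {a b : JetModel p n → Vec p}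
    (ha : ContDiffAt ℝ ∞ a y) (hb : ContDiffAt ℝ ∞ b y) :
    ContDiffAt ℝ ∞ (fun y => h.chr c.time y.1.1 (a y) (b y)) y :=
  bilV_contDiffAt (fun γ α β => christoffel_contDiffAt hy γ α β) ha hb

theorem connForm_contDiffAt (hy : y ∈ c.target) {W Z : JetModel p n → JetModel p n}
    (hW : ContDiffAt ℝ ∞ W y) (hZ : ContDiffAt ℝ ∞ Z y) :
    ContDiffAt ℝ ∞ (fun y => S.connForm c y (W y) (Z y)) y := by
  refine ((chr_contDiffAt hy hW.fst.fst hZ.fst.fst).prodMk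
    (S.omega_contDiffAt hy hW hZ.fst.snd)).prodMk (contDiffAt_clm_apply fun ζ => ?_)
  exact (S.omega_contDiffAt hy hW (hZ.snd.clm_apply contDiffAt_const)).sub
    (hZ.snd.clm_apply (chr_contDiffAt hy hW.fst.fst contDiffAt_const))

/-- The local expression of the Cartan connection in natural components. -/
def natLoc (c : JetChart p n T M) (Z : JetModel p n → JetModel p n) (y : JetModel p n) :
    JetModel p n →L[ℝ] JetModel p n :=
  LinearMap.toContinuousLinearMap (S.unadapt c y ∘ₗ S.covLoc c Z y)

/-- The value on each fixed vector is composed of the derivative of the components and of smooth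
coefficients; infinite differentiability loses no order under differentiation. -/
theorem natLoc_contDiffAt (hy : y ∈ c.target) {Z : JetModel p n → JetModel p n}
    (hZ : ContDiffAt ℝ ∞ Z y) : ContDiffAt ℝ ∞ (S.natLoc c Z) y := by
  refine contDiffAt_clm_apply fun w => ?_
  have h1 : ContDiffAt ℝ ∞ (fun y => fderiv ℝ Z y w) y :=
    (hZ.fderiv_right (m := ∞) (by simp)).clm_apply contDiffAt_const
  have h2 : ContDiffAt ℝ ∞ (fun y => S.connForm c y (S.adapt c y w) (Z y)) y :=
    S.connForm_contDiffAt hy (S.adapt_contDiffAt hy le_rfl contDiffAt_const) hZ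
  exact S.unadapt_contDiffAt hy le_rfl (h1.add h2)

theorem compL_cartan (he : e ∈ c.source) {Y : ∀ e : J1 p n T M, TangentSpace (jetI p n) e}
    (hY : DiffFieldAt Y e) (v : TangentSpace (jetI p n) e) :
    c.compL e (S.cartan Y e v) = S.natLoc c (S.arep c Y) (c.coord e) (c.compL e v) := by
  have e1 := S.acomp_cartanFun he hY v
  exact (S.unadapt_adapt _).symm.trans (congrArg (S.unadapt c (c.coord e)) e1)

theorem _root_.MultiTime.JetChart.mem_chartAt_source (e₀ : J1 p n T M)
    (he : e ∈ (pref p n T M e₀).source) :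
    e ∈ (chartAt (ModelProd (ModelProd (Vec p) (Vec n)) (Vec p →L[ℝ] Vec n)) e₀).source := by
  rw [← extChartAt_source (jetI p n), JetChart.extChartAt_source]
  exact he

theorem _root_.MultiTime.JetChart.continuousLinearMapAt_eq (e₀ : J1 p n T M)
    (he : e ∈ (pref p n T M e₀).source) :
    (trivializationAt (JetModel p n) (TangentSpace (jetI p n) : J1 p n T M → Type _)
      e₀).continuousLinearMapAt ℝ e = (pref p n T M e₀).compL e := by
  rw [TangentBundle.continuousLinearMapAt_trivializationAt (mem_chartAt_source e₀ he)]
  refine Filter.EventuallyEq.mfderiv_eq ?_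
  filter_upwards [(pref p n T M e₀).isOpen_source.mem_nhds he] with e' he'
  exact extChartAt_eq_coord e₀ he'

theorem smooth_cartan : CovariantDerivative.ContMDiffCovariantDerivative S.cartan ∞ where
  contMDiff := ⟨by
    intro Y hY e₀ _
    refine ContMDiffAt.contMDiffWithinAt ?_
    rw [contMDiffAt_hom_bundle]
    refine ⟨contMDiffAt_id, ?_⟩
    set c := pref p n T M e₀ with hc
    have hY' : ∀ e, ContMDiffAt (jetI p n) (jetI p n).tangent ∞
        (fun e' => (⟨e', Y e'⟩ : TangentBundle (jetI p n) (J1 p n T M))) e := fun e =>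
      (hY e (Set.mem_univ e)).contMDiffAt Filter.univ_mem
    have hm : e₀ ∈ c.source := mem_pref e₀
    have h1 : ContDiffAt ℝ ∞ (S.natLoc c (S.arep c Y)) (c.coord e₀) :=
      S.natLoc_contDiffAt (coord_mem hm)
        (S.adapt_contDiffAt (coord_mem hm) le_rfl (nrep_contDiffAt hm (hY' e₀)))
    have h2 := (contMDiffAt_iff_contDiffAt.2 h1).comp e₀ (c.contMDiffAt_coord hm)
    refine h2.congr_of_eventuallyEq ?_
    filter_upwards [c.isOpen_source.mem_nhds hm] with e he
    have hb : e ∈ (trivializationAt (JetModel p n)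
        (TangentSpace (jetI p n) : J1 p n T M → Type _) e₀).baseSet := by
      rw [TangentBundle.trivializationAt_baseSet]
      exact mem_chartAt_source e₀ he
    refine ContinuousLinearMap.ext fun w => ?_
    set s := (trivializationAt (JetModel p n)
      (TangentSpace (jetI p n) : J1 p n T M → Type _) e₀).symmL ℝ e w with hs
    have h5 : ∀ v : TangentSpace (jetI p n) e, (trivializationAt (JetModel p n)
        (TangentSpace (jetI p n) : J1 p n T M → Type _) e₀).continuousLinearMapAt ℝ e v
        = c.compL e v := fun v =>
      congrArg (fun f : TangentSpace (jetI p n) e →L[ℝ] JetModel p n => f v)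
        (continuousLinearMapAt_eq e₀ he)
    have h3 : c.compL e s = w :=
      (h5 s).symm.trans (Trivialization.continuousLinearMapAt_symmL _ hb w)
    -- At a nearby point `e` the connection was defined by the preferred chart of `e`, but it has
    -- the same expression in the fixed chart `c`. Hence one smooth local formula describes it on a
    -- neighbourhood of `e₀`.
    have h4 := S.compL_cartan he ((hY' e).mdifferentiableAt (by simp)) s
    rw [h3] at h4
    exact (h5 _).trans h4⟩

end LagrangeSpace
end Smoothness

/-! ### Uniqueness through the difference tensor. -/

section Uniqueness

variable {p n : ℕ}
  {T : Type*} [TopologicalSpace T] [ChartedSpace (Vec p) T] [IsManifold (𝓡 p) ∞ T]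
  {M : Type*} [TopologicalSpace M] [ChartedSpace (Vec n) M] [IsManifold (𝓡 n) ∞ M]

theorem SemiRiemannianMetric.flat_sharp (h : SemiRiemannianMetric p T)
    {φ : OpenPartialHomeomorph T (Vec p)} (hφ : φ ∈ IsManifold.maximalAtlas (𝓡 p) ∞ T)
    {u : Vec p} (hu : u ∈ φ.target) (θ : Vec p →L[ℝ] ℝ) : h.flat φ u (h.sharp φ u θ) = θ :=
  ContinuousLinearMap.ext fun b => h.bil_sharp hφ hu θ b

namespace LagrangeSpace

variable {h : SemiRiemannianMetric p T} (S : LagrangeSpace n M h) {c c' : JetChart p n T M}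
  {y : JetModel p n} {e : J1 p n T M}

open JetChart

theorem jet_eq_add (w : JetModel p n) : w = timeL w.1.1 + spaceL w.1.2 + vertL w.2 :=
  jet_ext (by simp [timeL, spaceL, vertL]) (by simp [timeL, spaceL, vertL])
    (by simp [timeL, spaceL, vertL])

/-- A linear map vanishing on the adapted basis vanishes. -/
theorem jet_linearMap_eq_zero {f : JetModel p n →ₗ[ℝ] ℝ} (hT : ∀ γ, f (timeL (bv γ)) = 0)
    (hX : ∀ j, f (spaceL (bv j)) = 0) (hV : ∀ j γ, f (vertL (vertUnit j γ)) = 0)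
    (w : JetModel p n) : f w = 0 := by
  have h1 : f (timeL w.1.1) = 0 := by
    have e := map_eq_sum (f ∘ₗ timeL) w.1.1
    simp only [LinearMap.comp_apply, hT, smul_zero, Finset.sum_const_zero] at e
    exact e
  have h2 : f (spaceL w.1.2) = 0 := by
    have e := map_eq_sum (f ∘ₗ spaceL) w.1.2
    simp only [LinearMap.comp_apply, hX, smul_zero, Finset.sum_const_zero] at e
    exact e
  have h3 : f (vertL w.2) = 0 := by
    rw [hom_eq_sum w.2, map_sum, map_sum]
    refine Finset.sum_eq_zero fun i _ => ?_
    rw [map_sum, map_sum]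
    refine Finset.sum_eq_zero fun α _ => ?_
    rw [map_smul, map_smul, hV, smul_zero]
  rw [jet_eq_add w, map_add, map_add, h1, h2, h3, add_zero, add_zero]

theorem acomp_bijective (he : e ∈ c.source) : Function.Bijective (S.acomp c e) :=
  ⟨S.acomp_injective he, fun z => ⟨S.alift c (fun _ => z) e, S.acomp_alift he _⟩⟩

/-- The vector with given adapted components. -/
def avec (he : e ∈ c.source) : JetModel p n →ₗ[ℝ] TangentSpace (jetI p n) e :=
  (LinearEquiv.ofBijective (S.acomp c e) (S.acomp_bijective he)).symm.toLinearMap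

theorem avec_acomp (he : e ∈ c.source) (v : TangentSpace (jetI p n) e) :
    S.avec he (S.acomp c e v) = v :=
  (LinearEquiv.ofBijective (S.acomp c e) (S.acomp_bijective he)).symm_apply_apply v

theorem diffFieldAt_alift_const (he : e ∈ c.source) (z : JetModel p n) :
    DiffFieldAt (S.alift c fun _ => z) e :=
  S.diffFieldAt_of_arep he (differentiableAt_const z) fun _ he' => S.acomp_alift he' _

/-- The difference of a linear connection and the Cartan connection. -/
def diffTensor (D : LinearConnection p n T M) (e : J1 p n T M) :
    TangentSpace (jetI p n) e →L[ℝ] TangentSpace (jetI p n) e →L[ℝ] TangentSpace (jetI p n) e :=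
  IsCovariantDerivativeOn.difference D.isCovariantDerivativeOnUniv
    S.cartan.isCovariantDerivativeOnUniv e

theorem diffTensor_apply (D : LinearConnection p n T M)
    {Y : ∀ e : J1 p n T M, TangentSpace (jetI p n) e} (hY : DiffFieldAt Y e)
    (v : TangentSpace (jetI p n) e) :
    S.diffTensor D e (Y e) v = D Y e v - S.cartan Y e v :=
  congrArg (fun f : TangentSpace (jetI p n) e →L[ℝ] TangentSpace (jetI p n) e => f v)
    (IsCovariantDerivativeOn.difference_apply D.isCovariantDerivativeOnUniv
      S.cartan.isCovariantDerivativeOnUniv (Set.mem_univ e) hY)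

/-- The difference tensor in adapted components. -/
def diffForm (D : LinearConnection p n T M) (he : e ∈ c.source) (z : JetModel p n) :
    JetModel p n →ₗ[ℝ] JetModel p n :=
  S.acomp c e ∘ₗ (S.diffTensor D e (S.avec he z)).toLinearMap ∘ₗ S.avec he

variable {D : LinearConnection p n T M}

theorem diffForm_add (he : e ∈ c.source) (z z' w : JetModel p n) :
    S.diffForm D he (z + z') w = S.diffForm D he z w + S.diffForm D he z' w := by
  have h1 : S.diffTensor D e (S.avec he (z + z')) = S.diffTensor D e (S.avec he z)
      + S.diffTensor D e (S.avec he z') :=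
    (congrArg (S.diffTensor D e) (map_add (S.avec he) z z')).trans
      (map_add (S.diffTensor D e) (S.avec he z) (S.avec he z'))
  exact (congrArg (fun f : TangentSpace (jetI p n) e →L[ℝ] TangentSpace (jetI p n) e =>
    S.acomp c e (f (S.avec he w))) h1).trans (map_add (S.acomp c e) _ _)

theorem diffForm_smul (he : e ∈ c.source) (r : ℝ) (z w : JetModel p n) :
    S.diffForm D he (r • z) w = r • S.diffForm D he z w := by
  have h1 : S.diffTensor D e (S.avec he (r • z)) = r • S.diffTensor D e (S.avec he z) :=
    (congrArg (S.diffTensor D e) (map_smul (S.avec he) r z)).trans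
      (map_smul (S.diffTensor D e) r (S.avec he z))
  exact (congrArg (fun f : TangentSpace (jetI p n) e →L[ℝ] TangentSpace (jetI p n) e =>
    S.acomp c e (f (S.avec he w))) h1).trans (map_smul (S.acomp c e) _ _)

/-- The difference tensor in adapted components, as a bilinear map. -/
def diffBil (D : LinearConnection p n T M) (he : e ∈ c.source) :
    JetModel p n →ₗ[ℝ] JetModel p n →ₗ[ℝ] JetModel p n where
  toFun := S.diffForm D he
  map_add' z z' := LinearMap.ext fun w => S.diffForm_add he z z' w
  map_smul' r z := LinearMap.ext fun w => S.diffForm_smul he r z w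

/-- Tensoriality: the difference depends only on the value of the field at `e`, so it can be
evaluated on convenient fields with prescribed adapted components. -/
theorem diffBil_eq (he : e ∈ c.source) {Y : ∀ e : J1 p n T M, TangentSpace (jetI p n) e}
    (hY : DiffFieldAt Y e) (v : TangentSpace (jetI p n) e) :
    S.diffBil D he (S.acomp c e (Y e)) (S.acomp c e v)
      = S.acomp c e (D Y e v) - S.acomp c e (S.cartan Y e v) := by
  have h1 : S.diffBil D he (S.acomp c e (Y e)) (S.acomp c e v)
      = S.acomp c e (S.diffTensor D e (Y e) v) :=
    congrArg₂ (fun a b => S.acomp c e (S.diffTensor D e a b)) (S.avec_acomp he _)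
      (S.avec_acomp he v)
  rw [h1, S.diffTensor_apply D hY v]
  exact map_sub (S.acomp c e) _ _

theorem diffBil_alift (he : e ∈ c.source) (z w : JetModel p n) :
    S.diffBil D he z w = S.acomp c e (D (S.alift c fun _ => z) e (S.alift c (fun _ => w) e))
      - S.acomp c e (S.cartan (S.alift c fun _ => z) e (S.alift c (fun _ => w) e)) := by
  have h1 := S.diffBil_eq (D := D) he (S.diffFieldAt_alift_const he z)
    (S.alift c (fun _ => w) e)
  rwa [S.acomp_alift he, S.acomp_alift he] at h1

/-- If `P` is parallel for both connections, the difference tensor commutes with it. For the three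
projections this says that the difference preserves the adapted decomposition. -/
theorem diffBil_comm (he : e ∈ c.source) (P : ∀ e : J1 p n T M, TangentSpace (jetI p n) e →
    TangentSpace (jetI p n) e) (A : JetModel p n →L[ℝ] JetModel p n)
    (hP : ∀ e ∈ c.source, ∀ v, S.acomp c e (P e v) = A (S.acomp c e v))
    (hD : ∀ Y, DiffFieldAt Y e → ∀ v, D (fun e' => P e' (Y e')) e v = P e (D Y e v))
    (hC : ∀ Y, DiffFieldAt Y e → ∀ v,
      S.cartan (fun e' => P e' (Y e')) e v = P e (S.cartan Y e v)) (z w : JetModel p n) :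
    S.diffBil D he (A z) w = A (S.diffBil D he z w) := by
  have hY := S.diffFieldAt_alift_const he z
  have hPe : ∀ e' ∈ c.source, S.acomp c e' (P e' (S.alift c (fun _ => z) e')) = A z :=
    fun e' he' => by rw [hP e' he', S.acomp_alift he']
  have hPY : DiffFieldAt (fun e' => P e' (S.alift c (fun _ => z) e')) e :=
    S.diffFieldAt_of_arep he (differentiableAt_const (A z)) hPe
  have h1 := S.diffBil_eq (D := D) he hPY (S.alift c (fun _ => w) e)
  rw [hPe e he, S.acomp_alift he, hD _ hY, hC _ hY, hP e he, hP e he, ← map_sub] at h1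
  rw [h1, S.diffBil_alift he z w]

variable (hD : S.IsCartan D)

include hD

/-- The vanishing of `g_{ij|k}` together with the symmetry of `L` is precisely the input of
`eq_koszul`; the vertical analogue follows for each fixed `γ`. -/
theorem coeffL_eq_cartanL (he : e ∈ c.source) (k i j : Fin n) :
    S.coeffL D c k i j e = S.cartanL c (c.coord e) k i j := by
  have hm : ∀ i j k, (∑ l, S.lo c l j (c.coord e) * S.coeffL D c l i k e)
      + ∑ l, S.lo c i l (c.coord e) * S.coeffL D c l j k e
      = S.deltaX c k (S.lo c i j) (c.coord e) := fun i j k => by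
    have := hD.metricalX c e he i j k
    rw [gCovX, sub_sub] at this
    exact (sub_eq_zero.1 this).symm
  exact eq_koszul (lo := fun i j => S.lo c i j (c.coord e))
    (up := fun i j => S.up c i j (c.coord e))
    (d := fun i j k => S.deltaX c k (S.lo c i j) (c.coord e))
    (fun i j => S.lo_symm c i j (c.coord e)) (S.up_mul_lo (coord_mem he))
    (S.lo_mul_up (coord_mem he)) (fun i j k => S.deltaX_lo_symm i j k)
    (A := fun k i j => S.coeffL D c k i j e) (hD.symmL c e he) hm k i j

theorem coeffC_eq_cartanC (he : e ∈ c.source) (k i j : Fin n) (γ : Fin p) :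
    S.coeffC D c k i j γ e = S.cartanC c (c.coord e) γ k i j := by
  have hm : ∀ i j k, (∑ l, S.lo c l j (c.coord e) * S.coeffC D c l i k γ e)
      + ∑ l, S.lo c i l (c.coord e) * S.coeffC D c l j k γ e
      = dV k γ (S.lo c i j) (c.coord e) := fun i j k => by
    have := hD.metricalV c e he i j k γ
    rw [gCovV, sub_sub] at this
    exact (sub_eq_zero.1 this).symm
  exact eq_koszul (lo := fun i j => S.lo c i j (c.coord e))
    (up := fun i j => S.up c i j (c.coord e))
    (d := fun i j k => dV k γ (S.lo c i j) (c.coord e))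
    (fun i j => S.lo_symm c i j (c.coord e)) (S.up_mul_lo (coord_mem he))
    (S.lo_mul_up (coord_mem he)) (fun i j k => S.dV_lo_symm i j k γ)
    (A := fun k i j => S.coeffC D c k i j γ e) (fun k i j => hD.symmC c e he k i j γ) hm k i j

/-- The three prescribed families `Ḡ`, `L̄`, `C̄` cover the three kinds of adapted directions, and
both connections share them. -/
theorem diffBil_timeL_time (he : e ∈ c.source) (a : Vec p) (w : JetModel p n) :
    (S.diffBil D he (timeL a) w).1.1 = 0 := by
  have key : ∀ β α w, (S.diffBil D he (timeL (bv β)) w).1.1 α = 0 := by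
    intro β α w
    refine jet_linearMap_eq_zero (f := (EuclideanSpace.proj α : Vec p →L[ℝ] ℝ).toLinearMap ∘ₗ
      LinearMap.fst ℝ (Vec p) (Vec n) ∘ₗ LinearMap.fst ℝ (Vec p × Vec n) (Vec p →L[ℝ] Vec n) ∘ₗ
      S.diffBil D he (timeL (bv β))) (fun γ => ?_) (fun j => ?_) (fun j γ => ?_) w
    · have h1 := (hD.gbar c e he α β γ).trans (S.gbar_cartan he α β γ).symm
      rw [coeffGbar, coeffGbar, S.frameT_eq, S.frameT_eq] at h1
      exact (congrArg (fun w : JetModel p n => w.1.1 α) (S.diffBil_alift he _ _)).trans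
        (sub_eq_zero.2 h1)
    · have h1 := (hD.lbar c e he α β j).trans (S.lbar_cartan he α β j).symm
      rw [coeffLbar, coeffLbar, S.frameT_eq, S.frameX_eq] at h1
      exact (congrArg (fun w : JetModel p n => w.1.1 α) (S.diffBil_alift he _ _)).trans
        (sub_eq_zero.2 h1)
    · have h1 := (hD.cbar c e he α β j γ).trans (S.cbar_cartan he α β j γ).symm
      rw [coeffCbar, coeffCbar, S.frameT_eq, S.frameV_eq] at h1
      exact (congrArg (fun w : JetModel p n => w.1.1 α) (S.diffBil_alift he _ _)).trans
        (sub_eq_zero.2 h1)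
  ext α
  have e1 := map_eq_sum ((EuclideanSpace.proj α : Vec p →L[ℝ] ℝ).toLinearMap ∘ₗ
      LinearMap.fst ℝ (Vec p) (Vec n) ∘ₗ LinearMap.fst ℝ (Vec p × Vec n) (Vec p →L[ℝ] Vec n) ∘ₗ
      (S.diffBil D he).flip w ∘ₗ timeL) a
  exact e1.trans (Finset.sum_eq_zero fun β _ =>
    (congrArg (a β • ·) (key β α w)).trans (smul_zero (a β)))

theorem diffBil_spaceL_space (he : e ∈ c.source) (u : Vec n) (w : JetModel p n) :
    (S.diffBil D he (spaceL u) w).1.2 = 0 := by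
  have key : ∀ i k w, (S.diffBil D he (spaceL (bv i)) w).1.2 k = 0 := by
    intro i k w
    refine jet_linearMap_eq_zero (f := (EuclideanSpace.proj k : Vec n →L[ℝ] ℝ).toLinearMap ∘ₗ
      LinearMap.snd ℝ (Vec p) (Vec n) ∘ₗ LinearMap.fst ℝ (Vec p × Vec n) (Vec p →L[ℝ] Vec n) ∘ₗ
      S.diffBil D he (spaceL (bv i))) (fun γ => ?_) (fun j => ?_) (fun j γ => ?_) w
    · have h1 := (hD.timeCoeff c e he k i γ).trans (S.coeffG_cartan he k i γ).symm
      rw [coeffG, coeffG, S.frameX_eq, S.frameT_eq] at h1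
      exact (congrArg (fun w : JetModel p n => w.1.2 k) (S.diffBil_alift he _ _)).trans
        (sub_eq_zero.2 h1)
    · have h1 := (S.coeffL_eq_cartanL hD he k i j).trans (S.coeffL_cartan he k i j).symm
      rw [coeffL, coeffL, S.frameX_eq i, S.frameX_eq j] at h1
      exact (congrArg (fun w : JetModel p n => w.1.2 k) (S.diffBil_alift he _ _)).trans
        (sub_eq_zero.2 h1)
    · have h1 := (S.coeffC_eq_cartanC hD he k i j γ).trans (S.coeffC_cartan he k i j γ).symm
      rw [coeffC, coeffC, S.frameX_eq, S.frameV_eq] at h1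
      exact (congrArg (fun w : JetModel p n => w.1.2 k) (S.diffBil_alift he _ _)).trans
        (sub_eq_zero.2 h1)
  ext k
  have e1 := map_eq_sum ((EuclideanSpace.proj k : Vec n →L[ℝ] ℝ).toLinearMap ∘ₗ
      LinearMap.snd ℝ (Vec p) (Vec n) ∘ₗ LinearMap.fst ℝ (Vec p × Vec n) (Vec p →L[ℝ] Vec n) ∘ₗ
      (S.diffBil D he).flip w ∘ₗ spaceL) u
  exact e1.trans (Finset.sum_eq_zero fun i _ =>
    (congrArg (u i • ·) (key i k w)).trans (smul_zero (u i)))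

/-- Commuting with the temporal projection forces the value to be temporal, and its temporal
component is already known to vanish. -/
theorem diffBil_timeL (he : e ∈ c.source) (a : Vec p) (w : JetModel p n) :
    S.diffBil D he (timeL a) w = 0 := by
  have h1 := S.diffBil_comm he (S.projT c) prT (fun _ he' w => S.acomp_projT he' w)
    (hD.projT c e he) (fun _ hY v => S.cartan_projT he hY v) (timeL a) w
  rw [show prT (timeL a : JetModel p n) = timeL a from rfl, prT_apply,
    S.diffBil_timeL_time hD he, map_zero] at h1
  exact h1

theorem diffBil_spaceL (he : e ∈ c.source) (u : Vec n) (w : JetModel p n) :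
    S.diffBil D he (spaceL u) w = 0 := by
  have h1 := S.diffBil_comm he (S.projX c) prX (fun _ he' w => S.acomp_projX he' w)
    (hD.projX c e he) (fun _ hY v => S.cartan_projX he hY v) (spaceL u) w
  rw [show prX (spaceL u : JetModel p n) = spaceL u from rfl, prX_apply,
    S.diffBil_spaceL_space hD he, map_zero] at h1
  exact h1

/-- Vertical vectors are sums of values of `J` on temporal and spatial vectors. Since `J` is
parallel for both connections, their agreement on the horizontal summands propagates to the vertical
one. -/
theorem diffBil_vertL (he : e ∈ c.source) (B : Vec p →L[ℝ] Vec n) (w : JetModel p n) :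
    S.diffBil D he (vertL B) w = 0 := by
  have key : ∀ (a : Vec p) (u : Vec n),
      S.diffBil D he (vertL (rk u (h.flat c.time (c.coord e).1.1 a))) w = 0 := by
    intro a u
    set X := S.alift c fun _ => timeL a
    set Y := S.alift c fun _ => spaceL u
    have hX : DiffFieldAt X e := S.diffFieldAt_alift_const he _
    have hY : DiffFieldAt Y e := S.diffFieldAt_alift_const he _
    have eX : ∀ e' ∈ c.source, S.acomp c e' (X e') = timeL a := fun e' he' => S.acomp_alift he' _
    have eY : ∀ e' ∈ c.source, S.acomp c e' (Y e') = spaceL u := fun e' he' => S.acomp_alift he' _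
    set v := S.alift c (fun _ => w) e
    have hv : S.acomp c e v = w := S.acomp_alift he _
    have dX : D X e v = S.cartan X e v := S.acomp_injective he (sub_eq_zero.1 (by
      rw [← S.diffBil_eq he hX v, eX e he, S.diffBil_timeL hD]))
    have dY : D Y e v = S.cartan Y e v := S.acomp_injective he (sub_eq_zero.1 (by
      rw [← S.diffBil_eq he hY v, eY e he, S.diffBil_spaceL hD]))
    have eJ : ∀ e' ∈ c.source, S.acomp c e' (normalization h c e' (X e') (Y e'))
        = vertL (rk u (h.flat c.time (c.coord e').1.1 a)) := fun e' he' => by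
      rw [S.acomp_normalization he', eX e' he', eY e' he']
      rfl
    have hJ : DiffFieldAt (fun e' => normalization h c e' (X e') (Y e')) e :=
      S.diffFieldAt_of_arep he (Z := fun y => vertL (rk u (h.flat c.time y.1.1 a)))
        ((ContinuousLinearMap.inr ℝ (Vec p × Vec n) (Vec p →L[ℝ] Vec n)).differentiableAt.comp _
          (rk_flat_differentiableAt (h := h) (coord_mem he) (differentiableAt_const a)
            (differentiableAt_const u))) eJ
    have h1 := S.diffBil_eq (D := D) he hJ v
    rw [eJ e he, hv] at h1
    rw [h1, hD.nablaJ c e he X Y hX hY v, S.cartan_nablaJ he hX hY v, dX, dY]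
    exact sub_self _
  rw [hom_eq_sum_rk B, map_sum, map_sum, LinearMap.sum_apply]
  refine Finset.sum_eq_zero fun α _ => ?_
  -- By nondegeneracy of `h` each coordinate covector is the flat of a vector, so each rank one
  -- summand is of the form treated in `key`.
  rw [← h.flat_sharp c.time_mem (coord_mem he).1 (cv α)]
  exact key _ _

theorem IsCartan.apply_eq {Y : ∀ e : J1 p n T M, TangentSpace (jetI p n) e}
    (hY : DiffFieldAt Y e) : D Y e = S.cartan Y e := by
  have he := mem_pref (T := T) (M := M) e
  refine ContinuousLinearMap.ext fun v => S.acomp_injective he (sub_eq_zero.1 ?_)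
  rw [← S.diffBil_eq he hY v, jet_eq_add (S.acomp _ e (Y e)), map_add, map_add,
    LinearMap.add_apply, LinearMap.add_apply, S.diffBil_timeL hD, S.diffBil_spaceL hD,
    S.diffBil_vertL hD, add_zero, add_zero]

end LagrangeSpace
end Uniqueness

end MultiTime

end

theorem mainTheorem5 {p n : ℕ}
    {T : Type*} [TopologicalSpace T] [ChartedSpace (MultiTime.Vec p) T] [IsManifold (𝓡 p) ∞ T]
    {M : Type*} [TopologicalSpace M] [ChartedSpace (MultiTime.Vec n) M] [IsManifold (𝓡 n) ∞ M]
    (h : MultiTime.SemiRiemannianMetric p T) (S : MultiTime.LagrangeSpace n M h) :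
    ∃ D : MultiTime.LinearConnection p n T M,
      S.IsCartan D ∧
      (∀ (c : MultiTime.JetChart p n T M), ∀ e ∈ c.source,
        (∀ i j k : Fin n, S.coeffL D c i j k e
          = ∑ m, S.up c i m (c.coord e) / 2 *
              (S.deltaX c k (S.lo c j m) (c.coord e) + S.deltaX c j (S.lo c k m) (c.coord e)
                - S.deltaX c m (S.lo c j k) (c.coord e))) ∧
        (∀ (i j k : Fin n) (γ : Fin p), S.coeffC D c i j k γ e
          = ∑ m, S.up c i m (c.coord e) / 2 *
              (MultiTime.dV k γ (S.lo c j m) (c.coord e)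
                + MultiTime.dV j γ (S.lo c k m) (c.coord e)
                - MultiTime.dV m γ (S.lo c j k) (c.coord e)))) ∧
      (∀ D' : MultiTime.LinearConnection p n T M, S.IsCartan D' →
        ∀ (Y : ∀ e : MultiTime.J1 p n T M, TangentSpace (MultiTime.jetI p n) e)
          (e : MultiTime.J1 p n T M), MultiTime.DiffFieldAt Y e → D' Y e = D Y e) := by
  -- Agreement is claimed only for fields differentiable at the point, since the axioms of a
  -- covariant derivative do not constrain its values on other fields.
  refine ⟨S.cartan, S.isCartan_cartan S.smooth_cartan, fun c e he => ⟨fun i j k => ?_,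
    fun i j k γ => ?_⟩, fun D' hD' Y e hY => hD'.apply_eq S hY⟩
  · exact S.coeffL_cartan he i j k
  · exact S.coeffC_cartan he i j k γ
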